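/- Let $H\colon \mathsf{Set}\to\mathsf{Set}$ be a functor that is zippable, i.e. for all sets $A,B$ the map $\langle H(A+!),H(!+B)\rangle\colon H(A+B)\to H(A+1)\times H(1+B)$ is injective. Let $H$ be equipped with an encoding, i.e. a set $A$ of labels and maps $\flat\colon HX\to\mathcal B(A\times X)$ (finite bags), one for every set $X$, and with a refinement interface, i.e. a set $W$ and functions $$\mathrm{init}\colon H1\times\mathcal B A\to W,\qquad \mathrm{update}\colon \mathcal B A\times W\to W\times H3\times W$$ for which there are weight maps $w(C)\colon HX\to W$ (for finite $C\subseteq X$) such that, for all $t\in HX$ and all finite sets $S\subseteq C\subseteq X$, $$\mathrm{init}(H!(t),\mathrm{fil}_X(\flat t))=w(X)(t)\ \ (X \text{ finite}),\qquad \mathrm{update}(\mathrm{fil}_S(\flat t),w(C)(t))=\bigl(w(S)(t),\,H\chi_S^C(t),\,w(C\setminus S)(t)\bigr).$$ Here $\mathrm{fil}_S(f)(a)=\sum_{y\in S}f(a,y)$, and $\chi_S^C\colon X\to 3=\{0,1,2\}$ has the value $2$ on $S$, $1$ on $C\setminus S$ and $0$ outside $C$. Assume that $\mathrm{init}$ and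 $\mathrm{update}$ are computed in time linear in the size of the given bag of labels, that $H3$ is linearly ordered, and that elements of $H3$ are compared in constant time. Consider the following algorithm. Its input is the encoding of a coalgebra $\xi\colon X\to HX$ with $X$ finite: the array $\mathrm{type}=H!\cdot\xi\colon X\to H1$, and the array $\mathrm{graph}\colon E\to X\times A\times X$ which lists, for every $x\in X$, the elements $(a,y)$ of the bag $\flat(\xi(x))$ as edges $x\xrightarrow{a}y$. It maintains partitions $X/P$ and $X/Q$ of $X$, a store of weights, and for every edge $e$ the address $\mathrm{lastW}[e]$ of a cell of this store. *Initialization.* For every $x\in X$, store $\mathrm{init}(\mathrm{type}[x],\ell)$, where $\ell$ is the bag of labels of all edges with source $x$, in a new cell $p$, and put $\mathrm{lastW}[e]:=p$ for these edges. Let $X/P$ be $X$ grouped by $\mathrm{type}$, and $X/Q=\{X\}$. *Main loop.* While $X/P$ is properly finer than $X/Q$: pick any block $S$ of $X/P$ with $2|S|\le|C|$, where $C\supseteq S$ is its block in $X/Q$; split $C$ into $S$ and $C\setminus S$ in $X/Q$; call $\mathrm{Split}(S)$. *$\mathrm{Split}(S)$.* Run through the edges $e=x\to y$ with $y\in S$,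 and collect, for every $x$, the list $\mathrm{toSub}[x]$ of these edges and, for every block $B$ of $X/P$, the list of its states $x$ that have such an edge, together with the old address $p_C=\mathrm{lastW}[e]$. For the first such edge of each block $B$, let $v_\emptyset$ be the second component of $\mathrm{update}(\emptyset,z)$, where $z$ is the weight at $\mathrm{lastW}[e]$. Then for every such block $B$ and every collected $x\in B$: compute $(w_S,v,w_{C\setminus S})=\mathrm{update}(\ell,z)$, where $\ell$ is the bag of labels of $\mathrm{toSub}[x]$ and $z$ is the weight at $p_C$; store $w_{C\setminus S}$ at $p_C$ and $w_S$ in a new cell $p_S$; put $\mathrm{lastW}[e]:=p_S$ for $e\in\mathrm{toSub}[x]$; and if $v\ne v_\emptyset$, remove $x$ from $B$. Group the removed states of $B$ by $v$, and insert the groups as new blocks into $X/P$ (deleting $B$ if it became empty). *Implementation.* Grouping a list first computes a possible majority candidate $p$ in linear time (a key that at least half of the elements have, if there is one), and then sorts, by merge sort, only the elements whose key differs from $p$; elements of $H1$ are compared through the injection $H1\to H3$ induced by $0\colon 1\to 3$. Blocks are doubly linked lists with stored lengths, so that insertions, deletions, creation and removal of blocks and finding the block of a state take constant time, as do array accesses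 and arithmetic. The subblock $S$ is picked in constant time; such a choice of $S$ exists, namely the smaller one of the first two subblocks of the first block of $X/Q$ in a maintained list of the blocks of $X/Q$ that are not blocks of $X/P$. **Theorem.** For every finite coalgebra $\xi\colon X\to HX$, every representation of its encoding and every way of picking $S$ within a fixed constant time, the algorithm terminates. Its final partition $X/P$ is the quotient of $(X,\xi)$ modulo behavioural equivalence: two states lie in the same block if and only if they are behaviourally equivalent (i.e. $f(x)=g(y)$ for some coalgebra morphisms $f,g$ from $(X,\xi)$ to a common coalgebra), and $X/P$ carries a coalgebra structure which makes it a simple quotient coalgebra of $(X,\xi)$. With $n=|X|$ states and $m=\sum_{x\in X}|\flat(\xi(x))|$ edges, the running time is $\mathcal O((m+n)\cdot\log n)$: there is a constant $c$, independent of the coalgebra, its representation and the picks (for a given bound on the time of a pick), such that the number of steps is at most $c\,(m+n)\log n$ if $n\ge 2$, and at most $c\,(m+1)$ if $n\le 1$. -/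

import Mathlib

open CategoryTheory

universe u v w

namespace CoalgRefine

/-! ### Set functors, coalgebras, behavioural equivalence -/

/-- The action of a set functor on a map. -/
def fmap (H : Type u ⥤ Type u) {A B : Type u} (f : A → B) : H.obj A → H.obj B :=
  fun t => H.map (TypeCat.ofHom f) t

/-- The one-element set `1`. -/
abbrev One : Type u := PUnit.{u + 1}

/-- The three-element set `3 = {0, 1, 2}`. -/
abbrev Three : Type u := ULift.{u} (Fin 3)

/-- `unzip : H (A + B) → H (A + 1) × H (1 + B)`, with components `H (A + !)` and `H (! + B)`. -/
def unzip (H : Type u ⥤ Type u) (A B : Type u) (t : H.obj (A ⊕ B)) :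
    H.obj (A ⊕ One.{u}) × H.obj (One.{u} ⊕ B) :=
  (fmap H (Sum.map (id : A → A) (fun _ : B => (PUnit.unit : One.{u}))) t,
   fmap H (Sum.map (fun _ : A => (PUnit.unit : One.{u})) (id : B → B)) t)

/-- A set functor is zippable if every `unzip` map is a monomorphism, that is, injective. -/
def Zippable (H : Type u ⥤ Type u) : Prop :=
  ∀ A B : Type u, Function.Injective (unzip H A B)

/-- The coalgebra `(X, ξ)` given by a structure map `ξ : X → H X`. -/
def coalg (H : Type u ⥤ Type u) {X : Type u} (ξ : X → H.obj X) : Endofunctor.Coalgebra H where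
  V := X
  str := TypeCat.ofHom ξ

/-- Two states of a coalgebra are behaviourally equivalent if some pair of coalgebra morphisms
with a common codomain merges them. -/
def BehaviourallyEquivalent (H : Type u ⥤ Type u) {X : Type u} (ξ : X → H.obj X) (x y : X) :
    Prop :=
  ∃ (Z : Endofunctor.Coalgebra H) (f g : coalg H ξ ⟶ Z), f.f x = g.f y

/-- A coalgebra is simple if it has no non-trivial quotients: every surjective coalgebra morphism
out of it is bijective. -/
def IsSimple {H : Type u ⥤ Type u} (Y : Endofunctor.Coalgebra H) : Prop :=
  ∀ (Z : Endofunctor.Coalgebra H) (q : Y ⟶ Z), Function.Surjective q.f → Function.Bijective q.f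

/-! ### Encodings and refinement interfaces -/

/-- An encoding of a set functor: a set of labels and, for every set `X`, a map
`♭ : H X → B (A × X)` into finite bags. No naturality is required. -/
structure FunctorEncoding (H : Type u ⥤ Type u) where
  Label : Type v
  flat : ∀ X : Type u, H.obj X → Multiset (Label × X)

open Classical in
/-- `fil_S : B (A × X) → B A`, `fil_S f a = ∑_{y ∈ S} f (a, y)`. -/
noncomputable def fil {A : Type v} {X : Type u} (S : Set X) (f : Multiset (A × X)) : Multiset A :=
  (f.filter (fun p => p.2 ∈ S)).map Prod.fst

open Classical in
/-- The three-valued characteristic map `χ_S^C` of `S ⊆ C ⊆ X`: it is `2` on `S`, `1` on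
`C \ S` and `0` outside `C`. -/
noncomputable def chi {X : Type u} (S C : Set X) (x : X) : Three.{u} :=
  ULift.up (if x ∈ S then 2 else if x ∈ C then 1 else 0)

/-- A refinement interface for a functor with an encoding. The weight map `w C : H X → W` is only
constrained for finite `C ⊆ X`. -/
structure RefinementInterface {H : Type u ⥤ Type u} (enc : FunctorEncoding.{u, v} H) where
  W : Type w
  init : H.obj One.{u} × Multiset enc.Label → W
  update : Multiset enc.Label × W → W × H.obj Three.{u} × W
  exists_weight : ∃ wt : ∀ X : Type u, Set X → H.obj X → W,
    (∀ (X : Type u) [Finite X] (t : H.obj X),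
      init (fmap H (fun _ => PUnit.unit) t, fil Set.univ (enc.flat X t)) = wt X Set.univ t) ∧
    (∀ (X : Type u) (S C : Set X), C.Finite → S ⊆ C → ∀ t : H.obj X,
      update (fil S (enc.flat X t), wt X C t) =
        (wt X S t, fmap H (chi S C) t, wt X (C \ S) t))

/-- Running times of an implementation of `init`, of `update` (on bags given as lists), and of the
comparison of two elements of `H 3`. -/
structure RefinementInterface.Timing {H : Type u ⥤ Type u} {enc : FunctorEncoding.{u, v} H}
    (R : RefinementInterface.{u, v, w} enc) where
  initTime : H.obj One.{u} → List enc.Label → ℕ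
  updateTime : List enc.Label → R.W → ℕ
  compareTime : H.obj Three.{u} → H.obj Three.{u} → ℕ

/-- `init` and `update` run in time linear in the size of the given bag of labels (a weight and an
element of `H 1` occupy one memory cell), and elements of `H 3` are compared in constant time. -/
def RefinementInterface.Timing.Linear {H : Type u ⥤ Type u} {enc : FunctorEncoding.{u, v} H}
    {R : RefinementInterface.{u, v, w} enc} (T : R.Timing) : Prop :=
  ∃ c : ℕ, (∀ b l, T.initTime b l ≤ c * (l.length + 1)) ∧
    (∀ l x, T.updateTime l x ≤ c * (l.length + 1)) ∧ (∀ a b, T.compareTime a b ≤ c)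

/-! ### Step-counted computations

A computation with memory `σ` either faults (`none`) or returns a value, the new memory and the
number of steps made. -/

/-- Step-counted imperative computations with memory `σ` and result `α`. -/
def Comp (σ : Type*) (α : Type*) := σ → Option (α × σ × ℕ)

namespace Comp

variable {σ : Type*} {α β : Type*}

/-- Return a value. -/
def ret (a : α) : Comp σ α := fun s => some (a, s, 0)

/-- Abort with a fault. -/
def fault : Comp σ α := fun _ => none

/-- Sequential composition; the step counts add up. -/
def bind (p : Comp σ α) (k : α → Comp σ β) : Comp σ β := fun s =>
  match p s with
  | none => none
  | some (a, s', t) =>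
    match k a s' with
    | none => none
    | some (b, s'', t') => some (b, s'', t + t')

/-- Spend `k` steps. -/
def tick (k : ℕ) : Comp σ Unit := fun s => some ((), s, k)

/-- One step that reads from the memory. It is only used for reading one variable or array cell
(for a list: its reference), one of the first two entries of a list, or its stored length. -/
def read (f : σ → α) : Comp σ α := fun s => some (f s, s, 1)

/-- One step that changes the memory. It is only used for the assignment of boundedly many
variables or array cells and for insertions into and deletions from (doubly linked) lists. -/
def write (f : σ → σ) : Comp σ Unit := fun s => some ((), f s, 1)

end Comp

infixl:55 " >>>= " => Comp.bind

/-- `for a ∈ l do p a`, with one step per loop test. -/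
def forEach {σ α : Type*} : List α → (α → Comp σ Unit) → Comp σ Unit
  | [], _ => Comp.tick 1
  | a :: l, p => Comp.tick 1 >>>= fun _ => p a >>>= fun _ => forEach l p

/-- The list of all `f a` for `a ∈ l`, one step per element. -/
def mapList {σ α β : Type*} (f : α → β) : List α → Comp σ (List β)
  | [] => Comp.tick 1 >>>= fun _ => Comp.ret []
  | a :: l => Comp.tick 1 >>>= fun _ => mapList f l >>>= fun r => Comp.ret (f a :: r)

/-! ### Grouping with a possible majority candidate -/

section Grouping

variable {σ : Type*} {Z : Type*} {K : Type*} [LinearOrder K]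

/-- Test `a = b` for keys, at the cost of one comparison. -/
def testEq (cmp : K → K → ℕ) (a b : K) : Comp σ Bool :=
  Comp.tick (cmp a b + 1) >>>= fun _ => Comp.ret (decide (a = b))

/-- Test `a ≤ b` for keys, at the cost of one comparison. -/
def testLe (cmp : K → K → ℕ) (a b : K) : Comp σ Bool :=
  Comp.tick (cmp a b + 1) >>>= fun _ => Comp.ret (decide (a ≤ b))

/-- Majority vote: `c` is the current candidate and `k` its lead. -/
def vote (cmp : K → K → ℕ) (key : Z → K) : List Z → K → ℕ → Comp σ K
  | [], c, _ => Comp.tick 1 >>>= fun _ => Comp.ret c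
  | z :: l, c, k =>
    testEq cmp (key z) c >>>= fun e =>
    if e then vote cmp key l c (k + 1)
    else if k = 0 then vote cmp key l (key z) 1
    else vote cmp key l c (k - 1)

/-- Separate the elements with key `p` from the others. -/
def separate (cmp : K → K → ℕ) (key : Z → K) (p : K) : List Z → Comp σ (List Z × List Z)
  | [] => Comp.tick 1 >>>= fun _ => Comp.ret ([], [])
  | z :: l =>
    testEq cmp (key z) p >>>= fun e =>
    separate cmp key p l >>>= fun r =>
    Comp.tick 1 >>>= fun _ =>
    Comp.ret (if e then (z :: r.1, r.2) else (r.1, z :: r.2))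

/-- A possible majority candidate of the nonempty list `z :: l`: a key that at least half of the
elements have, if there is such a key. If the first key is not one, then a key that at least half
of the elements have is a strict majority in the tail. -/
def majorityCandidate (cmp : K → K → ℕ) (key : Z → K) (z : Z) (l : List Z) : Comp σ K :=
  separate cmp key (key z) (z :: l) >>>= fun r =>
  Comp.tick 1 >>>= fun _ =>
  if r.2.length ≤ r.1.length then Comp.ret (key z) else vote cmp key l (key z) 0

/-- Merge two sorted lists. -/
def merge (cmp : K → K → ℕ) (key : Z → K) : List Z → List Z → Comp σ (List Z)
  | [], r => Comp.tick 1 >>>= fun _ => Comp.ret r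
  | a :: l, [] => Comp.tick 1 >>>= fun _ => Comp.ret (a :: l)
  | a :: l, b :: r =>
    testLe cmp (key a) (key b) >>>= fun e =>
    if e then merge cmp key l (b :: r) >>>= fun m => Comp.tick 1 >>>= fun _ => Comp.ret (a :: m)
    else merge cmp key (a :: l) r >>>= fun m => Comp.tick 1 >>>= fun _ => Comp.ret (b :: m)
termination_by l r => l.length + r.length

/-- Merge sort by key; cutting the list into halves costs one step per element. -/
def sort (cmp : K → K → ℕ) (key : Z → K) : List Z → Comp σ (List Z)
  | [] => Comp.tick 1 >>>= fun _ => Comp.ret []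
  | [a] => Comp.tick 1 >>>= fun _ => Comp.ret [a]
  | a :: b :: l =>
    Comp.tick (l.length + 2) >>>= fun _ =>
    sort cmp key ((a :: b :: l).take ((l.length + 2) / 2)) >>>= fun l₁ =>
    sort cmp key ((a :: b :: l).drop ((l.length + 2) / 2)) >>>= fun l₂ =>
    merge cmp key l₁ l₂
termination_by l => l.length
decreasing_by
  all_goals simp only [List.length_take, List.length_drop, List.length_cons]; omega

/-- Cut a list into maximal runs of consecutive elements with equal keys. -/
def cutRuns (cmp : K → K → ℕ) (key : Z → K) : List Z → Comp σ (List (List Z))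
  | [] => Comp.tick 1 >>>= fun _ => Comp.ret []
  | a :: l =>
    cutRuns cmp key l >>>= fun gs =>
    Comp.tick 1 >>>= fun _ =>
    match gs with
    | (b :: g) :: gs' =>
      testEq cmp (key a) (key b) >>>= fun e =>
      Comp.ret (if e then (a :: b :: g) :: gs' else [a] :: (b :: g) :: gs')
    | gs => Comp.ret ([a] :: gs)

/-- Group a list by key: only the elements whose key differs from a possible majority candidate
are sorted. -/
def group (cmp : K → K → ℕ) (key : Z → K) : List Z → Comp σ (List (List Z))
  | [] => Comp.tick 1 >>>= fun _ => Comp.ret []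
  | z :: l =>
    majorityCandidate cmp key z l >>>= fun p =>
    separate cmp key p (z :: l) >>>= fun r =>
    sort cmp key r.2 >>>= fun l' =>
    cutRuns cmp key l' >>>= fun gs =>
    Comp.ret (r.1 :: gs)

end Grouping

/-! ### The data structures of the algorithm -/

/-- The input: an enumeration of the states, the array `type : X → H 1`, and the array
`graph : E → X × A × X`, where the edges are numbered `0, …, m - 1`. -/
structure Input (H : Type u ⥤ Type u) (A : Type v) (X : Type u) where
  states : List X
  type : X → H.obj One.{u}
  m : ℕ
  graph : Fin m → X × A × X

/-- The input is the encoding of the coalgebra `ξ`: `type = H! ∘ ξ`, and for every state `x`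
the bag `♭ (ξ x)` lists the labels and targets of the edges with source `x`. -/
def Input.Encodes {H : Type u ⥤ Type u} {enc : FunctorEncoding.{u, v} H} {X : Type u}
    [DecidableEq X] (inp : Input H enc.Label X) (ξ : X → H.obj X) : Prop :=
  inp.states.Nodup ∧ (∀ x, x ∈ inp.states) ∧
  (∀ x, inp.type x = fmap H (fun _ => PUnit.unit) (ξ x)) ∧
  (∀ x, ((((List.finRange inp.m).filter (fun e => (inp.graph e).1 = x)).map
    (fun e => (inp.graph e).2) : List (enc.Label × X)) : Multiset (enc.Label × X)) =
      enc.flat X (ξ x))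

/-- The memory of the algorithm. Blocks of `X/P` and of `X/Q` have numbers as names. The partition
`X/Q` is stored as a partition of the set of blocks of `X/P`. Lists store their length. -/
structure Memory (X : Type u) (m : ℕ) (W : Type w) (K : Type u) where
  /-- edges from a state into the current subblock -/
  toSub : X → List (Fin m)
  /-- edges into a state -/
  pred : X → List (Fin m)
  /-- address of the weight belonging to an edge -/
  lastW : Fin m → ℕ
  /-- the store of weights -/
  deref : ℕ → Option W
  /-- the first unused address of the store -/
  nextCell : ℕ
  /-- markings of a block of `X/P` -/
  mark : ℕ → List (X × ℕ)
  /-- the list `M` of blocks with an edge into the current subblock -/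
  touched : List (ℕ × K)
  /-- the list `B_{≠∅}` -/
  moved : List (X × K)
  /-- the block of `X/P` around a state -/
  blk : X → ℕ
  /-- the elements of a block of `X/P` -/
  mem : ℕ → List X
  /-- the first unused name of a block of `X/P` -/
  nextP : ℕ
  /-- the block of `X/Q` around a block of `X/P` -/
  comp : ℕ → ℕ
  /-- the blocks of `X/P` in a block of `X/Q` -/
  sub : ℕ → List ℕ
  /-- the first unused name of a block of `X/Q` -/
  nextQ : ℕ
  /-- the blocks of `X/Q` that consist of at least two blocks of `X/P` -/
  work : List ℕ

/-- The memory before the algorithm starts. -/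
def Memory.empty (X : Type u) (m : ℕ) (W : Type w) (K : Type u) : Memory X m W K where
  toSub := fun _ => []
  pred := fun _ => []
  lastW := fun _ => 0
  deref := fun _ => none
  nextCell := 0
  mark := fun _ => []
  touched := []
  moved := []
  blk := fun _ => 0
  mem := fun _ => []
  nextP := 0
  comp := fun _ => 0
  sub := fun _ => []
  nextQ := 0
  work := []

section Primitives

variable {X : Type u} [DecidableEq X] {m : ℕ} {W : Type w} {K : Type u}

/-- Read a weight; reading an unused cell is a fault. -/
def loadW (p : ℕ) : Comp (Memory X m W K) W :=
  Comp.read (fun s => s.deref p) >>>= fun o =>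
  match o with
  | some x => Comp.ret x
  | none => Comp.fault

def storeW (p : ℕ) (x : W) : Comp (Memory X m W K) Unit :=
  Comp.write fun s => { s with deref := Function.update s.deref p (some x) }

/-- Allocate a new cell with a given weight. -/
def newCell (x : W) : Comp (Memory X m W K) ℕ :=
  Comp.read (fun s => s.nextCell) >>>= fun p =>
  Comp.write (fun s => { s with nextCell := s.nextCell + 1 }) >>>= fun _ =>
  storeW p x >>>= fun _ =>
  Comp.ret p

def setLastW (e : Fin m) (p : ℕ) : Comp (Memory X m W K) Unit :=
  Comp.write fun s => { s with lastW := Function.update s.lastW e p }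

def addToSub (x : X) (e : Fin m) : Comp (Memory X m W K) Unit :=
  Comp.write fun s => { s with toSub := Function.update s.toSub x (e :: s.toSub x) }

def clearToSub (x : X) : Comp (Memory X m W K) Unit :=
  Comp.write fun s => { s with toSub := Function.update s.toSub x [] }

def addPred (y : X) (e : Fin m) : Comp (Memory X m W K) Unit :=
  Comp.write fun s => { s with pred := Function.update s.pred y (e :: s.pred y) }

def addMark (B : ℕ) (x : X) (p : ℕ) : Comp (Memory X m W K) Unit :=
  Comp.write fun s => { s with mark := Function.update s.mark B ((x, p) :: s.mark B) }

def clearMark (B : ℕ) : Comp (Memory X m W K) Unit :=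
  Comp.write fun s => { s with mark := Function.update s.mark B [] }

def clearTouched : Comp (Memory X m W K) Unit :=
  Comp.write fun s => { s with touched := [] }

def addTouched (B : ℕ) (v : K) : Comp (Memory X m W K) Unit :=
  Comp.write fun s => { s with touched := (B, v) :: s.touched }

def clearMoved : Comp (Memory X m W K) Unit :=
  Comp.write fun s => { s with moved := [] }

def addMoved (x : X) (v : K) : Comp (Memory X m W K) Unit :=
  Comp.write fun s => { s with moved := (x, v) :: s.moved }

/-- Remove a state from its block `B` of `X/P`. -/
def removeFromBlock (B : ℕ) (x : X) : Comp (Memory X m W K) Unit :=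
  Comp.write fun s => { s with mem := Function.update s.mem B ((s.mem B).erase x) }

/-- Put a state into the block `B` of `X/P`. -/
def putIntoBlock (B : ℕ) (x : X) : Comp (Memory X m W K) Unit :=
  Comp.write fun s =>
    { s with mem := Function.update s.mem B (x :: s.mem B), blk := Function.update s.blk x B }

/-- Put the block `B` of `X/P` into the block `D` of `X/Q`; if `D` now consists of two blocks, it
enters the list `work`. -/
def attach (D B : ℕ) : Comp (Memory X m W K) Unit :=
  Comp.write fun s =>
    { s with
      comp := Function.update s.comp B D
      sub := Function.update s.sub D (B :: s.sub D)
      work := if (s.sub D).length = 1 then D :: s.work else s.work }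

/-- Remove the block `B` of `X/P` from the block `D` of `X/Q`; if `D` no longer consists of two
blocks, it leaves the list `work`. -/
def detach (D B : ℕ) : Comp (Memory X m W K) Unit :=
  Comp.write fun s =>
    { s with
      sub := Function.update s.sub D ((s.sub D).erase B)
      work := if (s.sub D).length = 2 then s.work.erase D else s.work }

/-- A new name for a block of `X/P`. -/
def newP : Comp (Memory X m W K) ℕ :=
  Comp.read (fun s => s.nextP) >>>= fun B =>
  Comp.write (fun s => { s with nextP := s.nextP + 1 }) >>>= fun _ =>
  Comp.ret B

/-- A new name for a block of `X/Q`. -/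
def newQ : Comp (Memory X m W K) ℕ :=
  Comp.read (fun s => s.nextQ) >>>= fun D =>
  Comp.write (fun s => { s with nextQ := s.nextQ + 1 }) >>>= fun _ =>
  Comp.ret D

/-- Insert a new block with elements `g` into `X/P`, inside the block `D` of `X/Q`. -/
def insertBlock (D : ℕ) (g : List X) : Comp (Memory X m W K) Unit :=
  newP >>>= fun B =>
  forEach g (fun x => putIntoBlock B x) >>>= fun _ =>
  attach D B

end Primitives

/-! ### The algorithm -/

section Algorithm

variable {H : Type u ⥤ Type u} {enc : FunctorEncoding.{u, v} H}
variable (R : RefinementInterface.{u, v, w} enc) (T : R.Timing) [LinearOrder (H.obj Three.{u})]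
variable {X : Type u} [DecidableEq X] (inp : Input H enc.Label X)

/-- The memory used for a given interface and input. -/
abbrev Mem := Memory X inp.m R.W (H.obj Three.{u})

/-- Evaluate `init` on a bag given as a list. -/
def callInit (b : H.obj One.{u}) (l : List enc.Label) : Comp (Mem R inp) R.W :=
  Comp.tick (T.initTime b l + 1) >>>= fun _ => Comp.ret (R.init (b, (l : Multiset enc.Label)))

/-- Evaluate `update` on a bag given as a list and a weight. -/
def callUpdate (l : List enc.Label) (x : R.W) : Comp (Mem R inp) (R.W × H.obj Three.{u} × R.W) :=
  Comp.tick (T.updateTime l x + 1) >>>= fun _ => Comp.ret (R.update ((l : Multiset enc.Label), x))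

/-- The embedding of `H 1` into `H 3` along which elements of `H 1` are compared. -/
def oneToThree (b : H.obj One.{u}) : H.obj Three.{u} := fmap H (fun _ => ULift.up 0) b

/-- The initialization procedure. -/
def setUp : Comp (Mem R inp) Unit :=
  Comp.tick (inp.states.length + inp.m) >>>= fun _ =>
  forEach (List.finRange inp.m) (fun e =>
    Comp.read (fun _ => inp.graph e) >>>= fun xay =>
    addToSub xay.1 e >>>= fun _ =>
    addPred xay.2.2 e) >>>= fun _ =>
  forEach inp.states (fun x =>
    Comp.read (fun s => s.toSub x) >>>= fun es =>
    mapList (fun e => (inp.graph e).2.1) es >>>= fun l =>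
    Comp.read (fun _ => inp.type x) >>>= fun b =>
    callInit R T inp b l >>>= fun wx =>
    newCell wx >>>= fun p =>
    forEach es (fun e => setLastW e p) >>>= fun _ =>
    clearToSub x) >>>= fun _ =>
  group T.compareTime (fun x => oneToThree (inp.type x)) inp.states >>>= fun gs =>
  newQ >>>= fun D =>
  forEach gs (fun g => insertBlock D g)

/-- First part of `Split`: collect the predecessor blocks of the subblock `S`. -/
def collect (S : ℕ) : Comp (Mem R inp) Unit :=
  clearTouched >>>= fun _ =>
  Comp.read (fun s => s.mem S) >>>= fun ys =>
  forEach ys (fun y =>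
    Comp.read (fun s => s.pred y) >>>= fun es =>
    forEach es (fun e =>
      Comp.read (fun _ => (inp.graph e).1) >>>= fun x =>
      Comp.read (fun s => s.blk x) >>>= fun B =>
      Comp.read (fun s => (s.mark B).isEmpty) >>>= fun unmarked =>
      (if unmarked then
        Comp.read (fun s => s.lastW e) >>>= fun p =>
        loadW p >>>= fun wC =>
        callUpdate R T inp [] wC >>>= fun r =>
        addTouched B r.2.1
      else Comp.ret ()) >>>= fun _ =>
      Comp.read (fun s => (s.toSub x).isEmpty) >>>= fun fresh =>
      (if fresh then
        Comp.read (fun s => s.lastW e) >>>= fun p =>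
        addMark B x p
      else Comp.ret ()) >>>= fun _ =>
      addToSub x e))

/-- Second part of `Split`, for one pair `(B, v∅) ∈ M`: split the block `B`. A block whose
elements have all been moved is deleted. -/
def splitBlock (B : ℕ) (v₀ : H.obj Three.{u}) : Comp (Mem R inp) Unit :=
  clearMoved >>>= fun _ =>
  Comp.read (fun s => s.mark B) >>>= fun ms =>
  forEach ms (fun xp =>
    Comp.read (fun s => s.toSub xp.1) >>>= fun es =>
    mapList (fun e => (inp.graph e).2.1) es >>>= fun l =>
    loadW xp.2 >>>= fun wC =>
    callUpdate R T inp l wC >>>= fun r =>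
    storeW xp.2 r.2.2 >>>= fun _ =>
    newCell r.1 >>>= fun pS =>
    forEach es (fun e => setLastW e pS) >>>= fun _ =>
    clearToSub xp.1 >>>= fun _ =>
    testEq T.compareTime r.2.1 v₀ >>>= fun same =>
    if same then Comp.ret ()
    else removeFromBlock B xp.1 >>>= fun _ => addMoved xp.1 r.2.1) >>>= fun _ =>
  clearMark B >>>= fun _ =>
  Comp.read (fun s => s.moved) >>>= fun zs =>
  group T.compareTime Prod.snd zs >>>= fun gs =>
  Comp.read (fun s => s.comp B) >>>= fun D =>
  forEach gs (fun g =>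
    mapList Prod.fst g >>>= fun g' =>
    insertBlock D g') >>>= fun _ =>
  Comp.read (fun s => (s.mem B).isEmpty) >>>= fun gone =>
  if gone then detach D B else Comp.ret ()

/-- The procedure `Split` for the subblock `S`. -/
def split (S : ℕ) : Comp (Mem R inp) Unit :=
  collect R T inp S >>>= fun _ =>
  Comp.read (fun s => s.touched) >>>= fun bs =>
  forEach bs (fun Bv => splitBlock R T inp Bv.1 Bv.2)

/-- The body of the main loop: pick a subblock `S` with compound block `C`, split `C` into `S` and
`C \ S` in `X/Q`, and call `Split`. -/
def loopBody (pick : Comp (Mem R inp) ℕ) : Comp (Mem R inp) Unit :=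
  pick >>>= fun S =>
  Comp.read (fun s => s.comp S) >>>= fun C =>
  detach C S >>>= fun _ =>
  newQ >>>= fun D =>
  attach D S >>>= fun _ =>
  split R T inp S

/-- `WhileLoop c p s s' t`: the loop `while c do p`, started in memory `s`, stops in memory `s'`
after `t` steps. Each evaluation of the loop test takes one step. -/
inductive WhileLoop {σ : Type*} (c : σ → Bool) (p : Comp σ Unit) : σ → σ → ℕ → Prop
  | done (s : σ) : c s = false → WhileLoop c p s s 1
  | step (s s' s'' : σ) (t t' : ℕ) : c s = true → p s = some ((), s', t) →
      WhileLoop c p s' s'' t' → WhileLoop c p s s'' (1 + t + t')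

/-- `Runs R T inp pick s t`: the algorithm (initialization, then the main loop while `X/P` is
properly finer than `X/Q`, i.e. while some block of `X/Q` consists of at least two blocks of
`X/P`) stops in memory `s` after `t` steps. -/
def Runs (pick : Comp (Mem R inp) ℕ) (s : Mem R inp) (t : ℕ) : Prop :=
  ∃ (s₀ : Mem R inp) (t₀ t₁ : ℕ),
    setUp R T inp (Memory.empty X inp.m R.W (H.obj Three.{u})) = some ((), s₀, t₀) ∧
    WhileLoop (fun s : Mem R inp => !s.work.isEmpty) (loopBody R T inp pick) s₀ s t₁ ∧
    t = t₀ + t₁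

end Algorithm

/-! ### Picking the subblock -/

section Picking

variable {X : Type u} {m : ℕ} {W : Type w} {K : Type u}

/-- The memory represents a partition `X/P` together with a coarser partition `X/Q`. -/
def Memory.WellFormed (s : Memory X m W K) : Prop :=
  (∀ B x, x ∈ s.mem B ↔ s.blk x = B) ∧ (∀ B, (s.mem B).Nodup) ∧
  (∀ D B, B ∈ s.sub D ↔ s.mem B ≠ [] ∧ s.comp B = D) ∧ (∀ D, (s.sub D).Nodup) ∧
  (∀ D, D ∈ s.work ↔ 2 ≤ (s.sub D).length) ∧ s.work.Nodup

/-- The number of states in a block of `X/Q`. -/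
def Memory.compSize (s : Memory X m W K) (D : ℕ) : ℕ :=
  ((s.sub D).map fun B => (s.mem B).length).sum

/-- A way of picking a subblock: whenever `X/P` is properly finer than `X/Q`, it returns, within
`k` steps and without changing the memory, a block `S` of `X/P` with at most half as many elements
as the block of `X/Q` around it. -/
def Admissible (k : ℕ) (pick : Comp (Memory X m W K) ℕ) : Prop :=
  ∀ s : Memory X m W K, s.WellFormed → s.work ≠ [] →
    ∃ S t, pick s = some (S, s, t) ∧ t ≤ k ∧ s.mem S ≠ [] ∧
      2 * (s.mem S).length ≤ s.compSize (s.comp S)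

/-- Take the first compound block in the list `work`, and pick the smaller one of its first two
subblocks. -/
def pickSmaller : Comp (Memory X m W K) ℕ :=
  Comp.read (fun s => s.work.head?) >>>= fun o =>
  match o with
  | none => Comp.fault
  | some C =>
    Comp.read (fun s => (s.sub C)[0]?) >>>= fun o₁ =>
    Comp.read (fun s => (s.sub C)[1]?) >>>= fun o₂ =>
    match o₁, o₂ with
    | some B₁, some B₂ =>
      Comp.read (fun s => (s.mem B₁).length) >>>= fun n₁ =>
      Comp.read (fun s => (s.mem B₂).length) >>>= fun n₂ =>
      Comp.tick 1 >>>= fun _ =>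
      Comp.ret (if n₁ ≤ n₂ then B₁ else B₂)
    | _, _ => Comp.fault

end Picking

/-- The memory holds, as its partition `X/P`, the quotient of `(X, ξ)` modulo behavioural
equivalence: the blocks are the classes of behavioural equivalence, and the partition carries the
simple quotient coalgebra. -/
def ComputesQuotient {H : Type u ⥤ Type u} {X : Type u} (ξ : X → H.obj X) {m : ℕ} {W : Type w}
    {K : Type u} (s : Memory X m W K) : Prop :=
  s.WellFormed ∧
  (∀ x y, s.blk x = s.blk y ↔ BehaviourallyEquivalent H ξ x y) ∧
  ∃ (Y : Endofunctor.Coalgebra H) (q : coalg H ξ ⟶ Y),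
    Function.Surjective q.f ∧ (∀ x y : X, q.f x = q.f y ↔ s.blk x = s.blk y) ∧ IsSimple Y

end CoalgRefine

/-! Correctness rests on two invariants of the main loop: behavioural equivalence refines `X/P`, and
states in one block of `X/P` have equal images under `H` applied to the projection `X → X/Q`. Once
the two partitions agree, the second invariant turns `X/P` into the kernel of a coalgebra morphism,
so its blocks consist of equivalent states; by the first, it is behavioural equivalence itself. The
quotient is simple because any further quotient only merges equivalent states (`simple_quotient`).

Let `C` be cut into `S` and `C \ S`. Write the refined quotient as `A + B`, with `A` the other
classes and `B` the two halves. The image of `ξ x` under `H` of the old projection determines its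
component in `H (A + 1)`, and the key `H χ_S^C (ξ x)` determines its component in `H (1 + B)`. By
zippability the two together determine the image for the refined projection
(`Zippable.fmap_splitOff`), so splitting the blocks by the key restores the second invariant. The
first survives because `χ_S^C` is constant on blocks of `X/P`, hence on equivalence classes.

The keys come from the store: for each edge from `x` to `y` it holds the weight of `ξ x` for the
class of `y` in `X/Q` (`Cells`). A state without an edge into `S` has the key `v∅` common to such
states of its block, and its weights need no change, so only predecessors of `S` are visited.

For the running time, collecting and updating cost a constant per state of `S` and per edge into
`S`. As `S` has at most half the size of `C`, a state lies in a picked block at most `log₂ n` times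
(`Input.logPotential_splitOff`). Sorting all moved states would cost a second logarithm; the
majority candidate prevents this. In a block, the states whose edges into `C` all end in `S` share
the key `H χ_C^C`, so at most twice as many elements are sorted as there are marked states with
edges into both `S` and `C \ S` (`ev_group`, `ev_splitBlock`). Each such state adds a new pair of a
source and a reached class of `X/Q`. There are never more than `m` such pairs
(`Input.linkCount_splitOff`), so sorting in the loop costs `O(m log n)` altogether. One potential
combines both counts. It drops by at least the time of each iteration (`ev_loopBody`), which also
gives termination. -/

namespace CoalgRefine

/-! ### Weakest preconditions for step-counted computations -/

/-- The computation `p` started in `s` does not fault, and its result, final memory and step count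
satisfy `Q`. -/
def Comp.Ev {σ α : Type*} (p : Comp σ α) (s : σ) (Q : α → σ → ℕ → Prop) : Prop :=
  ∃ a s' t, p s = some (a, s', t) ∧ Q a s' t

namespace Comp

variable {σ α β : Type*}

theorem Ev.mono {p : Comp σ α} {s : σ} {Q Q' : α → σ → ℕ → Prop} (h : p.Ev s Q)
    (hQ : ∀ a s' t, Q a s' t → Q' a s' t) : p.Ev s Q' := by
  obtain ⟨a, s', t, h1, h2⟩ := h
  exact ⟨a, s', t, h1, hQ _ _ _ h2⟩

@[simp] theorem ev_ret (a : α) (s : σ) (Q : α → σ → ℕ → Prop) :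
    (ret a : Comp σ α).Ev s Q ↔ Q a s 0 := by
  simp [Ev, ret, eq_comm]

@[simp] theorem ev_tick (k : ℕ) (s : σ) (Q : Unit → σ → ℕ → Prop) :
    (tick k : Comp σ Unit).Ev s Q ↔ Q () s k := by
  constructor
  · rintro ⟨_, _, _, h, hQ⟩
    cases h
    exact hQ
  · exact fun h => ⟨_, _, _, rfl, h⟩

@[simp] theorem ev_read (f : σ → α) (s : σ) (Q : α → σ → ℕ → Prop) :
    (read f : Comp σ α).Ev s Q ↔ Q (f s) s 1 := by
  simp [Ev, read, eq_comm]

@[simp] theorem ev_write (f : σ → σ) (s : σ) (Q : Unit → σ → ℕ → Prop) :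
    (write f : Comp σ Unit).Ev s Q ↔ Q () (f s) 1 := by
  constructor
  · rintro ⟨_, _, _, h, hQ⟩
    cases h
    exact hQ
  · exact fun h => ⟨_, _, _, rfl, h⟩

-- With this simp set, `simp` executes straight-line programs symbolically and leaves the
-- postcondition at the final memory, with the step counts summed up.
@[simp] theorem ev_bind (p : Comp σ α) (k : α → Comp σ β) (s : σ) (Q : β → σ → ℕ → Prop) :
    (p >>>= k).Ev s Q ↔ p.Ev s (fun a s' t => (k a).Ev s' (fun b s'' t' => Q b s'' (t + t'))) := by
  constructor
  · rintro ⟨b, s'', t, h, hQ⟩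
    unfold bind at h
    rcases hp : p s with _ | ⟨a, s', t1⟩
    · simp [hp] at h
    · rcases hk : k a s' with _ | ⟨b', s2, t2⟩
      · simp [hp, hk] at h
      · simp only [hp, hk, Option.some.injEq, Prod.mk.injEq] at h
        obtain ⟨rfl, rfl, rfl⟩ := h
        exact ⟨a, s', t1, hp, b', s2, t2, hk, hQ⟩
  · rintro ⟨a, s', t1, hp, b, s2, t2, hk, hQ⟩
    exact ⟨b, s2, t1 + t2, by simp [bind, hp, hk], hQ⟩

end Comp

open CoalgRefine.Comp

variable {σ α β : Type*}

/-- The invariant speaks of the processed prefix, so the induction over the remaining list has to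
carry an arbitrary prefix `pre`. -/
theorem ev_forEach_aux (p : α → Comp σ Unit) (I : List α → σ → Prop) (cost : α → ℕ) :
    ∀ (l pre : List α), (∀ pre' a suf, pre ++ l = pre' ++ a :: suf → ∀ s, I pre' s →
      (p a).Ev s (fun _ s' t => I (pre' ++ [a]) s' ∧ t ≤ cost a)) → ∀ s, I pre s →
    (forEach l p).Ev s (fun _ s' t => I (pre ++ l) s' ∧
      t ≤ (l.map (fun a => cost a + 1)).sum + 1)
  | [], pre, _, s, h0 => by simpa [forEach] using h0
  | a :: l, pre, h, s, h0 => by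
    simp only [forEach, ev_bind, ev_tick]
    refine (h pre a l rfl s h0).mono ?_
    rintro _ s' t ⟨h1, ht⟩
    refine (ev_forEach_aux p I cost l (pre ++ [a]) (by simpa using h) s' h1).mono ?_
    rintro _ s'' t' ⟨h2, ht'⟩
    refine ⟨by simpa using h2, ?_⟩
    simp only [List.map_cons, List.sum_cons]
    omega

/-- The loop rule: `I pre` holds after the elements of `pre` have been processed. -/
theorem ev_forEach {l : List α} {p : α → Comp σ Unit} (I : List α → σ → Prop) (cost : α → ℕ)
    {s : σ} (h0 : I [] s) (h : ∀ pre a suf, l = pre ++ a :: suf → ∀ s, I pre s →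
      (p a).Ev s (fun _ s' t => I (pre ++ [a]) s' ∧ t ≤ cost a)) :
    (forEach l p).Ev s (fun _ s' t => I l s' ∧ t ≤ (l.map (fun a => cost a + 1)).sum + 1) := by
  simpa using ev_forEach_aux p I cost l [] (by simpa using h) s h0

theorem ev_forEach_const {l : List α} {p : α → Comp σ Unit} (I : List α → σ → Prop) (c : ℕ)
    {s : σ} (h0 : I [] s) (h : ∀ pre a suf, l = pre ++ a :: suf → ∀ s, I pre s →
      (p a).Ev s (fun _ s' t => I (pre ++ [a]) s' ∧ t ≤ c)) :
    (forEach l p).Ev s (fun _ s' t => I l s' ∧ t ≤ (c + 1) * l.length + 1) := by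
  refine (ev_forEach I (fun _ => c) h0 h).mono ?_
  rintro _ s' t ⟨h1, h2⟩
  refine ⟨h1, ?_⟩
  simpa [mul_comm] using h2

theorem ev_mapList (f : α → β) (l : List α) (s : σ) :
    (mapList f l : Comp σ (List β)).Ev s (fun r s' t => r = l.map f ∧ s' = s ∧
      t = l.length + 1) := by
  induction l with
  | nil => simp [mapList]
  | cons a l ih =>
    simp only [mapList, ev_bind, ev_tick, ev_ret]
    refine ih.mono ?_
    rintro r s' t ⟨rfl, rfl, rfl⟩
    simp; omega

/-! ### Correctness and running time of grouping -/

section Grouping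

variable {Z : Type*} {K : Type*} [LinearOrder K] {cmp : K → K → ℕ} {c : ℕ}

theorem ev_testEq (hc : ∀ a b, cmp a b ≤ c) (a b : K) (s : σ) :
    (testEq cmp a b : Comp σ Bool).Ev s (fun r s' t => r = decide (a = b) ∧ s' = s ∧
      t ≤ c + 1) := by
  simp [testEq, hc]

theorem ev_testLe (hc : ∀ a b, cmp a b ≤ c) (a b : K) (s : σ) :
    (testLe cmp a b : Comp σ Bool).Ev s (fun r s' t => r = decide (a ≤ b) ∧ s' = s ∧
      t ≤ c + 1) := by
  simp [testLe, hc]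

/-- The lead `k` stands for `k` virtual copies of the candidate `d` put in front of `l`. Both
inequalities say that a key other than the result makes up at most half of this extended list. Each
step either adds a copy of `d` or cancels one against a different key. -/
theorem ev_vote (hc : ∀ a b, cmp a b ≤ c) (key : Z → K) : ∀ (l : List Z) (d : K) (k : ℕ) (s : σ),
    (vote cmp key l d k : Comp σ K).Ev s (fun r s' t => s' = s ∧ t ≤ (c + 1) * l.length + 1 ∧
      (r = d ∨ ∃ z ∈ l, key z = r) ∧
      ∀ q, q ≠ r → (q = d → 2 * l.countP (fun z => key z = q) + k ≤ l.length) ∧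
        (q ≠ d → 2 * l.countP (fun z => key z = q) ≤ l.length + k))
  | [], d, k, s => by
    simp only [vote, ev_bind, ev_tick, ev_ret]
    refine ⟨trivial, by simp, Or.inl trivial, fun q hq => ⟨fun h => absurd h hq, by simp⟩⟩
  | z :: l, d, k, s => by
    simp only [vote, ev_bind]
    refine (ev_testEq hc _ _ s).mono ?_
    rintro e s' t ⟨rfl, rfl, ht⟩
    by_cases h1 : key z = d
    · simp only [h1, decide_true, if_true]
      refine (ev_vote hc key l d (k + 1) s').mono ?_
      rintro r s2 t' ⟨rfl, ht', hr, hq⟩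
      refine ⟨rfl, by simp only [List.length_cons, mul_add]; omega, ?_, fun q hqr => ?_⟩
      · rcases hr with rfl | ⟨z', hz', rfl⟩
        · exact Or.inl rfl
        · exact Or.inr ⟨z', by simp [hz'], rfl⟩
      · have := hq q hqr
        refine ⟨fun h => ?_, fun h => ?_⟩
        · have := this.1 h
          simp [h1, h] at this ⊢
          omega
        · have := this.2 h
          have h' : d ≠ q := fun e => h e.symm
          simp [h1, h'] at this ⊢
          omega
    · simp only [h1, decide_false, Bool.false_eq_true, if_false]
      by_cases h2 : k = 0
      -- With no lead left, the key of `z` becomes the candidate and `z` itself is its single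
      -- virtual copy.
      · subst h2
        simp only [if_true]
        refine (ev_vote hc key l (key z) 1 s').mono ?_
        rintro r s2 t' ⟨rfl, ht', hr, hq⟩
        refine ⟨rfl, by simp only [List.length_cons, mul_add]; omega, ?_, fun q hqr => ?_⟩
        · rcases hr with rfl | ⟨z', hz', rfl⟩
          · exact Or.inr ⟨z, by simp, rfl⟩
          · exact Or.inr ⟨z', by simp [hz'], rfl⟩
        · have h3 := hq q hqr
          by_cases h4 : q = key z
          · have := h3.1 h4
            subst h4
            simp at this ⊢
            omega
          · have := h3.2 h4
            have h' : key z ≠ q := fun e => h4 e.symm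
            simp [h'] at this ⊢
            omega
      · simp only [h2, if_false]
        refine (ev_vote hc key l d (k - 1) s').mono ?_
        rintro r s2 t' ⟨rfl, ht', hr, hq⟩
        refine ⟨rfl, by simp only [List.length_cons, mul_add]; omega, ?_, fun q hqr => ?_⟩
        · rcases hr with rfl | ⟨z', hz', rfl⟩
          · exact Or.inl rfl
          · exact Or.inr ⟨z', by simp [hz'], rfl⟩
        · have h3 := hq q hqr
          refine ⟨fun h => ?_, fun h => ?_⟩
          · have := h3.1 h
            subst h
            simp [h1] at this ⊢
            omega
          · have := h3.2 h
            simp only [List.countP_cons, List.length_cons] at this ⊢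
            split_ifs <;> omega

theorem ev_separate (hc : ∀ a b, cmp a b ≤ c) (key : Z → K) (p : K) (s : σ) : ∀ (l : List Z),
    (separate cmp key p l : Comp σ (List Z × List Z)).Ev s (fun r s' t => s' = s ∧
      t ≤ (c + 2) * l.length + 1 ∧
      r = (l.filter (fun z => key z = p), l.filter (fun z => ¬ key z = p)))
  | [] => by simp [separate]
  | z :: l => by
    simp only [separate, ev_bind, ev_tick, ev_ret]
    refine (ev_testEq hc _ _ s).mono ?_
    rintro e s' t ⟨rfl, rfl, ht⟩
    refine (ev_separate hc key p s' l).mono ?_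
    rintro r s2 t' ⟨rfl, ht', rfl⟩
    refine ⟨rfl, by simp only [List.length_cons, mul_add]; omega, ?_⟩
    by_cases h : key z = p <;> simp [h]

/-- If the first key fills half of the list, all other keys share the remaining half. Otherwise the
first key is excluded by that test, and every other key has all its occurrences in the tail, where
the vote with lead `0` bounds them. -/
theorem ev_majorityCandidate (hc : ∀ a b, cmp a b ≤ c) (key : Z → K) (z : Z) (l : List Z) (s : σ) :
    (majorityCandidate cmp key z l : Comp σ K).Ev s (fun r s' t => s' = s ∧
      t ≤ (2 * c + 3) * (z :: l).length + 3 ∧ (∃ a ∈ z :: l, key a = r) ∧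
      ∀ q, q ≠ r → 2 * (z :: l).countP (fun a => key a = q) ≤ (z :: l).length) := by
  simp only [majorityCandidate, ev_bind, ev_tick]
  refine (ev_separate hc key (key z) s (z :: l)).mono ?_
  rintro r s' t ⟨rfl, ht, rfl⟩
  have e1 : ((z :: l).filter (fun a => key a = key z)).length =
      (z :: l).countP (fun a => key a = key z) := (List.countP_eq_length_filter ..).symm
  have e2 : (z :: l).length = (z :: l).countP (fun a => key a = key z) +
      ((z :: l).filter (fun a => ¬ key a = key z)).length := by
    rw [← List.countP_eq_length_filter]
    have := List.length_eq_countP_add_countP (fun a => decide (key a = key z)) (l := z :: l)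
    simpa using this
  split_ifs with h
  · rw [ev_ret]
    refine ⟨rfl, ?_, ⟨z, by simp, rfl⟩, fun q hq => ?_⟩
    · nlinarith
    · have : (z :: l).countP (fun a => key a = q) ≤
          ((z :: l).filter (fun a => ¬ key a = key z)).length := by
        rw [← List.countP_eq_length_filter]
        refine List.countP_mono_left fun a _ ha => ?_
        simp only [decide_eq_true_eq] at ha ⊢
        rw [ha]; exact hq
      simp only at h
      omega
  · refine (ev_vote hc key l (key z) 0 s').mono ?_
    rintro r s2 t' ⟨rfl, ht', hr, hq⟩
    refine ⟨rfl, ?_, ?_, fun q hqr => ?_⟩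
    · simp only [List.length_cons, mul_add, add_mul] at ht ht' ⊢
      nlinarith
    · rcases hr with rfl | ⟨z', hz', rfl⟩
      · exact ⟨z, by simp, rfl⟩
      · exact ⟨z', by simp [hz'], rfl⟩
    · by_cases h4 : q = key z
      · subst h4
        simp only at h
        omega
      · have := (hq q hqr).2 h4
        have h' : key z ≠ q := fun e => h4 e.symm
        simp [h'] at this ⊢
        omega

theorem ev_merge (hc : ∀ a b, cmp a b ≤ c) (key : Z → K) (s : σ) : ∀ (l r : List Z),
    l.Pairwise (fun a b => key a ≤ key b) → r.Pairwise (fun a b => key a ≤ key b) →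
    (merge cmp key l r : Comp σ (List Z)).Ev s (fun q s' t => s' = s ∧
      t ≤ (c + 2) * (l.length + r.length) + 1 ∧ q.Perm (l ++ r) ∧
      q.Pairwise (fun a b => key a ≤ key b))
  | [], r, _, hr => by simp [merge, hr]
  | a :: l, [], hl, _ => by
    rw [merge]
    simp only [ev_bind, ev_tick, ev_ret]
    exact ⟨trivial, by simp, by simp, hl⟩
  | a :: l, b :: r, hl, hr => by
    rw [merge]
    simp only [ev_bind]
    refine (ev_testLe hc _ _ s).mono ?_
    rintro e s' t ⟨rfl, rfl, ht⟩
    by_cases h : key a ≤ key b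
    · simp only [h, decide_true, if_true, ev_bind, ev_tick, ev_ret]
      refine (ev_merge hc key s' l (b :: r) hl.of_cons hr).mono ?_
      rintro q s2 t' ⟨rfl, ht', hp, hs⟩
      refine ⟨rfl, by simp only [List.length_cons, mul_add] at ht' ⊢; omega, ?_, ?_⟩
      · simpa using hp
      · refine List.pairwise_cons.2 ⟨fun x hx => ?_, hs⟩
        rcases List.mem_append.1 (hp.subset hx) with hx | hx
        · exact (List.pairwise_cons.1 hl).1 x hx
        · rcases List.mem_cons.1 hx with rfl | hx
          · exact h
          · exact h.trans ((List.pairwise_cons.1 hr).1 x hx)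
    · simp only [h, decide_false, Bool.false_eq_true, if_false, ev_bind, ev_tick, ev_ret]
      refine (ev_merge hc key s' (a :: l) r hl hr.of_cons).mono ?_
      rintro q s2 t' ⟨rfl, ht', hp, hs⟩
      refine ⟨rfl, by simp only [List.length_cons, mul_add] at ht' ⊢; omega, ?_, ?_⟩
      · exact (hp.cons b).trans (List.perm_middle.symm)
      · refine List.pairwise_cons.2 ⟨fun x hx => ?_, hs⟩
        rcases List.mem_append.1 (hp.subset hx) with hx | hx
        · rcases List.mem_cons.1 hx with rfl | hx
          · exact (not_le.1 h).le
          · exact (not_le.1 h).le.trans ((List.pairwise_cons.1 hl).1 x hx)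
        · exact (List.pairwise_cons.1 hr).1 x hx
termination_by l r => l.length + r.length

theorem ev_sort (hc : ∀ a b, cmp a b ≤ c) (key : Z → K) (s : σ) : ∀ (l : List Z),
    (sort cmp key l : Comp σ (List Z)).Ev s (fun q s' t => s' = s ∧
      t ≤ (c + 5) * (l.length * (Nat.clog 2 l.length + 1)) + 1 ∧ q.Perm l ∧
      q.Pairwise (fun a b => key a ≤ key b))
  | [] => by rw [sort]; simp
  | [a] => by rw [sort]; simp
  | a :: b :: l => by
    rw [sort]
    simp only [ev_bind, ev_tick]
    set n := l.length with hn
    set L := a :: b :: l with hL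
    have hlen : L.length = n + 2 := by simp [hL, hn]
    refine (ev_sort hc key s (L.take ((n + 2) / 2))).mono ?_
    rintro q s' t ⟨rfl, ht, hp, hs⟩
    refine (ev_sort hc key s' (L.drop ((n + 2) / 2))).mono ?_
    rintro q' s2 t' ⟨rfl, ht', hp', hs'⟩
    refine (ev_merge hc key s2 q q' hs hs').mono ?_
    rintro q2 s3 t2 ⟨rfl, ht2, hp2, hs2⟩
    refine ⟨rfl, ?_, ?_, hs2⟩
    · rw [hp.length_eq, hp'.length_eq] at ht2
      rw [List.length_take] at ht ht2
      rw [List.length_drop] at ht' ht2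
      rw [hlen] at *
      have hm : min ((n + 2) / 2) (n + 2) = (n + 2) / 2 := by omega
      rw [hm] at ht ht2
      -- The ceiling logarithm obeys exactly the recursion of the larger half `⌈(n + 2) / 2⌉`; the
      -- smaller half is handled by monotonicity.
      have hclog : Nat.clog 2 (n + 2) = Nat.clog 2 ((n + 2 + 1) / 2) + 1 := by
        rw [Nat.clog_of_one_lt (by norm_num) (by omega)]
        rfl
      have h2 : n + 2 - (n + 2) / 2 = (n + 2 + 1) / 2 := by omega
      rw [h2] at ht' ht2
      have hmono : Nat.clog 2 ((n + 2) / 2) ≤ Nat.clog 2 ((n + 2 + 1) / 2) :=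
        Nat.clog_mono_right 2 (by omega)
      rw [hclog]
      generalize Nat.clog 2 ((n + 2 + 1) / 2) = g at *
      generalize Nat.clog 2 ((n + 2) / 2) = g' at *
      have hsum : (n + 2) / 2 + (n + 2 + 1) / 2 = n + 2 := by omega
      generalize (n + 2) / 2 = x at *
      generalize (n + 2 + 1) / 2 = y at *
      have e1 : x * (g' + 1) ≤ x * (g + 1) := Nat.mul_le_mul_left _ (by omega)
      have e2 := Nat.mul_le_mul_left (c + 5) e1
      have e3 : (c + 5) * ((n + 2) * (g + 1 + 1)) =
          (c + 5) * (x * (g + 1)) + (c + 5) * (y * (g + 1)) + (c + 5) * (n + 2) := by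
        rw [← hsum]; ring
      -- One level of the recursion brings in `(c + 5) (n + 2)`: the part `c + 2` pays for merging,
      -- and `3 (n + 2)` for cutting and for the additive constants of the three calls.
      have e4 : (c + 5) * (n + 2) = (c + 2) * (x + y) + 3 * (n + 2) := by
        rw [hsum]; ring
      omega
    · refine hp2.trans ((hp.append hp').trans ?_)
      rw [List.take_append_drop]
termination_by l => l.length
decreasing_by
  all_goals simp only [List.length_take, List.length_drop, List.length_cons]; omega

/-- The list `gs` consists of the nonempty groups of elements with equal keys. -/
structure IsGrouping (key : Z → K) (gs : List (List Z)) : Prop where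
  ne_nil : ∀ g ∈ gs, g ≠ []
  key_eq : ∀ g ∈ gs, ∀ a ∈ g, ∀ b ∈ g, key a = key b
  pairwise : gs.Pairwise (fun g g' => ∀ a ∈ g, ∀ b ∈ g', key a ≠ key b)

/-- In a sorted list equal keys are adjacent, so distinct runs have distinct keys. -/
theorem ev_cutRuns (hc : ∀ a b, cmp a b ≤ c) (key : Z → K) (s : σ) : ∀ (l : List Z),
    l.Pairwise (fun a b => key a ≤ key b) →
    (cutRuns cmp key l : Comp σ (List (List Z))).Ev s (fun gs s' t => s' = s ∧
      t ≤ (c + 2) * l.length + 1 ∧ gs.flatten = l ∧ IsGrouping key gs)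
  | [], _ => by
    simp only [cutRuns, ev_bind, ev_tick, ev_ret]
    exact ⟨trivial, by simp, rfl, ⟨by simp, by simp, by simp⟩⟩
  | a :: l, hl => by
    simp only [cutRuns, ev_bind, ev_tick]
    refine (ev_cutRuns hc key s l hl.of_cons).mono ?_
    rintro gs s' t ⟨rfl, ht, hf, hg⟩
    rcases gs with _ | ⟨_ | ⟨b, g⟩, gs⟩
    · simp only [ev_ret]
      simp only [List.flatten_nil] at hf
      subst hf
      exact ⟨trivial, by simp at ht ⊢; omega, rfl, ⟨by simp, by simp, by simp⟩⟩
    · exact absurd rfl (hg.ne_nil [] (by simp))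
    · simp only [ev_bind, ev_ret]
      refine (ev_testEq hc _ _ s').mono ?_
      rintro e s2 t2 ⟨rfl, rfl, ht2⟩
      refine ⟨rfl, by simp only [List.length_cons, mul_add]; omega, ?_, ?_⟩
      · by_cases h : key a = key b <;> simp [h, ← hf]
      · have hle := (List.pairwise_cons.1 hl)
        have hpw := (List.pairwise_cons.1 hg.pairwise)
        by_cases h : key a = key b
        · simp only [h, decide_true, if_true]
          refine ⟨?_, ?_, ?_⟩
          · intro g' hg'
            rcases List.mem_cons.1 hg' with rfl | hg'
            · simp
            · exact hg.ne_nil g' (by simp [hg'])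
          · intro g' hg'
            rcases List.mem_cons.1 hg' with rfl | hg'
            · have : ∀ x ∈ a :: b :: g, key x = key b := by
                intro x hx
                rcases List.mem_cons.1 hx with rfl | hx
                · exact h
                · exact hg.key_eq _ (by simp) x hx b (by simp)
              intro x hx y hy
              rw [this x hx, this y hy]
            · exact hg.key_eq g' (by simp [hg'])
          · refine List.pairwise_cons.2 ⟨fun g' hg' x hx y hy => ?_, hpw.2⟩
            rcases List.mem_cons.1 hx with rfl | hx
            · rw [h]
              exact hpw.1 g' hg' b (by simp) y hy
            · exact hpw.1 g' hg' x hx y hy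
        · simp only [h, decide_false, Bool.false_eq_true, if_false]
          refine ⟨?_, ?_, ?_⟩
          · intro g' hg'
            rcases List.mem_cons.1 hg' with rfl | hg'
            · simp
            · exact hg.ne_nil g' hg'
          · intro g' hg'
            rcases List.mem_cons.1 hg' with rfl | hg'
            · simp
            · exact hg.key_eq g' hg'
          · refine List.pairwise_cons.2 ⟨fun g' hg' x hx y hy e => ?_, hg.pairwise⟩
            rw [List.mem_singleton] at hx
            subst hx
            have hb : b ∈ l := by rw [← hf]; simp
            have hy' : y ∈ l := by
              rw [← hf]; exact List.mem_flatten.2 ⟨g', hg', hy⟩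
            -- The key of `x` is strictly below that of the next element and hence below all later
            -- keys: no later run can share it.
            have hlt : key x < key b := lt_of_le_of_ne (hle.1 b hb) h
            have hby : key b ≤ key y := by
              have h5 : (((b :: g) :: gs).flatten).Pairwise (fun a b => key a ≤ key b) := by
                rw [hf]; exact hle.2
              rw [List.flatten_cons, List.cons_append, List.pairwise_cons] at h5
              rcases List.mem_cons.1 hg' with rfl | hg'
              · rcases List.mem_cons.1 hy with rfl | hy
                · exact le_rfl
                · exact h5.1 y (by simp [hy])
              · exact h5.1 y (List.mem_append_right _ (List.mem_flatten.2 ⟨g', hg', hy⟩))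
            exact absurd e (hlt.trans_le hby).ne

/-- Grouping: linear time plus the time for sorting `N` elements, where `N` is at most twice the
number of elements whose key differs from any given key. -/
theorem ev_group (hc : ∀ a b, cmp a b ≤ c) (key : Z → K) (s : σ) (l : List Z) :
    (group cmp key l : Comp σ (List (List Z))).Ev s (fun gs s' t => s' = s ∧
      (∃ N, t ≤ (4 * c + 13) * (l.length + 1) + (c + 5) * (N * (Nat.clog 2 N + 1)) ∧
        N ≤ l.length ∧ ∀ q, N ≤ 2 * l.countP (fun z => ¬ key z = q)) ∧
      gs.flatten.Perm l ∧ IsGrouping key gs) := by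
  rcases l with _ | ⟨z, l⟩
  · simp only [group, ev_bind, ev_tick, ev_ret]
    exact ⟨trivial, ⟨0, by simp, by simp, by simp⟩, by simp, ⟨by simp, by simp, by simp⟩⟩
  · simp only [group, ev_bind, ev_ret]
    refine (ev_majorityCandidate hc key z l s).mono ?_
    rintro p s' t1 ⟨rfl, ht1, ⟨a, ha, hap⟩, hmaj⟩
    refine (ev_separate hc key p s' (z :: l)).mono ?_
    rintro r s2 t2 ⟨rfl, ht2, rfl⟩
    refine (ev_sort hc key s2 _).mono ?_
    rintro l' s3 t3 ⟨rfl, ht3, hp, hs⟩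
    refine (ev_cutRuns hc key s3 l' hs).mono ?_
    rintro gs s4 t4 ⟨rfl, ht4, hf, hg⟩
    have hmem : ∀ g ∈ gs, ∀ y ∈ g, ¬ key y = p := fun g hgm y hy => by
      have : y ∈ l' := by rw [← hf]; exact List.mem_flatten.2 ⟨g, hgm, hy⟩
      have := hp.subset this
      simpa using (List.mem_filter.1 this).2
    refine ⟨rfl, ⟨((z :: l).filter (fun z => ¬ key z = p)).length, ?_, List.length_filter_le _ _,
      fun q => ?_⟩, ?_, ?_, ?_, ?_⟩
    · have hle : ((z :: l).filter (fun z => ¬ key z = p)).length ≤ (z :: l).length :=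
        List.length_filter_le _ _
      rw [hp.length_eq] at ht4
      simp only at ht1 ht2 ht3 ht4
      generalize ((z :: l).filter (fun z => ¬ key z = p)).length = N at *
      generalize (z :: l).length = k at *
      have := Nat.mul_le_mul_left (c + 2) hle
      simp only [add_mul, mul_add] at *
      nlinarith
    -- For `q = p` exactly the elements with a key different from `q` are sorted. Any other `q` is
    -- the key of at most half of the list, so even the whole list is at most twice as long as the
    -- rest.
    · by_cases hq : q = p
      · subst hq
        rw [← List.countP_eq_length_filter]
        omega
      · have h1 := hmaj q hq
        have h2 := List.length_eq_countP_add_countP (fun a => decide (key a = q)) (l := z :: l)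
        have h3 : ((z :: l).filter (fun z => ¬ key z = p)).length ≤ (z :: l).length :=
          List.length_filter_le _ _
        simp only [decide_not, decide_eq_true_eq] at *
        have h4 : (z :: l).countP (fun a => !decide (key a = q)) =
          (z :: l).countP (fun a => decide (decide (key a = q) = false)) := by
          congr 1; ext a; simp
        omega
    · rw [List.flatten_cons, hf]
      refine (List.Perm.append_left _ hp).trans ?_
      have := List.filter_append_perm (fun z => decide (key z = p)) (z :: l)
      simpa using this
    · intro g hgm
      rcases List.mem_cons.1 hgm with rfl | hgm
      · exact List.ne_nil_of_mem (a := a) (by simpa [hap] using ha)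
      · exact hg.ne_nil g hgm
    · intro g hgm
      rcases List.mem_cons.1 hgm with rfl | hgm
      · intro x hx y hy
        simp only [List.mem_filter, decide_eq_true_eq] at hx hy
        rw [hx.2, hy.2]
      · exact hg.key_eq g hgm
    · refine List.pairwise_cons.2 ⟨fun g hgm x hx y hy e => ?_, hg.pairwise⟩
      simp only [List.mem_filter, decide_eq_true_eq] at hx
      exact hmem g hgm y hy (e ▸ hx.2)

end Grouping

/-! ### Coalgebraic facts -/

section Coalgebra

variable {H : Type u ⥤ Type u}

theorem fmap_fmap {A B C : Type u} (f : A → B) (g : B → C) (t : H.obj A) :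
    fmap H g (fmap H f t) = fmap H (fun a => g (f a)) t := by
  unfold fmap
  have : TypeCat.ofHom (fun a => g (f a)) = TypeCat.ofHom f ≫ TypeCat.ofHom g := rfl
  rw [this, H.map_comp]
  rfl

theorem fmap_congr {A B : Type u} {f g : A → B} (h : ∀ a, f a = g a) (t : H.obj A) :
    fmap H f t = fmap H g t := by
  rw [funext h]

theorem fmap_id (A : Type u) (t : H.obj A) : fmap H (fun a : A => a) t = t := by
  unfold fmap
  have : TypeCat.ofHom (fun a : A => a) = 𝟙 A := rfl
  rw [this, H.map_id]
  rfl

/-- Maps that factor through `f` identify what `H f` identifies. -/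
theorem fmap_eq_of_factors {A B C : Type u} {f : A → B} {p : A → C}
    (hp : ∀ a b, f a = f b → p a = p b) (a₀ : A) {t t' : H.obj A} (h : fmap H f t = fmap H f t') :
    fmap H p t = fmap H p t' := by
  -- The factor of `p` through `f` needs a value outside the range of `f`; the point `a₀` provides
  -- it.
  have e : ∀ a, Function.extend f p (fun _ => p a₀) (f a) = p a := fun a =>
    Function.FactorsThrough.extend_apply (fun a b hab => hp a b hab) _ a
  have := congrArg (fmap H (Function.extend f p (fun _ => p a₀))) h
  rwa [fmap_fmap, fmap_fmap, fmap_congr e, fmap_congr e] at this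

variable {X : Type u} {ξ : X → H.obj X}

/-- A coalgebra morphism from its underlying map. -/
def homMk {Y : Type u} {ζ : Y → H.obj Y} (f : X → Y) (h : ∀ x, fmap H f (ξ x) = ζ (f x)) :
    coalg H ξ ⟶ coalg H ζ where
  f := TypeCat.ofHom f
  h := by
    ext x
    exact h x

/-- Behaviourally equivalent states are identified by a single morphism. -/
theorem BehaviourallyEquivalent.exists_merge {x y : X} (h : BehaviourallyEquivalent H ξ x y) :
    ∃ (Z : Type u) (ζ : Z → H.obj Z) (f : X → Z), (∀ a, fmap H f (ξ a) = ζ (f a)) ∧ f x = f y := by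
  obtain ⟨⟨Z, ζ'⟩, f, g, hfg⟩ := h
  let ζ : Z → H.obj Z := fun z => ζ' z
  let F : X → Z := f.f
  let G : X → Z := g.f
  have hf : ∀ a, fmap H F (ξ a) = ζ (F a) := fun a => congrArg (fun g => g a) f.h
  have hg : ∀ a, fmap H G (ξ a) = ζ (G a) := fun a => congrArg (fun g => g a) g.h
  -- The quotient by `r` is the coequalizer of `F` and `G`. It inherits a coalgebra structure
  -- because `F` and `G` are morphisms, and both become the same map into it.
  let r : Z → Z → Prop := fun a b => ∃ s, F s = a ∧ G s = b
  have e : (fun s : X => Quot.mk r (F s)) = fun s => Quot.mk r (G s) :=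
    funext fun s => Quot.sound ⟨s, rfl, rfl⟩
  refine ⟨Quot r, Quot.lift (fun z => fmap H (Quot.mk r) (ζ z)) ?_, fun s => Quot.mk r (F s),
    fun a => ?_, (congrArg (Quot.mk r) hfg).trans (congrFun e y).symm⟩
  · rintro _ _ ⟨s, rfl, rfl⟩
    rw [← hf, ← hg, fmap_fmap, fmap_fmap, e]
  · change _ = fmap H (Quot.mk r) (ζ (F a))
    rw [← hf, fmap_fmap]

theorem behaviourallyEquivalent_of_merge {x y : X} {Z : Type u} {ζ : Z → H.obj Z} {f : X → Z}
    (hf : ∀ a, fmap H f (ξ a) = ζ (f a)) (h : f x = f y) : BehaviourallyEquivalent H ξ x y :=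
  ⟨coalg H ζ, homMk f hf, homMk f hf, h⟩

/-- A map that is constant on the classes of behavioural equivalence sends behaviourally
equivalent states to equal values of `H`. -/
theorem BehaviourallyEquivalent.fmap_eq {x y : X} (h : BehaviourallyEquivalent H ξ x y)
    {Y : Type u} {p : X → Y} (hp : ∀ a b, BehaviourallyEquivalent H ξ a b → p a = p b) :
    fmap H p (ξ x) = fmap H p (ξ y) := by
  obtain ⟨Z, ζ, f, hf, hxy⟩ := h.exists_merge
  refine fmap_eq_of_factors (f := f)
    (fun a b hab => hp a b (behaviourallyEquivalent_of_merge hf hab)) x ?_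
  rw [hf, hf, hxy]

/-- The map into natural numbers as a map into a type of the universe of `X`. -/
def lifted (q : X → ℕ) (x : X) : ULift.{u} ℕ := ⟨q x⟩

theorem lifted_inj {q : X → ℕ} {a b : X} : lifted q a = lifted q b ↔ q a = q b := by
  simp [lifted]

/-- A stable partition that is coarser than behavioural equivalence is the simple quotient. -/
theorem simple_quotient {q : X → ℕ}
    (h1 : ∀ a b, q a = q b → fmap H (lifted q) (ξ a) = fmap H (lifted q) (ξ b))
    (h2 : ∀ a b, BehaviourallyEquivalent H ξ a b → q a = q b) :
    (∀ a b, q a = q b ↔ BehaviourallyEquivalent H ξ a b) ∧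
    ∃ (Y : Endofunctor.Coalgebra H) (f : coalg H ξ ⟶ Y), Function.Surjective f.f ∧
      (∀ a b : X, f.f a = f.f b ↔ q a = q b) ∧ IsSimple Y := by
  let r : Setoid X := Setoid.ker q
  let mk : X → Quotient r := Quotient.mk r
  have hmk : ∀ a b, mk a = mk b ↔ q a = q b := fun a b => Quotient.eq (r := r)
  let ζ : Quotient r → H.obj (Quotient r) := Quotient.lift (fun x => fmap H mk (ξ x))
    (fun a b hab => fmap_eq_of_factors (f := lifted q)
      (fun c d hcd => (hmk c d).2 (lifted_inj.1 hcd)) a (h1 a b hab))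
  have hζ : ∀ a, fmap H mk (ξ a) = ζ (mk a) := fun a => rfl
  have hbe : ∀ a b, q a = q b ↔ BehaviourallyEquivalent H ξ a b := fun a b =>
    ⟨fun h => behaviourallyEquivalent_of_merge hζ ((hmk a b).2 h), h2 a b⟩
  refine ⟨hbe, coalg H ζ, homMk mk hζ, Quotient.mk_surjective, hmk, ?_⟩
  rintro Z p hp
  refine ⟨fun a b hab => ?_, hp⟩
  obtain ⟨a, rfl⟩ := Quotient.mk_surjective a
  obtain ⟨b, rfl⟩ := Quotient.mk_surjective b
  -- States merged by a further quotient `p` are merged by a morphism out of `X`, so they are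
  -- behaviourally equivalent and already equal in the quotient.
  exact (hmk a b).2 (h2 a b ⟨Z, homMk mk hζ ≫ p, homMk mk hζ ≫ p, hab⟩)

open Classical in
/-- The partition obtained by splitting off the class `S`, with the new name `D`. -/
noncomputable def splitOff (q : X → ℕ) (S : Set X) (D : ℕ) (y : X) : ℕ := if y ∈ S then D else q y

/-- This is where zippability enters: refining `q` at the single class `c` needs, besides the old
information, only the three-valued characteristic map of `S` in that class. -/
theorem Zippable.fmap_splitOff (hH : Zippable H) {q : X → ℕ} {S : Set X} {c : ℕ} (D : ℕ)
    (hS : ∀ y ∈ S, q y = c) {t t' : H.obj X} (hq : fmap H (lifted q) t = fmap H (lifted q) t')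
    (hc : fmap H (chi S {y | q y = c}) t = fmap H (chi S {y | q y = c}) t') :
    fmap H (lifted (splitOff q S D)) t = fmap H (lifted (splitOff q S D)) t' := by
  classical
  -- The refined partition with values in `A + B`: the left summand names the classes other than
  -- `c`, the right one tells `S` from the rest of `c`. Collapsing the right summand gives a map
  -- that factors through `q`, and collapsing the left one a map that factors through `chi`.
  let k : X → ULift.{u} ℕ ⊕ ULift.{u} Bool := fun y =>
    if q y = c then Sum.inr ⟨decide (y ∈ S)⟩ else Sum.inl ⟨q y⟩
  have hk : fmap H k t = fmap H k t' := by
    apply hH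
    unfold unzip
    rw [fmap_fmap, fmap_fmap, fmap_fmap, fmap_fmap]
    refine Prod.ext ?_ ?_
    · let g : ULift.{u} ℕ → ULift.{u} ℕ ⊕ One.{u} := fun d =>
        if d.down = c then Sum.inr PUnit.unit else Sum.inl d
      have e : ∀ y, g (lifted q y) =
          Sum.map (id : ULift.{u} ℕ → ULift.{u} ℕ) (fun _ => (PUnit.unit : One.{u})) (k y) := by
        intro y
        by_cases h : q y = c <;> simp [g, k, lifted, h]
      have := congrArg (fmap H g) hq
      rwa [fmap_fmap, fmap_fmap, fmap_congr e, fmap_congr e] at this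
    · let g : Three.{u} → One.{u} ⊕ ULift.{u} Bool := fun d =>
        if d.down = 2 then Sum.inr ⟨true⟩ else if d.down = 1 then Sum.inr ⟨false⟩
        else Sum.inl PUnit.unit
      have e : ∀ y, g (chi S {y | q y = c} y) = Sum.map (fun _ => (PUnit.unit : One.{u}))
          (id : ULift.{u} Bool → ULift.{u} Bool) (k y) := by
        intro y
        by_cases h : y ∈ S
        · simp [g, k, chi, h, hS y h]
        · by_cases h' : q y = c <;> simp [g, k, chi, h, h']
      have := congrArg (fmap H g) hc
      rwa [fmap_fmap, fmap_fmap, fmap_congr e, fmap_congr e] at this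
  let g : ULift.{u} ℕ ⊕ ULift.{u} Bool → ULift.{u} ℕ :=
    Sum.elim id (fun b => if b.down then ⟨D⟩ else ⟨c⟩)
  have e : ∀ y, g (k y) = lifted (splitOff q S D) y := by
    intro y
    by_cases h : y ∈ S
    · simp [g, k, lifted, splitOff, h, hS y h]
    · by_cases h' : q y = c <;> simp [g, k, lifted, splitOff, h, h']
  have := congrArg (fmap H g) hk
  rwa [fmap_fmap, fmap_fmap, fmap_congr e, fmap_congr e] at this

/-- Three-valued characteristic maps of unions of classes factor through the partition. -/
theorem fmap_chi_eq {q : X → ℕ} {S C : Set X} (hS : ∀ a b, q a = q b → (a ∈ S ↔ b ∈ S))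
    (hC : ∀ a b, q a = q b → (a ∈ C ↔ b ∈ C)) (a₀ : X) {t t' : H.obj X}
    (hq : fmap H (lifted q) t = fmap H (lifted q) t') :
    fmap H (chi S C) t = fmap H (chi S C) t' := by
  refine fmap_eq_of_factors (f := lifted q) (fun a b hab => ?_) a₀ hq
  have := lifted_inj.1 hab
  have h1 := hS a b this
  have h2 := hC a b this
  by_cases h : b ∈ S <;> by_cases h' : b ∈ C <;> simp [chi, h1, h2, h, h']

end Coalgebra

/-! ### Consequences of the weight laws for states with no edges into a set -/

section Weights

variable {H : Type u ⥤ Type u} {enc : FunctorEncoding.{u, v} H}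

/-- The laws of the weight maps on the set `X`. -/
structure RefinementInterface.IsWeight (R : RefinementInterface.{u, v, w} enc) {X : Type u}
    (wt : Set X → H.obj X → R.W) : Prop where
  init_eq : ∀ t, R.init (fmap H (fun _ => PUnit.unit) t, fil Set.univ (enc.flat X t)) =
    wt Set.univ t
  update_eq : ∀ S C : Set X, S ⊆ C → ∀ t, R.update (fil S (enc.flat X t), wt C t) =
    (wt S t, fmap H (chi S C) t, wt (C \ S) t)

theorem RefinementInterface.exists_isWeight (R : RefinementInterface.{u, v, w} enc) (X : Type u)
    [Finite X] : ∃ wt : Set X → H.obj X → R.W, R.IsWeight wt := by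
  obtain ⟨wt, h1, h2⟩ := R.exists_weight
  exact ⟨wt X, h1 X, fun S C h t => h2 X S C C.toFinite h t⟩

theorem fil_empty {A : Type v} {X : Type u} (f : Multiset (A × X)) : fil ∅ f = 0 := by
  simp [fil]

theorem fil_diff {A : Type v} {X : Type u} {S C : Set X} (h : S ⊆ C) (f : Multiset (A × X)) :
    fil S f + fil (C \ S) f = fil C f := by
  classical
  unfold fil
  rw [← Multiset.map_add]
  congr 1
  induction f using Multiset.induction_on with
  | empty => simp
  | cons a f ih =>
    have hs := @h a.2
    by_cases h1 : a.2 ∈ S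
    · simp [h1, hs h1, ← ih]
    · by_cases h2 : a.2 ∈ C <;> simp [h1, h2, ← ih]

variable {R : RefinementInterface.{u, v, w} enc} {X : Type u} {wt : Set X → H.obj X → R.W}

/-- The case `S = ∅` of the update law. It identifies the value `v∅` computed by the algorithm as
the key for `χ_∅^C`. -/
theorem RefinementInterface.IsWeight.update_zero (hw : R.IsWeight wt) (C : Set X) (t : H.obj X) :
    R.update (0, wt C t) = (wt ∅ t, fmap H (chi ∅ C) t, wt C t) := by
  have := hw.update_eq ∅ C (Set.empty_subset _) t
  rwa [fil_empty, Set.sdiff_empty] at this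

/-- With no labels into `S`, the calls of `update` for `S` and for `∅` have the same arguments. This
is why states without an edge into `S` need not be visited. -/
theorem RefinementInterface.IsWeight.of_fil_eq_zero (hw : R.IsWeight wt) {S C : Set X} (h : S ⊆ C)
    {t : H.obj X} (ht : fil S (enc.flat X t) = 0) :
    fmap H (chi S C) t = fmap H (chi ∅ C) t ∧ wt (C \ S) t = wt C t := by
  have h1 := hw.update_eq S C h t
  rw [ht, hw.update_zero, Prod.mk.injEq, Prod.mk.injEq] at h1
  exact ⟨h1.2.1.symm, h1.2.2.symm⟩

/-- When all edges into `C` end in `S`, the calls of `update` for `S` and for `C` coincide. Such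
states therefore share one key within a block, and this key bounds the work of sorting. -/
theorem RefinementInterface.IsWeight.of_fil_diff_eq_zero (hw : R.IsWeight wt) {S C : Set X}
    (h : S ⊆ C) {t : H.obj X} (ht : fil (C \ S) (enc.flat X t) = 0) :
    fmap H (chi S C) t = fmap H (chi C C) t := by
  have h1 := hw.update_eq S C h t
  have h2 := hw.update_eq C C subset_rfl t
  rw [← fil_diff h, ht, add_zero, h1, Prod.mk.injEq, Prod.mk.injEq] at h2
  exact h2.2.1

end Weights

/-! ### The stored partitions -/

section Partition

variable {X : Type u} {m : ℕ} {W : Type w} {K : Type u}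

/-- The stored partitions, while the states in `Z` have been taken out of their blocks and the
blocks in `Y` have not been deleted yet even if they are empty. -/
structure Memory.Hole (Z : Set X) (Y : Set ℕ) (s : Memory X m W K) : Prop where
  mem_iff : ∀ B x, x ∈ s.mem B ↔ s.blk x = B ∧ x ∉ Z
  mem_nodup : ∀ B, (s.mem B).Nodup
  sub_iff : ∀ D B, B ∈ s.sub D ↔ (s.mem B ≠ [] ∨ B ∈ Y) ∧ s.comp B = D
  sub_nodup : ∀ D, (s.sub D).Nodup
  work_iff : ∀ D, D ∈ s.work ↔ 2 ≤ (s.sub D).length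
  work_nodup : s.work.Nodup
  blk_lt : ∀ x, x ∉ Z → s.blk x < s.nextP
  dirty_lt : ∀ B ∈ Y, B < s.nextP
  fresh : ∀ D, s.nextQ ≤ D → s.sub D = []

theorem Memory.Hole.wellFormed {s : Memory X m W K} (h : s.Hole ∅ ∅) : s.WellFormed :=
  ⟨by simpa using h.mem_iff, h.mem_nodup, by simpa using h.sub_iff, h.sub_nodup, h.work_iff,
    h.work_nodup⟩

theorem Memory.Hole.mem_nextP {Z : Set X} {Y : Set ℕ} {s : Memory X m W K} (h : s.Hole Z Y)
    {B : ℕ} (hB : s.nextP ≤ B) : s.mem B = [] := by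
  refine List.eq_nil_iff_forall_not_mem.2 fun x hx => ?_
  obtain ⟨h1, h2⟩ := (h.mem_iff _ _).1 hx
  have := h.blk_lt x h2
  omega

theorem Memory.Hole.not_mem_sub {Z : Set X} {Y : Set ℕ} {s : Memory X m W K} (h : s.Hole Z Y)
    {B : ℕ} (hB : s.nextP ≤ B) (D : ℕ) : B ∉ s.sub D := by
  intro hx
  rcases ((h.sub_iff _ _).1 hx).1 with h1 | h1
  · exact h1 (h.mem_nextP hB)
  · have := h.dirty_lt B h1
    omega

theorem Memory.Hole.comp_lt {Z : Set X} {Y : Set ℕ} {s : Memory X m W K} (h : s.Hole Z Y)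
    {x : X} (hx : x ∉ Z) : s.comp (s.blk x) < s.nextQ := by
  by_contra hlt
  have h1 := h.fresh _ (not_lt.1 hlt)
  have h2 : x ∈ s.mem (s.blk x) := (h.mem_iff _ _).2 ⟨rfl, hx⟩
  have h3 := (h.sub_iff (s.comp (s.blk x)) (s.blk x)).2 ⟨Or.inl (List.ne_nil_of_mem h2), rfl⟩
  rw [h1] at h3
  simp at h3

/-- The parts of the memory concerning edges and weights agree. -/
structure Memory.SameEdges (s s' : Memory X m W K) : Prop where
  toSub : s'.toSub = s.toSub
  pred : s'.pred = s.pred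
  lastW : s'.lastW = s.lastW
  deref : s'.deref = s.deref
  nextCell : s'.nextCell = s.nextCell
  mark : s'.mark = s.mark

/-- The memory after `insertBlock D g`. -/
def Memory.inserted [DecidableEq X] (s : Memory X m W K) (D : ℕ) (g : List X) : Memory X m W K :=
  { s with
    nextP := s.nextP + 1
    mem := Function.update s.mem s.nextP (g.reverse ++ s.mem s.nextP)
    blk := fun x => if x ∈ g then s.nextP else s.blk x
    comp := Function.update s.comp s.nextP D
    sub := Function.update s.sub D (s.nextP :: s.sub D)
    work := if (s.sub D).length = 1 then D :: s.work else s.work }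

theorem ev_insertBlock [DecidableEq X] (D : ℕ) (g : List X) (s : Memory X m W K) :
    (insertBlock D g).Ev s (fun _ s' t => s' = s.inserted D g ∧ t ≤ 2 * g.length + 4) := by
  simp only [insertBlock, newP, Comp.ev_bind, Comp.ev_read, Comp.ev_write, Comp.ev_ret]
  refine (ev_forEach_const (fun pre s' => s' = { s with
    nextP := s.nextP + 1
    mem := Function.update s.mem s.nextP (pre.reverse ++ s.mem s.nextP)
    blk := fun x => if x ∈ pre then s.nextP else s.blk x }) 1 ?_ ?_).mono ?_
  · simp
  · rintro pre a suf _ s' rfl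
    simp only [putIntoBlock, Comp.ev_write, le_refl, and_true]
    congr 1
    · funext x
      by_cases h : x = a
      · subst h; simp
      · simp [h]
    · simp
  · rintro _ s' t ⟨rfl, ht⟩
    simp only [attach, Comp.ev_write]
    refine ⟨rfl, by omega⟩

/-- The name `nextP` belongs neither to an occupied nor to a dirty block, so filling it disturbs no
other block. Taking `D` below `nextQ` keeps the unused names of `X/Q` free. -/
theorem Memory.Hole.inserted [DecidableEq X] {Z : Set X} {Y : Set ℕ} {s : Memory X m W K} (h : s.Hole Z Y)
    {D : ℕ} (hD : D < s.nextQ) {g : List X} (hg : g ≠ []) (hnd : g.Nodup) (hZ : ∀ x ∈ g, x ∈ Z) :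
    (s.inserted D g).Hole (Z \ {x | x ∈ g}) Y := by
  have hm := h.mem_nextP le_rfl
  have hn := fun D => h.not_mem_sub le_rfl D
  refine ⟨fun B x => ?_, fun B => ?_, fun D' B => ?_, fun D' => ?_, fun D' => ?_, ?_,
    fun x hx => ?_, fun B hB => ?_, fun D' hD' => ?_⟩
  · simp only [Memory.inserted, Set.mem_sdiff, Set.mem_ofPred_eq, not_and, not_not]
    by_cases hB : B = s.nextP
    · subst hB
      simp only [hm, Function.update_self, List.append_nil, List.mem_reverse]
      by_cases hx : x ∈ g
      · simp [hx]
      · simp only [hx, if_false, imp_false, false_iff, not_and, not_not]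
        intro hb
        by_contra hxZ
        exact absurd hb (h.blk_lt x hxZ).ne
    · rw [Function.update_of_ne hB, h.mem_iff]
      by_cases hx : x ∈ g
      · simp [hx, hZ x hx, Ne.symm hB]
      · simp [hx]
  · simp only [Memory.inserted]
    by_cases hB : B = s.nextP
    · subst hB
      simpa [hm] using hnd
    · rw [Function.update_of_ne hB]
      exact h.mem_nodup B
  · simp only [Memory.inserted]
    by_cases hB : B = s.nextP
    · subst hB
      simp only [Function.update_self, hm, List.append_nil, ne_eq, List.reverse_eq_nil_iff, hg,
        not_false_eq_true, true_or, true_and]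
      by_cases hDD : D' = D
      · subst hDD; simp
      · rw [Function.update_of_ne hDD]
        exact iff_of_false (hn D') (Ne.symm hDD)
    · rw [Function.update_of_ne hB, Function.update_of_ne hB, ← h.sub_iff]
      by_cases hDD : D' = D
      · subst hDD; simp [hB]
      · rw [Function.update_of_ne hDD]
  · simp only [Memory.inserted]
    by_cases hDD : D' = D
    · subst hDD; simpa using ⟨hn D', h.sub_nodup D'⟩
    · rw [Function.update_of_ne hDD]
      exact h.sub_nodup D'
  · simp only [Memory.inserted]
    by_cases hDD : D' = D
    · subst hDD
      have := h.work_iff D'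
      split_ifs with h1
      · simp; omega
      · simp only [Function.update_self, List.length_cons, this]; omega
    · rw [Function.update_of_ne hDD, ← h.work_iff]
      split_ifs <;> simp [hDD]
  · simp only [Memory.inserted]
    split_ifs with h1
    · refine List.nodup_cons.2 ⟨fun hm => ?_, h.work_nodup⟩
      have := (h.work_iff D).1 hm
      omega
    · exact h.work_nodup
  · simp only [Memory.inserted]
    by_cases hxg : x ∈ g
    · simp [hxg]
    · have := h.blk_lt x fun hxZ => hx ⟨hxZ, hxg⟩
      simp only [hxg, if_false]; omega
  · exact (h.dirty_lt B hB).trans (Nat.lt_succ_self _)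
  · simp only [Memory.inserted] at hD' ⊢
    rw [Function.update_of_ne (by omega)]
    exact h.fresh D' hD'

/-- `s'` arises from `s` by inserting the groups `gs` of states from `Z` as new blocks into the
block `D` of `X/Q`. -/
structure Memory.Inserted (s : Memory X m W K) (Z : Set X) (Y : Set ℕ) (D : ℕ)
    (gs : List (List X)) (s' : Memory X m W K) : Prop where
  hole : s'.Hole (Z \ {x | x ∈ gs.flatten}) Y
  edges : s.SameEdges s'
  nextQ_eq : s'.nextQ = s.nextQ
  nextP_le : s.nextP ≤ s'.nextP
  blk_old : ∀ x, x ∉ gs.flatten → s'.blk x = s.blk x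
  blk_new : ∀ x ∈ gs.flatten, s.nextP ≤ s'.blk x ∧ s'.blk x < s'.nextP ∧ s'.comp (s'.blk x) = D
  comp_old : ∀ B < s.nextP, s'.comp B = s.comp B
  mem_old : ∀ B < s.nextP, s'.mem B = s.mem B
  blk_eq : ∀ g ∈ gs, ∀ x ∈ g, ∀ y ∈ gs.flatten, s'.blk y = s'.blk x ↔ y ∈ g

theorem Memory.Inserted.nil {s : Memory X m W K} {Z : Set X} {Y : Set ℕ} (D : ℕ)
    (h : s.Hole Z Y) : s.Inserted Z Y D [] s :=
  ⟨by simpa using h, ⟨rfl, rfl, rfl, rfl, rfl, rfl⟩, rfl, le_rfl, by simp, by simp, by simp,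
    by simp, by simp⟩

/-- Earlier groups carry names below the current `nextP`, which becomes the name of `g`; hence
states of different groups get different blocks. -/
theorem Memory.Inserted.snoc [DecidableEq X] {s s' : Memory X m W K} {Z : Set X} {Y : Set ℕ} {D : ℕ}
    {gs : List (List X)} (h : s.Inserted Z Y D gs s') (hD : D < s.nextQ) {g : List X}
    (hg : g ≠ []) (hnd : (gs ++ [g]).flatten.Nodup) (hZ : ∀ x ∈ g, x ∈ Z) :
    s.Inserted Z Y D (gs ++ [g]) (s'.inserted D g) := by
  simp only [List.flatten_append, List.flatten_cons, List.flatten_nil, List.append_nil] at hnd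
  obtain ⟨hnd1, hnd2, hnd3⟩ := List.nodup_append.1 hnd
  have hdis : ∀ x, x ∈ g → x ∉ gs.flatten := fun x hx hx' => hnd3 x hx' x hx rfl
  have hfl : ∀ x, x ∈ (gs ++ [g]).flatten ↔ x ∈ gs.flatten ∨ x ∈ g := by simp
  have hP := h.nextP_le
  refine ⟨?_, ⟨h.edges.toSub, h.edges.pred, h.edges.lastW, h.edges.deref, h.edges.nextCell,
    h.edges.mark⟩, h.nextQ_eq, hP.trans (Nat.le_succ _), fun x hx => ?_, fun x hx => ?_,
    fun B hB => ?_, fun B hB => ?_, ?_⟩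
  · have := h.hole.inserted (by rw [h.nextQ_eq]; exact hD) hg hnd2
      (fun x hx => ⟨hZ x hx, hdis x hx⟩)
    convert this using 1
    ext x
    simp only [Set.mem_sdiff, Set.mem_ofPred_eq, hfl]
    tauto
  · rw [hfl, not_or] at hx
    simp only [Memory.inserted, hx.2, if_false]
    exact h.blk_old x hx.1
  · simp only [Memory.inserted]
    by_cases hxg : x ∈ g
    · simp [hxg, hP]
    · rw [hfl] at hx
      have := h.blk_new x (hx.resolve_right hxg)
      simp only [hxg, if_false]
      rw [Function.update_of_ne (by omega)]
      exact ⟨this.1, by omega, this.2.2⟩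
  · simp only [Memory.inserted]
    rw [Function.update_of_ne (by omega)]
    exact h.comp_old B hB
  · simp only [Memory.inserted]
    rw [Function.update_of_ne (by omega)]
    exact h.mem_old B hB
  · intro g' hg' x hx y hy
    rw [hfl] at hy
    simp only [Memory.inserted]
    rcases List.mem_append.1 hg' with hg' | hg'
    · have hxf : x ∈ gs.flatten := List.mem_flatten.2 ⟨g', hg', hx⟩
      have hxg : x ∉ g := fun h => hdis x h hxf
      by_cases hyg : y ∈ g
      · have h1 := h.blk_new x hxf
        simp only [hyg, hxg, if_true, if_false]
        refine iff_of_false (by omega) fun hy' => hdis y hyg (List.mem_flatten.2 ⟨g', hg', hy'⟩)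
      · simp only [hyg, hxg, if_false]
        exact h.blk_eq g' hg' x hx y (hy.resolve_right hyg)
    · rw [List.mem_singleton] at hg'
      subst hg'
      simp only [hx, if_true]
      by_cases hyg : y ∈ g'
      · simp [hyg]
      · have h1 := h.blk_new y (hy.resolve_right hyg)
        simp only [hyg, if_false, iff_false]
        omega

/-- Taking states out of a block. -/
theorem Memory.Hole.takeOut {s s' : Memory X m W K} (h : s.Hole ∅ ∅) {B : ℕ} (hB : s.mem B ≠ [])
    {Z : Set X} (hZ : ∀ x ∈ Z, s.blk x = B)
    (hnd : (s'.mem B).Nodup) (hmem : ∀ x, x ∈ s'.mem B ↔ x ∈ s.mem B ∧ x ∉ Z)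
    (hmem' : ∀ B', B' ≠ B → s'.mem B' = s.mem B')
    (h1 : s'.blk = s.blk) (h2 : s'.nextP = s.nextP) (h3 : s'.comp = s.comp) (h4 : s'.sub = s.sub)
    (h5 : s'.nextQ = s.nextQ) (h6 : s'.work = s.work) : s'.Hole Z {B} := by
  refine ⟨fun B' x => ?_, fun B' => ?_, fun D' B' => ?_, ?_, ?_, ?_, fun x hx => ?_, ?_, ?_⟩
  · by_cases hBB : B' = B
    · subst hBB
      rw [hmem, h.mem_iff, h1]
      simp
    · rw [hmem' _ hBB, h.mem_iff, h1]
      simp only [Set.mem_empty_iff_false, not_false_eq_true, and_true, iff_self_and]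
      rintro rfl hx
      exact hBB (hZ x hx)
  · by_cases hBB : B' = B
    · subst hBB
      exact hnd
    · rw [hmem' _ hBB]
      exact h.mem_nodup B'
  · rw [h4, h.sub_iff, h3]
    by_cases hBB : B' = B
    · subst hBB; simp [hB]
    · simp [hmem' _ hBB, hBB]
  · rw [h4]; exact h.sub_nodup
  · rw [h4, h6]; exact h.work_iff
  · rw [h6]; exact h.work_nodup
  · rw [h1, h2]; exact h.blk_lt x (by simp)
  · rintro _ rfl
    obtain ⟨x, hx⟩ := List.exists_mem_of_ne_nil _ hB
    have := (h.mem_iff _ _).1 hx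
    rw [h2, ← this.1]
    exact h.blk_lt x (by simp)
  · rw [h4, h5]; exact h.fresh

theorem length_erase_eq {l : List ℕ} {a : ℕ} (h : a ∈ l) : (l.erase a).length + 1 = l.length := by
  rw [List.length_erase_of_mem h]
  have := List.length_pos_of_mem h
  omega

/-- Deleting an empty block. -/
theorem Memory.Hole.detach {s : Memory X m W K} {B : ℕ} (h : s.Hole ∅ {B}) (hB : s.mem B = []) :
    ({ s with
      sub := Function.update s.sub (s.comp B) ((s.sub (s.comp B)).erase B)
      work := if (s.sub (s.comp B)).length = 2 then s.work.erase (s.comp B) else s.work } :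
      Memory X m W K).Hole ∅ ∅ := by
  have hin : B ∈ s.sub (s.comp B) := (h.sub_iff _ _).2 ⟨Or.inr rfl, rfl⟩
  have hlen := length_erase_eq hin
  refine ⟨h.mem_iff, h.mem_nodup, fun D' B' => ?_, fun D' => ?_, fun D' => ?_, ?_, h.blk_lt,
    by simp, fun D' hD' => ?_⟩
  · simp only [Set.mem_empty_iff_false, or_false]
    by_cases hDD : D' = s.comp B
    · subst hDD
      rw [Function.update_self, (h.sub_nodup _).mem_erase_iff, h.sub_iff, Set.mem_singleton_iff]
      by_cases hBB : B' = B
      · subst hBB; simp [hB]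
      · simp [hBB]
    · rw [Function.update_of_ne hDD, h.sub_iff, Set.mem_singleton_iff]
      by_cases hBB : B' = B
      · subst hBB; simp [Ne.symm hDD]
      · simp [hBB]
  · simp only
    by_cases hDD : D' = s.comp B
    · subst hDD
      rw [Function.update_self]
      exact (h.sub_nodup _).erase _
    · rw [Function.update_of_ne hDD]
      exact h.sub_nodup _
  · simp only
    by_cases hDD : D' = s.comp B
    · subst hDD
      rw [Function.update_self]
      have := h.work_iff (s.comp B)
      split_ifs with h1
      · rw [h.work_nodup.mem_erase_iff]; simp; omega
      · rw [this]; omega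
    · rw [Function.update_of_ne hDD, ← h.work_iff]
      split_ifs
      · rw [h.work_nodup.mem_erase_iff]; simp [hDD]
      · rfl
  · simp only
    split_ifs
    · exact h.work_nodup.erase _
    · exact h.work_nodup
  · simp only at hD' ⊢
    have : s.comp B < s.nextQ := by
      by_contra hlt
      rw [h.fresh _ (not_lt.1 hlt)] at hin
      simp at hin
    rw [Function.update_of_ne (by omega)]
    exact h.fresh D' hD'

/-- The memory after the block `S` of `X/P` has been made a block of `X/Q` of its own. -/
def Memory.isolated (s : Memory X m W K) (S : ℕ) : Memory X m W K :=
  { s with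
    nextQ := s.nextQ + 1
    comp := Function.update s.comp S s.nextQ
    sub := Function.update (Function.update s.sub (s.comp S) ((s.sub (s.comp S)).erase S)) s.nextQ
      [S]
    work := if (s.sub (s.comp S)).length = 2 then s.work.erase (s.comp S) else s.work }

/-- The new name of a block of `X/Q` has an empty list of subblocks, so attaching `S` to it leaves
`work` alone. The four steps are one for `detach`, two for `newQ` and one for `attach`. -/
theorem ev_isolate {s : Memory X m W K} (h : s.Hole ∅ ∅) {S : ℕ} (hS : s.mem S ≠ [])
    {p : Comp (Memory X m W K) Unit} {Q : Unit → Memory X m W K → ℕ → Prop}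
    (hp : p.Ev (s.isolated S) (fun a s' t => Q a s' (t + 4))) :
    (detach (s.comp S) S >>>= fun _ => newQ >>>= fun D => attach D S >>>= fun _ => p).Ev s Q := by
  have hin : S ∈ s.sub (s.comp S) := (h.sub_iff _ _).2 ⟨Or.inl hS, rfl⟩
  have hlt : s.comp S < s.nextQ := by
    by_contra hlt
    rw [h.fresh _ (not_lt.1 hlt)] at hin
    simp at hin
  simp only [newQ, CoalgRefine.detach, attach, Comp.ev_bind, Comp.ev_read, Comp.ev_write,
    Comp.ev_ret]
  rw [Function.update_of_ne hlt.ne', h.fresh _ le_rfl]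
  refine hp.mono fun a s' t hQ => ?_
  convert hQ using 1
  omega

theorem Memory.Hole.isolated {s : Memory X m W K} (h : s.Hole ∅ ∅) {S : ℕ} (hS : s.mem S ≠ []) :
    (s.isolated S).Hole ∅ ∅ := by
  have hin : S ∈ s.sub (s.comp S) := (h.sub_iff _ _).2 ⟨Or.inl hS, rfl⟩
  have hlen := length_erase_eq hin
  have hlt : s.comp S < s.nextQ := by
    by_contra hlt
    rw [h.fresh _ (not_lt.1 hlt)] at hin
    simp at hin
  have hQw : s.nextQ ∉ s.work := fun hw => by
    have := (h.work_iff _).1 hw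
    rw [h.fresh _ le_rfl] at this
    simp at this
  refine ⟨h.mem_iff, h.mem_nodup, fun D' B' => ?_, fun D' => ?_, fun D' => ?_, ?_, h.blk_lt,
    by simp, fun D' hD' => ?_⟩
  · simp only [Memory.isolated, Set.mem_empty_iff_false, or_false]
    by_cases hD : D' = s.nextQ
    · subst hD
      rw [Function.update_self, List.mem_singleton]
      by_cases hBB : B' = S
      · subst hBB; simp [hS]
      · rw [Function.update_of_ne hBB]
        refine iff_of_false hBB fun hc => ?_
        have := (h.sub_iff s.nextQ B').2 ⟨Or.inl hc.1, hc.2⟩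
        rw [h.fresh _ le_rfl] at this
        simp at this
    · rw [Function.update_of_ne hD]
      have hsub := h.sub_iff D' B'
      simp only [Set.mem_empty_iff_false, or_false] at hsub
      by_cases hBB : B' = S
      · subst hBB
        simp only [Function.update_self, Ne.symm hD, and_false, iff_false]
        by_cases hDD : D' = s.comp B'
        · subst hDD
          rw [Function.update_self, (h.sub_nodup _).mem_erase_iff]
          simp
        · rw [Function.update_of_ne hDD, hsub]
          exact fun hc => hDD hc.2.symm
      · rw [Function.update_of_ne hBB, ← hsub]
        by_cases hDD : D' = s.comp S
        · subst hDD
          rw [Function.update_self, (h.sub_nodup _).mem_erase_iff]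
          simp [hBB]
        · rw [Function.update_of_ne hDD]
  · simp only [Memory.isolated]
    by_cases hD : D' = s.nextQ
    · subst hD; simp
    · rw [Function.update_of_ne hD]
      by_cases hDD : D' = s.comp S
      · subst hDD
        rw [Function.update_self]
        exact (h.sub_nodup _).erase _
      · rw [Function.update_of_ne hDD]
        exact h.sub_nodup _
  · simp only [Memory.isolated]
    by_cases hD : D' = s.nextQ
    · subst hD
      simp only [Function.update_self, List.length_singleton, Nat.not_ofNat_le_one, iff_false]
      split_ifs
      · exact fun hw => hQw (List.mem_of_mem_erase hw)
      · exact hQw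
    · rw [Function.update_of_ne hD]
      by_cases hDD : D' = s.comp S
      · subst hDD
        rw [Function.update_self]
        have := h.work_iff (s.comp S)
        split_ifs with h1
        · rw [h.work_nodup.mem_erase_iff]; simp; omega
        · rw [this]; omega
      · rw [Function.update_of_ne hDD, ← h.work_iff]
        split_ifs
        · rw [h.work_nodup.mem_erase_iff]; simp [hDD]
        · rfl
  · simp only [Memory.isolated]
    split_ifs
    · exact h.work_nodup.erase _
    · exact h.work_nodup
  · simp only [Memory.isolated] at hD' ⊢
    rw [Function.update_of_ne (by omega), Function.update_of_ne (by omega)]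
    exact h.fresh D' (by omega)

/-- The size of a compound block is the number of states in it. -/
theorem Memory.Hole.compSize_eq [Fintype X] [DecidableEq X] {s : Memory X m W K} (h : s.Hole ∅ ∅) (D : ℕ) :
    s.compSize D = (Finset.univ.filter (fun x => s.comp (s.blk x) = D)).card := by
  have h1 : s.compSize D = ((s.sub D).flatMap s.mem).length := by
    simp [Memory.compSize, List.length_flatMap]
  have hnd : ((s.sub D).flatMap s.mem).Nodup := by
    refine List.nodup_flatMap.2 ⟨fun B _ => h.mem_nodup B, ?_⟩
    refine (h.sub_nodup D).imp fun {a b} hab x hxa hxb => hab ?_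
    rw [← ((h.mem_iff _ _).1 hxa).1, ← ((h.mem_iff _ _).1 hxb).1]
  rw [h1, ← List.toFinset_card_of_nodup hnd]
  congr 1
  ext x
  simp only [List.mem_toFinset, List.mem_flatMap, Finset.mem_filter, Finset.mem_univ, true_and]
  constructor
  · rintro ⟨B, hB, hx⟩
    rw [((h.mem_iff _ _).1 hx).1]
    exact ((h.sub_iff _ _).1 hB).2
  · intro hx
    have hm : x ∈ s.mem (s.blk x) := (h.mem_iff _ _).2 ⟨rfl, by simp⟩
    exact ⟨s.blk x, (h.sub_iff _ _).2 ⟨Or.inl (List.ne_nil_of_mem hm), hx⟩, hm⟩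

/-- If no block of `X/Q` consists of two blocks of `X/P`, the partitions agree. -/
theorem Memory.WellFormed.comp_inj {s : Memory X m W K} (h : s.WellFormed) (hw : s.work = [])
    {x y : X} (hxy : s.comp (s.blk x) = s.comp (s.blk y)) : s.blk x = s.blk y := by
  obtain ⟨h1, -, h3, h4, h5, -⟩ := h
  by_contra hne
  have hx := (h3 (s.comp (s.blk x)) (s.blk x)).2
    ⟨List.ne_nil_of_mem ((h1 _ x).2 rfl), rfl⟩
  have hy := (h3 (s.comp (s.blk x)) (s.blk y)).2
    ⟨List.ne_nil_of_mem ((h1 _ y).2 rfl), hxy.symm⟩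
  have hlen : ¬ 2 ≤ (s.sub (s.comp (s.blk x))).length := by
    rw [← h5, hw]; simp
  rcases hl : s.sub (s.comp (s.blk x)) with _ | ⟨a, _ | ⟨b, l⟩⟩
  · rw [hl] at hx; simp at hx
  · rw [hl, List.mem_singleton] at hx hy
    exact hne (hx.trans hy.symm)
  · rw [hl] at hlen
    simp at hlen

end Partition

/-- The picking rule of the implementation is admissible. -/
theorem admissible_pickSmaller (X : Type u) (m : ℕ) (W : Type w) (K : Type u) :
    Admissible 6 (pickSmaller (X := X) (m := m) (W := W) (K := K)) := by
  rintro s ⟨-, -, h3, h4, h5, -⟩ hw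
  rcases hwork : s.work with _ | ⟨C, ws⟩
  · exact absurd hwork hw
  have hC : 2 ≤ (s.sub C).length := (h5 C).1 (by simp [hwork])
  rcases hl : s.sub C with _ | ⟨a, _ | ⟨b, l⟩⟩
  · simp [hl] at hC
  · simp [hl] at hC
  have ha := (h3 C a).1 (by simp [hl])
  have hb := (h3 C b).1 (by simp [hl])
  suffices hE : pickSmaller.Ev s (fun S s' t => s' = s ∧ t ≤ 6 ∧ s.mem S ≠ [] ∧
      2 * (s.mem S).length ≤ s.compSize (s.comp S)) by
    obtain ⟨S, s', t, h, rfl, h'⟩ := hE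
    exact ⟨S, t, h, h'⟩
  have hsize : (s.mem a).length + (s.mem b).length ≤ s.compSize C := by
    simp only [Memory.compSize, hl, List.map_cons, List.sum_cons]; omega
  simp only [pickSmaller, Comp.ev_bind, Comp.ev_read, hwork, List.head?_cons, hl,
    List.getElem?_cons_zero, List.getElem?_cons_succ, Comp.ev_tick, Comp.ev_ret]
  refine ⟨trivial, by omega, ?_⟩
  split_ifs with h
  · rw [ha.2]; exact ⟨ha.1, by omega⟩
  · rw [hb.2]; exact ⟨hb.1, by omega⟩

/-! ### Edges and the store of weights -/

section Edges

variable {H : Type u ⥤ Type u} {enc : FunctorEncoding.{u, v} H} {X : Type u}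

/-- Two duplicate-free lists of the same edges are permutations of each other, so the order in which
edges were collected does not matter. This makes the lists `toSub` legitimate arguments for the laws
of `init` and `update`. -/
theorem Input.Encodes.fil_eq [DecidableEq X] {inp : Input H enc.Label X} {ξ : X → H.obj X}
    (h : inp.Encodes ξ) {S : Set X} {x : X} {es : List (Fin inp.m)} (hnd : es.Nodup)
    (hes : ∀ e, e ∈ es ↔ (inp.graph e).1 = x ∧ (inp.graph e).2.2 ∈ S) :
    fil S (enc.flat X (ξ x)) = ((es.map fun e => (inp.graph e).2.1 : List _) : Multiset _) := by
  classical
  rw [← h.2.2.2 x]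
  unfold fil
  rw [Multiset.filter_coe, Multiset.map_coe, List.filter_map, List.map_map]
  refine Multiset.coe_eq_coe.2 (List.Perm.map _ ?_)
  refine (List.perm_ext_iff_of_nodup (((List.nodup_finRange _).filter _).filter _) hnd).2 ?_
  intro e
  simp [hes, and_comm]

/-- Every edge `e` with source in `dom` has an address, where the weight of the class of its target
is stored; here `c x` is the partition of the states as seen from the source `x`. -/
structure Cells (inp : Input H enc.Label X) (ξ : X → H.obj X) {W : Type w}
    (wt : Set X → H.obj X → W) (dom : Set X) (c : X → X → ℕ) (lastW : Fin inp.m → ℕ)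
    (deref : ℕ → Option W) (next : ℕ) : Prop where
  lt : ∀ e, (inp.graph e).1 ∈ dom → lastW e < next
  deref_eq : ∀ e, (inp.graph e).1 ∈ dom → deref (lastW e) =
    some (wt {y | c (inp.graph e).1 y = c (inp.graph e).1 (inp.graph e).2.2} (ξ (inp.graph e).1))
  inj : ∀ e e', (inp.graph e).1 ∈ dom → (inp.graph e').1 ∈ dom → (lastW e = lastW e' ↔
    (inp.graph e).1 = (inp.graph e').1 ∧
    c (inp.graph e).1 (inp.graph e).2.2 = c (inp.graph e).1 (inp.graph e').2.2)

variable {inp : Input H enc.Label X} {ξ : X → H.obj X} {W : Type w}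
  {wt : Set X → H.obj X → W}

/-- At the start all states form one class of `X/Q`, so all edges with source `x` share the cell
that receives the weight for the whole set. -/
theorem Cells.start {dom : Set X} {lastW : Fin inp.m → ℕ} {deref : ℕ → Option W} {next : ℕ}
    {k : ℕ} (h : Cells inp ξ wt dom (fun _ _ => k) lastW deref next) {x : X}
    {es : List (Fin inp.m)} (hes : ∀ e, e ∈ es ↔ (inp.graph e).1 = x) :
    Cells inp ξ wt (insert x dom) (fun _ _ => k) (fun e => if e ∈ es then next else lastW e)
      (Function.update deref next (some (wt Set.univ (ξ x)))) (next + 1) := by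
  have key : ∀ e, (inp.graph e).1 ∈ insert x dom → (e ∈ es ∧ (inp.graph e).1 = x) ∨
      (e ∉ es ∧ (inp.graph e).1 ∈ dom ∧ (inp.graph e).1 ≠ x) := by
    intro e he
    by_cases h1 : e ∈ es
    · exact Or.inl ⟨h1, (hes e).1 h1⟩
    · have h2 : (inp.graph e).1 ≠ x := fun h2 => h1 ((hes e).2 h2)
      exact Or.inr ⟨h1, he.resolve_left h2, h2⟩
  refine ⟨fun e he => ?_, fun e he => ?_, fun e e' he he' => ?_⟩
  · rcases key e he with ⟨h1, h2⟩ | ⟨h1, h2, h3⟩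
    · simp [h1]
    · simp only [h1, if_false]
      exact (h.lt e h2).trans (Nat.lt_succ_self _)
  · rcases key e he with ⟨h1, h2⟩ | ⟨h1, h2, h3⟩
    · simp only [h1, if_true, Function.update_self, h2]
      simp
    · rw [if_neg h1, Function.update_of_ne (h.lt e h2).ne]
      exact h.deref_eq e h2
  · rcases key e he with ⟨h1, h2⟩ | ⟨h1, h2, h3⟩ <;>
      rcases key e' he' with ⟨h1', h2'⟩ | ⟨h1', h2', h3'⟩
    · simp [h1, h1', h2, h2']
    · simp only [h1, h1', if_true, if_false]
      exact iff_of_false (h.lt e' h2').ne' fun hh => h3' (hh.1.symm.trans h2)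
    · simp only [h1, h1', if_true, if_false]
      exact iff_of_false (h.lt e h2).ne fun hh => h3 (hh.1.trans h2')
    · rw [if_neg h1, if_neg h1']
      exact h.inj e e' h2 h2'

theorem splitOff_of_mem {q : X → ℕ} {S : Set X} {D : ℕ} {y : X} (h : y ∈ S) :
    splitOff q S D y = D := by simp [splitOff, h]

theorem splitOff_of_not_mem {q : X → ℕ} {S : Set X} {D : ℕ} {y : X} (h : y ∉ S) :
    splitOff q S D y = q y := by simp [splitOff, h]

section SplitOff

variable {q : X → ℕ} {S : Set X} {k D : ℕ}

theorem setOf_splitOff_new (hD : ∀ y, q y ≠ D) : {y | splitOff q S D y = D} = S := by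
  ext y
  by_cases h : y ∈ S
  · simp [splitOff_of_mem h, h]
  · simp [splitOff_of_not_mem h, h, hD y]

theorem setOf_splitOff_old (hD : ∀ y, q y ≠ D) (y' : X) :
    {y | splitOff q S D y = q y'} = {y | q y = q y'} \ S := by
  ext y
  by_cases h : y ∈ S
  · simp [splitOff_of_mem h, h, (hD y').symm]
  · simp [splitOff_of_not_mem h, h]

theorem diff_eq_of_ne (hS : ∀ y ∈ S, q y = k) {y' : X} (h : q y' ≠ k) :
    {y | q y = q y'} \ S = {y | q y = q y'} := by
  ext y
  simp only [Set.mem_sdiff, Set.mem_ofPred_eq, and_iff_left_iff_imp]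
  exact fun h1 h2 => h (h1.symm.trans (hS y h2))

/-- The old cell is shared by exactly the edges from `x` into the class `k`. Those into `S` move to
the new cell, and the others keep the old one, so overwriting it with the weight for the rest of the
class is correct for them and affects no other edge. Only `c x` changes: between two such steps
different sources see different partitions. -/
theorem Cells.split (hS : ∀ y ∈ S, q y = k) (hD : ∀ y, q y ≠ D) {c c' : X → X → ℕ}
    {lastW : Fin inp.m → ℕ} {deref : ℕ → Option W} {next : ℕ}
    (h : Cells inp ξ wt Set.univ c lastW deref next) {x : X} (hc : c x = q)
    (hc' : c' x = splitOff q S D) (hcc : ∀ x', x' ≠ x → c' x' = c x')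
    {es : List (Fin inp.m)} (hes : ∀ e, e ∈ es ↔ (inp.graph e).1 = x ∧ (inp.graph e).2.2 ∈ S)
    {e₀ : Fin inp.m} (he₀ : e₀ ∈ es) :
    Cells inp ξ wt Set.univ c' (fun e => if e ∈ es then next else lastW e)
      (Function.update (Function.update deref (lastW e₀) (some (wt ({y | q y = k} \ S) (ξ x))))
        next (some (wt S (ξ x)))) (next + 1) := by
  have hlt : ∀ e, lastW e < next := fun e => h.lt e (Set.mem_univ _)
  obtain ⟨hx0, hy0⟩ := (hes e₀).1 he₀
  -- By injectivity of addresses, the cell to be overwritten serves only edges from `x` into the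
  -- class that contains `S`.
  have hp : ∀ e, lastW e = lastW e₀ ↔ (inp.graph e).1 = x ∧ q (inp.graph e).2.2 = k := by
    intro e
    rw [h.inj e e₀ (Set.mem_univ _) (Set.mem_univ _), hx0]
    refine and_congr_right fun hx => ?_
    rw [hx, hc, hS _ hy0]
  refine ⟨fun e _ => ?_, fun e _ => ?_, fun e e' _ _ => ?_⟩
  · split_ifs
    · exact Nat.lt_succ_self _
    · exact (hlt e).trans (Nat.lt_succ_self _)
  · by_cases h1 : e ∈ es
    · obtain ⟨hx, hy⟩ := (hes e).1 h1
      simp only [h1, if_true, Function.update_self]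
      rw [hx, hc', splitOff_of_mem hy, setOf_splitOff_new hD]
    · simp only [h1, if_false]
      rw [Function.update_of_ne (hlt e).ne]
      by_cases hx : (inp.graph e).1 = x
      · have hy : (inp.graph e).2.2 ∉ S := fun hy => h1 ((hes e).2 ⟨hx, hy⟩)
        rw [hx, hc', splitOff_of_not_mem hy, setOf_splitOff_old hD]
        by_cases hk : q (inp.graph e).2.2 = k
        · rw [(hp e).2 ⟨hx, hk⟩, Function.update_self, hk]
        · rw [Function.update_of_ne (fun hh => hk ((hp e).1 hh).2), diff_eq_of_ne hS hk,
            h.deref_eq e (Set.mem_univ _), hx, hc]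
      · rw [Function.update_of_ne (fun hh => hx ((hp e).1 hh).1), hcc _ hx]
        exact h.deref_eq e (Set.mem_univ _)
  · by_cases hx : (inp.graph e).1 = x
    · by_cases hx' : (inp.graph e').1 = x
      · have hinj := h.inj e e' (Set.mem_univ _) (Set.mem_univ _)
        rw [hx, hx', hc] at hinj
        rw [hx, hx', hc']
        by_cases h1 : e ∈ es <;> by_cases h1' : e' ∈ es
        · simp [h1, h1', splitOff_of_mem ((hes e).1 h1).2, splitOff_of_mem ((hes e').1 h1').2]
        · have hy : (inp.graph e').2.2 ∉ S := fun hy => h1' ((hes e').2 ⟨hx', hy⟩)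
          simp only [h1, h1', if_true, if_false, splitOff_of_mem ((hes e).1 h1).2,
            splitOff_of_not_mem hy]
          exact iff_of_false (hlt e').ne' fun hh => hD _ hh.2.symm
        · have hy : (inp.graph e).2.2 ∉ S := fun hy => h1 ((hes e).2 ⟨hx, hy⟩)
          simp only [h1, h1', if_true, if_false, splitOff_of_mem ((hes e').1 h1').2,
            splitOff_of_not_mem hy]
          exact iff_of_false (hlt e).ne fun hh => hD _ hh.2
        · have hy : (inp.graph e).2.2 ∉ S := fun hy => h1 ((hes e).2 ⟨hx, hy⟩)
          have hy' : (inp.graph e').2.2 ∉ S := fun hy => h1' ((hes e').2 ⟨hx', hy⟩)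
          rw [if_neg h1, if_neg h1', splitOff_of_not_mem hy, splitOff_of_not_mem hy']
          exact hinj
      · have h1' : e' ∉ es := fun h1 => hx' ((hes e').1 h1).1
        have hne : (inp.graph e).1 ≠ (inp.graph e').1 := fun hh => hx' (hh.symm.trans hx)
        simp only [h1', if_false]
        refine iff_of_false ?_ fun hh => hne hh.1
        split_ifs
        · exact (hlt e').ne'
        · exact fun hh => hne ((h.inj e e' (Set.mem_univ _) (Set.mem_univ _)).1 hh).1
    · have h1 : e ∉ es := fun h1 => hx ((hes e).1 h1).1
      simp only [h1, if_false]
      by_cases h1' : e' ∈ es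
      · simp only [h1', if_true]
        exact iff_of_false (hlt e).ne fun hh => hx (hh.1.trans ((hes e').1 h1').1)
      · simp only [h1', if_false]
        rw [h.inj e e' (Set.mem_univ _) (Set.mem_univ _), hcc _ hx]

/-- A source that was never processed has no edge into `S`. For it the weights for the class `k` and
for its rest agree, so its cells are already correct for the refined partition. -/
theorem Cells.finish [DecidableEq X] {R : RefinementInterface.{u, v, w} enc}
    {wt : Set X → H.obj X → R.W} (hw : R.IsWeight wt) (hinp : inp.Encodes ξ)
    (hS : ∀ y ∈ S, q y = k) (hD : ∀ y, q y ≠ D) {c : X → X → ℕ}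
    {lastW : Fin inp.m → ℕ} {deref : ℕ → Option R.W} {next : ℕ}
    (h : Cells inp ξ wt Set.univ c lastW deref next)
    (hc : ∀ x, c x = splitOff q S D ∨ (c x = q ∧ ∀ e, (inp.graph e).1 = x →
      (inp.graph e).2.2 ∉ S)) :
    Cells inp ξ wt Set.univ (fun _ => splitOff q S D) lastW deref next := by
  refine ⟨h.lt, fun e he => ?_, fun e e' he he' => ?_⟩
  · rw [h.deref_eq e he]
    rcases hc (inp.graph e).1 with h1 | ⟨h1, h2⟩
    · rw [h1]
    · rw [h1, splitOff_of_not_mem (h2 e rfl), setOf_splitOff_old hD]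
      by_cases hk : q (inp.graph e).2.2 = k
      · rw [hk]
        have hfil : fil S (enc.flat X (ξ (inp.graph e).1)) = 0 := by
          rw [hinp.fil_eq (es := []) (by simp)]
          · simp
          · intro e'
            simp only [List.not_mem_nil, false_iff, not_and]
            exact h2 e'
        rw [(hw.of_fil_eq_zero (show S ⊆ {y | q y = k} from hS) hfil).2]
      · rw [diff_eq_of_ne hS hk]
  · rw [h.inj e e' he he']
    refine and_congr_right fun hx => ?_
    rcases hc (inp.graph e).1 with h1 | ⟨h1, h2⟩
    · rw [h1]
    · rw [h1, splitOff_of_not_mem (h2 e rfl), splitOff_of_not_mem (h2 e' hx.symm)]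

end SplitOff

theorem ev_setLastW {m : ℕ} {K : Type u} (es : List (Fin m)) (p : ℕ) (s : Memory X m W K) :
    (forEach es (fun e => setLastW e p)).Ev s (fun _ s' t =>
      s' = { s with lastW := fun e => if e ∈ es then p else s.lastW e } ∧
      t ≤ 2 * es.length + 1) := by
  refine ev_forEach_const (s := s) (fun pre s' => s' =
    { s with lastW := fun e => if e ∈ pre then p else s.lastW e }) 1 (by simp) ?_
  rintro pre a suf _ s' rfl
  simp only [setLastW, Comp.ev_write, le_refl, and_true]
  congr 1
  funext x
  by_cases h : x = a
  · subst h; simp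
  · simp [h]

end Edges

/-! ### Collecting the predecessors of a subblock -/

section Collect

variable {H : Type u ⥤ Type u} {enc : FunctorEncoding.{u, v} H}
  {R : RefinementInterface.{u, v, w} enc} {T : R.Timing} {X : Type u}
  {inp : Input H enc.Label X}

/-- The result of collecting the edges in `F`: the lists `ts` of edges, the markings `mk` and the
list `tl` of touched blocks. -/
structure Collected (blk : X → ℕ) (lastW : Fin inp.m → ℕ) (val : Fin inp.m → H.obj Three.{u})
    (F : Set (Fin inp.m)) (ts : X → List (Fin inp.m)) (mk : ℕ → List (X × ℕ))
    (tl : List (ℕ × H.obj Three.{u})) : Prop where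
  ts_nodup : ∀ x, (ts x).Nodup
  ts_iff : ∀ x e, e ∈ ts x ↔ e ∈ F ∧ (inp.graph e).1 = x
  mk_nodup : ∀ B, ((mk B).map Prod.fst).Nodup
  mk_mem : ∀ B xp, xp ∈ mk B → blk xp.1 = B ∧ ∃ e ∈ ts xp.1, lastW e = xp.2
  mk_of_ts : ∀ x, ts x ≠ [] → x ∈ (mk (blk x)).map Prod.fst
  tl_nodup : (tl.map Prod.fst).Nodup
  tl_iff : ∀ B, B ∈ tl.map Prod.fst ↔ mk B ≠ []
  tl_val : ∀ Bv ∈ tl, ∃ e ∈ F, blk (inp.graph e).1 = Bv.1 ∧ Bv.2 = val e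

theorem Collected.empty (blk : X → ℕ) (lastW : Fin inp.m → ℕ) (val : Fin inp.m → H.obj Three.{u}) :
    Collected blk lastW val ∅ (fun _ => []) (fun _ => []) [] :=
  ⟨by simp, by simp, by simp, by simp, by simp, by simp, by simp, by simp⟩

/-- A state is marked when its list becomes nonempty, and a block is touched when its first state is
marked. Hence an unmarked block contains no state with a collected edge, and no state or block is
recorded twice. -/
theorem Collected.step [DecidableEq X] {blk : X → ℕ} {lastW : Fin inp.m → ℕ} {val : Fin inp.m → H.obj Three.{u}}
    {F : Set (Fin inp.m)} {ts : X → List (Fin inp.m)} {mk : ℕ → List (X × ℕ)}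
    {tl : List (ℕ × H.obj Three.{u})} (h : Collected blk lastW val F ts mk tl) {e : Fin inp.m}
    (he : e ∉ F) {x : X} (hx : (inp.graph e).1 = x) :
    Collected blk lastW val (insert e F) (Function.update ts x (e :: ts x))
      (if ts x = [] then Function.update mk (blk x) ((x, lastW e) :: mk (blk x)) else mk)
      (if mk (blk x) = [] then (blk x, val e) :: tl else tl) := by
  have hts : ∀ x', ts x' ≠ [] → Function.update ts x (e :: ts x) x' ≠ [] := by
    intro x' hx'
    by_cases hxx : x' = x
    · subst hxx; simp
    · rwa [Function.update_of_ne hxx]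
  have hsub : ∀ x' e', e' ∈ ts x' → e' ∈ Function.update ts x (e :: ts x) x' := by
    intro x' e' hx'
    by_cases hxx : x' = x
    · subst hxx; simp [hx']
    · rwa [Function.update_of_ne hxx]
  have hfresh : mk (blk x) = [] → ts x = [] := fun hm => by
    by_contra hne
    have := h.mk_of_ts x hne
    simp [hm] at this
  have hnew : ∀ xp ∈ mk (blk x), ts x = [] → xp.1 ≠ x := by
    rintro xp hxp hx0 rfl
    obtain ⟨-, e', he', -⟩ := h.mk_mem _ _ hxp
    simp [hx0] at he'
  refine ⟨fun x' => ?_, fun x' e' => ?_, fun B => ?_, fun B xp hxp => ?_, fun x' hx' => ?_, ?_,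
    fun B => ?_, fun Bv hB => ?_⟩
  · by_cases hxx : x' = x
    · subst hxx
      rw [Function.update_self, List.nodup_cons]
      exact ⟨fun hm => he ((h.ts_iff _ _).1 hm).1, h.ts_nodup _⟩
    · rw [Function.update_of_ne hxx]; exact h.ts_nodup _
  · by_cases hxx : x' = x
    · subst hxx
      rw [Function.update_self, List.mem_cons, h.ts_iff, Set.mem_insert_iff]
      constructor
      · rintro (rfl | ⟨h1, h2⟩)
        · exact ⟨Or.inl rfl, hx⟩
        · exact ⟨Or.inr h1, h2⟩
      · rintro ⟨rfl | h1, h2⟩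
        · exact Or.inl rfl
        · exact Or.inr ⟨h1, h2⟩
    · rw [Function.update_of_ne hxx, h.ts_iff, Set.mem_insert_iff]
      refine ⟨fun hh => ⟨Or.inr hh.1, hh.2⟩, fun hh => ⟨hh.1.resolve_left ?_, hh.2⟩⟩
      rintro rfl
      exact hxx (hh.2.symm.trans hx)
  · split_ifs with h0
    · by_cases hB : B = blk x
      · subst hB
        rw [Function.update_self, List.map_cons, List.nodup_cons]
        refine ⟨fun hm => ?_, h.mk_nodup _⟩
        obtain ⟨xp, hxp, hxe⟩ := List.mem_map.1 hm
        exact hnew xp hxp h0 hxe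
      · rw [Function.update_of_ne hB]; exact h.mk_nodup _
    · exact h.mk_nodup _
  · have hold : xp ∈ mk B → blk xp.1 = B ∧ ∃ e_1 ∈ Function.update ts x (e :: ts x) xp.1,
        lastW e_1 = xp.2 := fun hxp => by
      obtain ⟨h1, e', he', h2⟩ := h.mk_mem B xp hxp
      exact ⟨h1, e', hsub _ _ he', h2⟩
    split_ifs at hxp with h0
    · by_cases hB : B = blk x
      · subst hB
        rw [Function.update_self, List.mem_cons] at hxp
        rcases hxp with rfl | hxp
        · exact ⟨rfl, e, by simp, rfl⟩
        · exact hold hxp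
      · rw [Function.update_of_ne hB] at hxp
        exact hold hxp
    · exact hold hxp
  · by_cases hxx : x' = x
    · subst hxx
      split_ifs with h0
      · simp
      · exact h.mk_of_ts _ h0
    · rw [Function.update_of_ne hxx] at hx'
      have := h.mk_of_ts x' hx'
      split_ifs with h0
      · by_cases hB : blk x' = blk x
        · rw [hB, Function.update_self, List.map_cons, List.mem_cons]
          rw [hB] at this
          exact Or.inr this
        · rwa [Function.update_of_ne hB]
      · exact this
  · split_ifs with h0
    · rw [List.map_cons, List.nodup_cons]
      exact ⟨fun hm => (h.tl_iff _).1 hm h0, h.tl_nodup⟩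
    · exact h.tl_nodup
  · by_cases h0 : mk (blk x) = []
    · simp only [h0, hfresh h0, if_true, List.map_cons, List.mem_cons]
      by_cases hB : B = blk x
      · subst hB; simp
      · rw [Function.update_of_ne hB, ← h.tl_iff]
        simp only [hB, false_or]
    · simp only [h0, if_false]
      rw [h.tl_iff]
      by_cases h1 : ts x = []
      · simp only [h1, if_true]
        by_cases hB : B = blk x
        · subst hB; simp [h0]
        · rw [Function.update_of_ne hB]
      · simp [h1]
  · have hold : Bv ∈ tl → ∃ e_1 ∈ insert e F, blk (inp.graph e_1).1 = Bv.1 ∧ Bv.2 = val e_1 := by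
      intro hB
      obtain ⟨e', he', h2⟩ := h.tl_val Bv hB
      exact ⟨e', Or.inr he', h2⟩
    split_ifs at hB
    · rcases List.mem_cons.1 hB with rfl | hB
      · exact ⟨e, Or.inl rfl, by rw [hx], rfl⟩
      · exact hold hB
    · exact hold hB

/-- Each edge into `S` costs a constant number of steps: the only calls of `update` are on the empty
bag. The function `wv` gives the weights currently found at the edges into `S`. -/
theorem ev_collect [DecidableEq X] {c : ℕ} (hT : ∀ l x, T.updateTime l x ≤ c * (l.length + 1)) {S : ℕ}
    (s : Mem R inp) (hts : ∀ x, s.toSub x = []) (hmk : ∀ B, s.mark B = [])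
    (hS : (s.mem S).Nodup) (hp : ∀ y, (s.pred y).Nodup)
    (hpred : ∀ y e, e ∈ s.pred y ↔ (inp.graph e).2.2 = y)
    {wv : Fin inp.m → R.W} (hwv : ∀ e, (inp.graph e).2.2 ∈ s.mem S →
      s.deref (s.lastW e) = some (wv e)) :
    (collect R T inp S).Ev s (fun _ s' t => (∃ ts mk tl,
      s' = { s with toSub := ts, mark := mk, touched := tl } ∧
      Collected s.blk s.lastW (fun e => (R.update (0, wv e)).2.1)
        {e | (inp.graph e).2.2 ∈ s.mem S} ts mk tl) ∧
      t ≤ (c + 20) * (((s.mem S).map fun y => (s.pred y).length + 1).sum + 1)) := by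
  have hstep : ∀ (e : Fin inp.m) (F : Set (Fin inp.m)) (s₁ : Mem R inp), e ∉ F →
      (inp.graph e).2.2 ∈ s.mem S →
      (∃ ts mk tl, s₁ = { s with toSub := ts, mark := mk, touched := tl } ∧
        Collected s.blk s.lastW (fun e => (R.update (0, wv e)).2.1) F ts mk tl) →
      Comp.Ev (Comp.read (fun _ => (inp.graph e).1) >>>= fun x =>
        Comp.read (fun s => s.blk x) >>>= fun B =>
        Comp.read (fun s => (s.mark B).isEmpty) >>>= fun unmarked =>
        (if unmarked then
          Comp.read (fun s => s.lastW e) >>>= fun p =>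
          loadW p >>>= fun wC =>
          callUpdate R T inp [] wC >>>= fun r =>
          addTouched B r.2.1
        else Comp.ret ()) >>>= fun _ =>
        Comp.read (fun s => (s.toSub x).isEmpty) >>>= fun fresh =>
        (if fresh then
          Comp.read (fun s => s.lastW e) >>>= fun p =>
          addMark B x p
        else Comp.ret ()) >>>= fun _ =>
        addToSub x e) s₁ (fun _ s' t =>
        (∃ ts mk tl, s' = { s with toSub := ts, mark := mk, touched := tl } ∧
          Collected s.blk s.lastW (fun e => (R.update (0, wv e)).2.1) (insert e F) ts mk tl) ∧
        t ≤ c + 12) := by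
    rintro e F _ he hy ⟨ts, mk, tl, rfl, hcol⟩
    have hnext := hcol.step he rfl
    have ht := hT [] (wv e)
    simp only [List.length_nil, zero_add, mul_one] at ht
    have hfresh : mk (s.blk (inp.graph e).1) = [] → ts (inp.graph e).1 = [] := fun hm => by
      by_contra hne
      have := hcol.mk_of_ts _ hne
      simp [hm] at this
    simp only [Comp.ev_bind, Comp.ev_read]
    by_cases h0 : mk (s.blk (inp.graph e).1) = []
    · simp only [h0, List.isEmpty_nil, if_true, Comp.ev_bind, Comp.ev_read, loadW, hwv e hy,
        Comp.ev_ret, callUpdate, Comp.ev_tick, addTouched, Comp.ev_write, hfresh h0, addMark,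
        addToSub, Multiset.coe_nil]
      simp only [h0, hfresh h0, if_true] at hnext
      exact ⟨⟨_, _, _, rfl, hnext⟩, by omega⟩
    · have e0 : (mk (s.blk (inp.graph e).1)).isEmpty = false := by simpa using h0
      simp only [e0, Bool.false_eq_true, if_false, Comp.ev_ret]
      by_cases h1 : ts (inp.graph e).1 = []
      · simp only [h1, List.isEmpty_nil, if_true, Comp.ev_bind, Comp.ev_read, addMark, addToSub,
          Comp.ev_write]
        simp only [h0, h1, if_true, if_false] at hnext
        exact ⟨⟨_, _, _, rfl, hnext⟩, by omega⟩
      · have e1 : (ts (inp.graph e).1).isEmpty = false := by simpa using h1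
        simp only [e1, Bool.false_eq_true, if_false, Comp.ev_ret, addToSub, Comp.ev_write]
        simp only [h0, h1, if_false] at hnext
        exact ⟨⟨_, _, _, rfl, hnext⟩, by omega⟩
  unfold collect
  simp only [Comp.ev_bind, clearTouched, Comp.ev_write]
  rw [Comp.ev_read]
  refine (ev_forEach (fun pre s' => ∃ ts mk tl,
      s' = { s with toSub := ts, mark := mk, touched := tl } ∧
      Collected s.blk s.lastW (fun e => (R.update (0, wv e)).2.1)
        {e | (inp.graph e).2.2 ∈ pre} ts mk tl)
      (fun y => (c + 13) * (s.pred y).length + 2) ?_ ?_).mono ?_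
  · refine ⟨fun _ => [], fun _ => [], [], ?_, ?_⟩
    · rw [← show s.toSub = fun _ => [] from funext hts, ← show s.mark = fun _ => [] from funext hmk]
    · simpa using Collected.empty s.blk s.lastW _
  · rintro pre y suf hl _ ⟨ts, mk, tl, rfl, hcol⟩
    have hnd : y ∉ pre := by
      have := hS
      rw [show s.mem S = pre ++ y :: suf from hl] at this
      intro hm
      exact (List.nodup_append.1 this).2.2 y hm y (by simp) rfl
    have hyS : y ∈ s.mem S := by rw [show s.mem S = pre ++ y :: suf from hl]; simp
    rw [Comp.ev_bind, Comp.ev_read]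
    refine (ev_forEach_const (fun preE s' => ∃ ts mk tl,
      s' = { s with toSub := ts, mark := mk, touched := tl } ∧
      Collected s.blk s.lastW (fun e => (R.update (0, wv e)).2.1)
        {e | (inp.graph e).2.2 ∈ pre ∨ e ∈ preE} ts mk tl) (c + 12) ?_ ?_).mono ?_
    · exact ⟨ts, mk, tl, rfl, by simpa using hcol⟩
    · rintro preE e sufE hE s₁ hs₁
      have hE' : s.pred y = preE ++ e :: sufE := hE
      have hey : (inp.graph e).2.2 = y := (hpred y e).1 (by rw [hE']; simp)
      refine (hstep e _ s₁ ?_ (by rw [hey]; exact hyS) hs₁).mono ?_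
      · rintro (h1 | h1)
        · exact hnd (hey ▸ h1)
        · have := hp y
          rw [hE'] at this
          exact (List.nodup_append.1 this).2.2 e h1 e (by simp) rfl
      · rintro _ s' t ⟨⟨ts', mk', tl', h1, h2⟩, ht⟩
        refine ⟨⟨ts', mk', tl', h1, ?_⟩, ht⟩
        convert h2 using 1
        ext e'
        simp only [Set.mem_ofPred_eq, List.mem_append, List.mem_singleton, Set.mem_insert_iff]
        tauto
    · rintro _ s' t ⟨⟨ts', mk', tl', h1, h2⟩, ht⟩
      refine ⟨⟨ts', mk', tl', h1, ?_⟩, ?_⟩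
      · convert h2 using 1
        ext e'
        simp [hpred]
      · simp only [show c + 12 + 1 = c + 13 from rfl] at ht
        omega
  · rintro _ s' t ⟨h1, ht⟩
    refine ⟨h1, ?_⟩
    have : ((s.mem S).map fun y => (c + 13) * (s.pred y).length + 2 + 1).sum ≤
        (c + 20) * ((s.mem S).map fun y => (s.pred y).length + 1).sum := by
      rw [← List.sum_map_mul_left]
      refine List.sum_le_sum fun y _ => ?_
      nlinarith
    simp only at ht
    rw [mul_add]
    omega

end Collect

/-! ### Splitting a block -/

section SplitBlock

variable {H : Type u ⥤ Type u} {enc : FunctorEncoding.{u, v} H}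
  {R : RefinementInterface.{u, v, w} enc} {T : R.Timing} [LinearOrder (H.obj Three.{u})]
  {X : Type u} [DecidableEq X] {inp : Input H enc.Label X}

/-- The effect of `splitBlock` on the block `B`, where `val` is the key of a state. -/
structure BlockSplit (ξ : X → H.obj X) (wt : Set X → H.obj X → R.W) (q : X → ℕ) (S : Set X)
    (D : ℕ) (c : X → X → ℕ) (val : X → H.obj Three.{u}) (B : ℕ) (s s' : Mem R inp) : Prop where
  hole : s'.Hole ∅ ∅
  pred_eq : s'.pred = s.pred
  nextQ_eq : s'.nextQ = s.nextQ
  nextP_le : s.nextP ≤ s'.nextP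
  toSub_eq : ∀ x, s'.toSub x = if x ∈ (s.mark B).map Prod.fst then [] else s.toSub x
  mark_eq : s'.mark = Function.update s.mark B []
  lastW_eq : ∀ e, (inp.graph e).1 ∉ (s.mark B).map Prod.fst → s'.lastW e = s.lastW e
  cells : Cells inp ξ wt Set.univ
    (fun x => if x ∈ (s.mark B).map Prod.fst then splitOff q S D else c x)
    s'.lastW s'.deref s'.nextCell
  blk_old : ∀ x, s.blk x ≠ B → s'.blk x = s.blk x
  blk_iff : ∀ x y, s'.blk x = s'.blk y ↔ s.blk x = s.blk y ∧ (s.blk x = B → val x = val y)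
  comp_eq : ∀ x, s'.comp (s'.blk x) = s.comp (s.blk x)

/-- The memory while the marked states of a block are processed; the states of `pre` are done. -/
structure Moving (ξ : X → H.obj X) (wt : Set X → H.obj X → R.W) (q : X → ℕ) (S : Set X)
    (D : ℕ) (c : X → X → ℕ) (val : X → H.obj Three.{u}) (v₀ : H.obj Three.{u}) (B : ℕ)
    (s : Mem R inp) (pre : List X) (s' : Mem R inp) : Prop where
  frame : s'.pred = s.pred ∧ s'.mark = s.mark ∧ s'.blk = s.blk ∧ s'.nextP = s.nextP ∧
    s'.comp = s.comp ∧ s'.sub = s.sub ∧ s'.nextQ = s.nextQ ∧ s'.work = s.work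
  moved_eq : s'.moved = ((pre.filter (fun x => val x ≠ v₀)).map fun x => (x, val x)).reverse
  mem_ne : ∀ B', B' ≠ B → s'.mem B' = s.mem B'
  nodup : (s'.mem B).Nodup
  mem_iff : ∀ x, x ∈ s'.mem B ↔ x ∈ s.mem B ∧ ¬ (x ∈ pre ∧ val x ≠ v₀)
  toSub_eq : ∀ x, s'.toSub x = if x ∈ pre then [] else s.toSub x
  lastW_eq : ∀ e, (inp.graph e).1 ∉ pre → s'.lastW e = s.lastW e
  cells : Cells inp ξ wt Set.univ (fun x => if x ∈ pre then splitOff q S D else c x)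
    s'.lastW s'.deref s'.nextCell

variable {ξ : X → H.obj X} {wt : Set X → H.obj X → R.W} {q : X → ℕ} {S : Set X} {k D : ℕ}
  {c : X → X → ℕ}

/-- A marked state is processed while its cells still describe the old partition `q`, so `update` is
applied to the weight for the whole class `k` and the update law gives both new weights and the key.
-/
theorem ev_splitBlock_moving {cT cc : ℕ} (hT : ∀ l x, T.updateTime l x ≤ cT * (l.length + 1))
    (hcc : ∀ a b, T.compareTime a b ≤ cc) (hw : R.IsWeight wt) (hinp : inp.Encodes ξ)
    (hS : ∀ y ∈ S, q y = k) (hD : ∀ y, q y ≠ D) {s : Mem R inp} (hs : s.Hole ∅ ∅)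
    (hcell : Cells inp ξ wt Set.univ c s.lastW s.deref s.nextCell) {B : ℕ}
    (hmk : ((s.mark B).map Prod.fst).Nodup)
    (hmk' : ∀ xp ∈ s.mark B, s.blk xp.1 = B ∧ c xp.1 = q ∧ (s.toSub xp.1).Nodup ∧
      (∀ e, e ∈ s.toSub xp.1 ↔ (inp.graph e).1 = xp.1 ∧ (inp.graph e).2.2 ∈ S) ∧
      ∃ e ∈ s.toSub xp.1, s.lastW e = xp.2) (v₀ : H.obj Three.{u}) (hmv : s.moved = []) :
    (forEach (s.mark B) (fun xp =>
      Comp.read (fun s => s.toSub xp.1) >>>= fun es =>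
      mapList (fun e => (inp.graph e).2.1) es >>>= fun l =>
      loadW xp.2 >>>= fun wC =>
      callUpdate R T inp l wC >>>= fun r =>
      storeW xp.2 r.2.2 >>>= fun _ =>
      newCell r.1 >>>= fun pS =>
      forEach es (fun e => setLastW e pS) >>>= fun _ =>
      clearToSub xp.1 >>>= fun _ =>
      testEq T.compareTime r.2.1 v₀ >>>= fun same =>
      if same then Comp.ret ()
      else removeFromBlock B xp.1 >>>= fun _ => addMoved xp.1 r.2.1)).Ev
      s (fun _ s' t => Moving ξ wt q S D c
        (fun x => fmap H (chi S {y | q y = k}) (ξ x)) v₀ B s ((s.mark B).map Prod.fst) s' ∧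
        t ≤ (cT + cc + 20) *
          (((s.mark B).map Prod.fst).map fun x => (s.toSub x).length + 1).sum + 1) := by
  refine (ev_forEach (fun pre s' => Moving ξ wt q S D c
    (fun x => fmap H (chi S {y | q y = k}) (ξ x)) v₀ B s (pre.map Prod.fst) s')
    (fun xp => (cT + 3) * (s.toSub xp.1).length + cT + cc + 15) ?_ ?_).mono ?_
  · exact ⟨⟨rfl, rfl, rfl, rfl, rfl, rfl, rfl, rfl⟩, by simpa using hmv, fun _ _ => rfl,
      hs.mem_nodup B, by simp, by simp, by simp, by simpa using hcell⟩
  · rintro pre ⟨x, p⟩ suf hl s₁ h₁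
    obtain ⟨hxB, hcx, hnd, hes, e₀, he₀, rfl⟩ := hmk' (x, p) (by rw [hl]; simp)
    simp only at hxB hcx hnd hes he₀ ⊢
    have hxpre : x ∉ pre.map Prod.fst := by
      rw [hl, List.map_append, List.map_cons] at hmk
      exact fun hm => (List.nodup_append.1 hmk).2.2 x hm x (by simp) rfl
    have hts : s₁.toSub x = s.toSub x := by rw [h₁.toSub_eq, if_neg hxpre]
    obtain ⟨hx0, hy0⟩ := (hes e₀).1 he₀
    have hl0 : s₁.lastW e₀ = s.lastW e₀ := h₁.lastW_eq e₀ (by rwa [hx0])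
    -- The address recorded while collecting is still current, since `x` has not been processed
    -- before, and it holds the weight for the class `k ⊇ S`.
    have hder : s₁.deref (s.lastW e₀) = some (wt {y | q y = k} (ξ x)) := by
      rw [← hl0, h₁.cells.deref_eq e₀ (Set.mem_univ _)]
      simp only [hx0, if_neg hxpre, hcx, hS _ hy0]
    have hupd : R.update (((s.toSub x).map fun e => (inp.graph e).2.1 : List _),
        wt {y | q y = k} (ξ x)) = (wt S (ξ x), fmap H (chi S {y | q y = k}) (ξ x),
          wt ({y | q y = k} \ S) (ξ x)) := by
      rw [← hw.update_eq S {y | q y = k} hS, hinp.fil_eq hnd hes]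
    have hmem : ∀ x', x' ≠ x →
        (x' ∈ (pre ++ [(x, s.lastW e₀)]).map Prod.fst ↔ x' ∈ pre.map Prod.fst) := by
      intro x' hx'
      rw [List.map_append, List.mem_append]
      exact or_iff_left (by simpa using hx')
    have hsplit := h₁.cells.split hS hD (x := x) (by simp [hxpre, hcx])
      (c' := fun x' => if x' ∈ (pre ++ [(x, s.lastW e₀)]).map Prod.fst then splitOff q S D
        else c x') (by simp) (fun x' hx' => if_congr (hmem x' hx') rfl rfl) hes he₀
    rw [hl0] at hsplit
    have htime := hT ((s.toSub x).map fun e => (inp.graph e).2.1) (wt {y | q y = k} (ξ x))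
    rw [List.length_map] at htime
    have hxm : x ∈ s₁.mem B := by
      rw [h₁.mem_iff]
      exact ⟨(hs.mem_iff _ _).2 ⟨hxB, by simp⟩, fun hh => hxpre hh.1⟩
    have hlW : ∀ e, (inp.graph e).1 ∉ (pre ++ [(x, s.lastW e₀)]).map Prod.fst →
        (if e ∈ s.toSub x then s₁.nextCell else s₁.lastW e) = s.lastW e := by
      intro e he
      simp only [List.map_append, List.map_cons, List.map_nil, List.mem_append,
        List.mem_singleton, not_or] at he
      rw [if_neg fun hm => he.2 ((hes e).1 hm).1]
      exact h₁.lastW_eq e he.1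
    have htoSub : ∀ x', Function.update s₁.toSub x [] x' =
        if x' ∈ (pre ++ [(x, s.lastW e₀)]).map Prod.fst then [] else s.toSub x' := by
      intro x'
      by_cases hx' : x' = x
      · subst hx'; simp
      · rw [Function.update_of_ne hx', h₁.toSub_eq]
        exact if_congr (hmem x' hx').symm rfl rfl
    simp only [Comp.ev_bind, Comp.ev_read, hts]
    refine (ev_mapList _ _ s₁).mono ?_
    rintro _ _ t₁ ⟨rfl, rfl, ht₁⟩
    simp only [loadW, Comp.ev_bind, Comp.ev_read, hder, Comp.ev_ret, callUpdate, Comp.ev_tick,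
      hupd, storeW, newCell, Comp.ev_write]
    refine (ev_setLastW _ _ _).mono ?_
    rintro _ _ t₂ ⟨rfl, ht₂⟩
    simp only [clearToSub, Comp.ev_write]
    refine (ev_testEq hcc _ _ _).mono ?_
    rintro _ _ t₃ ⟨rfl, rfl, ht₃⟩
    by_cases hv : fmap H (chi S {y | q y = k}) (ξ x) = v₀
    · simp only [hv, decide_true, if_true, Comp.ev_ret]
      refine ⟨⟨h₁.frame, ?_, h₁.mem_ne, ?_, fun x' => ?_, htoSub, hlW, hsplit⟩, ?_⟩
      · rw [h₁.moved_eq]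
        simp [hv]
      · exact h₁.nodup
      · simp only [h₁.mem_iff, List.map_append, List.map_cons, List.map_nil, List.mem_append,
          List.mem_singleton]
        refine and_congr_right fun _ => not_congr ⟨fun hh => ⟨Or.inl hh.1, hh.2⟩, ?_⟩
        rintro ⟨hh | rfl, h2⟩
        · exact ⟨hh, h2⟩
        · exact absurd hv h2
      · ring_nf at htime ⊢
        omega
    · simp only [hv, decide_false, Bool.false_eq_true, if_false, Comp.ev_bind, removeFromBlock,
        addMoved, Comp.ev_write]
      refine ⟨⟨h₁.frame, ?_, fun B' hB' => ?_, ?_, fun x' => ?_, htoSub, hlW, hsplit⟩, ?_⟩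
      · rw [h₁.moved_eq]
        simp [hv, List.filter_append]
      · rw [← h₁.mem_ne B' hB']
        exact Function.update_of_ne hB' _ _
      · simp only [Function.update_self]
        exact h₁.nodup.erase _
      · simp only [Function.update_self, h₁.nodup.mem_erase_iff, h₁.mem_iff, List.map_append,
          List.map_cons, List.map_nil, List.mem_append, List.mem_singleton]
        by_cases hx' : x' = x
        · subst hx'; simp [hv]
        · simp [hx']
      · ring_nf at htime ⊢
        omega
  · rintro _ s' t ⟨h1, ht⟩
    refine ⟨h1, ht.trans ?_⟩
    rw [List.map_map, ← List.sum_map_mul_left]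
    refine Nat.add_le_add_right (List.sum_le_sum fun xp _ => ?_) 1
    simp only [Function.comp]
    nlinarith

end SplitBlock

theorem ev_insertBlocks {X : Type u} [DecidableEq X] {m : ℕ} {W : Type w} {K : Type u} {A : Type*}
    (f : A → X) (gs : List (List A)) {s : Memory X m W K} {Z : Set X} {Y : Set ℕ} (h : s.Hole Z Y)
    {D : ℕ} (hD : D < s.nextQ) (hne : ∀ g ∈ gs, g ≠ []) (hnd : (gs.flatten.map f).Nodup)
    (hZ : ∀ x ∈ gs.flatten.map f, x ∈ Z) :
    (forEach gs (fun g => mapList f g >>>= fun g' => insertBlock D g')).Ev s (fun _ s' t =>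
      s.Inserted Z Y D (gs.map (List.map f)) s' ∧ t ≤ 9 * gs.flatten.length + 1) := by
  refine (ev_forEach (fun pre s' => s.Inserted Z Y D (pre.map (List.map f)) s')
    (fun g => 3 * g.length + 5) (Memory.Inserted.nil D h) ?_).mono ?_
  · rintro pre g suf rfl s' hs'
    rw [Comp.ev_bind]
    refine (ev_mapList f g s').mono ?_
    rintro _ _ t ⟨rfl, rfl, rfl⟩
    refine (ev_insertBlock D _ _).mono ?_
    rintro _ _ t ⟨rfl, ht⟩
    rw [List.length_map] at ht
    refine ⟨?_, by omega⟩
    rw [List.map_append]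
    refine hs'.snoc hD (by simpa using hne g (by simp)) ?_ (fun x hx => hZ x ?_)
    · refine List.Nodup.sublist ?_ hnd
      rw [← List.map_singleton, ← List.map_append, ← List.map_flatten]
      refine List.Sublist.map f ?_
      simp
    · obtain ⟨a, ha, rfl⟩ := List.mem_map.1 hx
      exact List.mem_map_of_mem (List.mem_flatten.2 ⟨g, by simp, ha⟩)
  · rintro _ s' t ⟨h1, ht⟩
    refine ⟨h1, ht.trans (Nat.add_le_add_right ?_ 1)⟩
    rw [List.length_flatten, ← List.sum_map_mul_left]
    refine List.sum_le_sum fun g hg => ?_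
    -- A nonempty group absorbs the constant overhead: `3 |g| + 6 ≤ 9 |g|`.
    have := List.length_pos_of_ne_nil (hne g hg)
    omega

theorem sum_map_add_mul_ite {A : Type*} (l : List A) (f : A → ℕ) (L : ℕ) (p : A → Prop)
    [DecidablePred p] : (l.map fun a => f a + L * if p a then 1 else 0).sum =
      (l.map f).sum + L * l.countP (fun a => p a) := by
  induction l with
  | nil => simp
  | cons a l ih =>
    simp only [List.map_cons, List.sum_cons, ih, List.countP_cons, decide_eq_true_eq]
    ring

section SplitBlock

variable {H : Type u ⥤ Type u} {enc : FunctorEncoding.{u, v} H}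
  {R : RefinementInterface.{u, v, w} enc} {T : R.Timing} [LinearOrder (H.obj Three.{u})]
  {X : Type u} [DecidableEq X] {inp : Input H enc.Label X}
  {ξ : X → H.obj X} {wt : Set X → H.obj X → R.W} {q : X → ℕ} {S : Set X} {k D : ℕ}
  {c : X → X → ℕ}

/-- Inserting the groups of moved states refines the partition by the key `val`. -/
theorem BlockSplit.of_inserted {val : X → H.obj Three.{u}} {v₀ : H.obj Three.{u}} {B : ℕ}
    {s s₂ s₃ s' : Mem R inp} (hs : s.Hole ∅ ∅)
    (hB : s.mem B ≠ [])
    (hms : ∀ x ∈ (s.mark B).map Prod.fst, s.blk x = B)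
    (hv₀ : ∀ x, s.blk x = B → x ∉ (s.mark B).map Prod.fst → val x = v₀)
    (h₂ : Moving ξ wt q S D c val v₀ B s ((s.mark B).map Prod.fst) s₂)
    {gs : List (List (X × H.obj Three.{u}))} (hperm : gs.flatten.Perm s₂.moved)
    (hgs : IsGrouping Prod.snd gs)
    (h₃ : ({ s₂ with mark := Function.update s₂.mark B [] } : Mem R inp).Inserted
      {x | x ∈ s₂.moved.map Prod.fst} {B} (s.comp B) (gs.map (List.map Prod.fst)) s₃)
    (hs' : s' = if s₃.mem B = [] then { s₃ with
      sub := Function.update s₃.sub (s₃.comp B) ((s₃.sub (s₃.comp B)).erase B)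
      work := if (s₃.sub (s₃.comp B)).length = 2 then s₃.work.erase (s₃.comp B) else s₃.work }
      else s₃) : BlockSplit ξ wt q S D c val B s s' := by
  obtain ⟨f1, f2, f3, f4, f5, f6, f7, f8⟩ := h₂.frame
  have hmv : ∀ x w, (x, w) ∈ s₂.moved ↔ x ∈ (s.mark B).map Prod.fst ∧ val x ≠ v₀ ∧ w = val x := by
    intro x w
    rw [h₂.moved_eq]
    simp only [List.mem_reverse, List.mem_map, List.mem_filter, Prod.mk.injEq, ne_eq,
      decide_not, Bool.not_eq_eq_eq_not, Bool.not_true, decide_eq_false_iff_not]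
    constructor
    · rintro ⟨y, ⟨h1, h2⟩, rfl, rfl⟩
      exact ⟨h1, h2, rfl⟩
    · rintro ⟨h1, h2, rfl⟩
      exact ⟨x, ⟨h1, h2⟩, rfl, rfl⟩
  have hmvx : ∀ x, x ∈ s₂.moved.map Prod.fst ↔ x ∈ (s.mark B).map Prod.fst ∧ val x ≠ v₀ := by
    intro x
    rw [List.mem_map]
    constructor
    · rintro ⟨⟨y, w⟩, hy, rfl⟩
      exact ⟨((hmv _ _).1 hy).1, ((hmv _ _).1 hy).2.1⟩
    · rintro ⟨h1, h2⟩
      exact ⟨(x, val x), (hmv _ _).2 ⟨h1, h2, rfl⟩, rfl⟩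
  have hfl : ∀ x, x ∈ (gs.map (List.map Prod.fst)).flatten ↔
      x ∈ (s.mark B).map Prod.fst ∧ val x ≠ v₀ := by
    intro x
    rw [← List.map_flatten, (hperm.map Prod.fst).mem_iff, hmvx]
  have hlt : ∀ x, s.blk x < s.nextP := fun x => hs.blk_lt x (by simp)
  have hBlt : B < s.nextP := by
    obtain ⟨x, hx⟩ := List.exists_mem_of_ne_nil _ hB
    rw [← ((hs.mem_iff _ _).1 hx).1]
    exact hlt x
  have hblk_old : ∀ x, ¬ (x ∈ (s.mark B).map Prod.fst ∧ val x ≠ v₀) → s₃.blk x = s.blk x := by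
    intro x hx
    rw [h₃.blk_old x (by rwa [hfl])]
    exact congrFun f3 x
  have hblk_new : ∀ x, (x ∈ (s.mark B).map Prod.fst ∧ val x ≠ v₀) → s.nextP ≤ s₃.blk x ∧
      s₃.comp (s₃.blk x) = s.comp B := by
    intro x hx
    have := h₃.blk_new x ((hfl x).2 hx)
    exact ⟨f4 ▸ this.1, this.2.2⟩
  -- Every state taken out of `B` has been put into a new block; the only possible defect left is
  -- that `B` is empty.
  have hhole : s₃.Hole ∅ {B} := by
    have := h₃.hole
    convert this using 1
    symm
    rw [Set.sdiff_eq_empty]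
    intro x hx
    exact (hfl x).2 ((hmvx x).1 hx)
  have e : s'.Hole ∅ ∅ ∧ s'.pred = s₃.pred ∧ s'.nextQ = s₃.nextQ ∧ s'.nextP = s₃.nextP ∧
      s'.toSub = s₃.toSub ∧ s'.mark = s₃.mark ∧ s'.lastW = s₃.lastW ∧ s'.deref = s₃.deref ∧
      s'.nextCell = s₃.nextCell ∧ s'.blk = s₃.blk ∧ s'.comp = s₃.comp := by
    by_cases hm : s₃.mem B = []
    · rw [if_pos hm] at hs'
      subst hs'
      exact ⟨hhole.detach hm, rfl, rfl, rfl, rfl, rfl, rfl, rfl, rfl, rfl, rfl⟩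
    · rw [if_neg hm] at hs'
      subst hs'
      refine ⟨⟨hhole.mem_iff, hhole.mem_nodup, fun D' B' => ?_, hhole.sub_nodup, hhole.work_iff,
        hhole.work_nodup, hhole.blk_lt, by simp, hhole.fresh⟩,
        rfl, rfl, rfl, rfl, rfl, rfl, rfl, rfl, rfl, rfl⟩
      rw [hhole.sub_iff]
      by_cases hBB : B' = B
      · subst hBB; simp [hm]
      · simp [hBB]
  obtain ⟨g0, g1, g2, g3, g4, g5, g6, g7, g8, g9, g10⟩ := e
  refine ⟨g0, ?_, ?_, ?_, fun x => ?_, ?_, fun e he => ?_, ?_, fun x hx => ?_, fun x y => ?_,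
    fun x => ?_⟩
  · rw [g1, h₃.edges.pred]; exact f1
  · rw [g2, h₃.nextQ_eq]; exact f7
  · rw [g3]
    exact f4 ▸ h₃.nextP_le
  · rw [g4, h₃.edges.toSub]; exact h₂.toSub_eq x
  · rw [g5, h₃.edges.mark]
    simp only [f2]
  · rw [g6, h₃.edges.lastW]; exact h₂.lastW_eq e he
  · rw [g6, g7, g8, h₃.edges.lastW, h₃.edges.deref, h₃.edges.nextCell]
    exact h₂.cells
  · rw [g9]
    exact hblk_old x fun hh => hx (hms x hh.1)
  · rw [g9]
    -- The states that stay in `B` are the unmarked ones and the marked ones with key `v₀`, so all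
    -- of them have key `v₀`.
    have hval : ∀ z, s.blk z = B → ¬ (z ∈ (s.mark B).map Prod.fst ∧ val z ≠ v₀) → val z = v₀ := by
      intro z hz hz'
      by_cases hzm : z ∈ (s.mark B).map Prod.fst
      · by_contra hne
        exact hz' ⟨hzm, hne⟩
      · exact hv₀ z hz hzm
    by_cases hx : x ∈ (s.mark B).map Prod.fst ∧ val x ≠ v₀ <;>
      by_cases hy : y ∈ (s.mark B).map Prod.fst ∧ val y ≠ v₀
    · rw [hms x hx.1, hms y hy.1]
      simp only [true_and, forall_const]
      have hxg : (x, val x) ∈ gs.flatten := hperm.mem_iff.2 ((hmv _ _).2 ⟨hx.1, hx.2, rfl⟩)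
      obtain ⟨g, hg, hxg⟩ := List.mem_flatten.1 hxg
      have hyg : (y, val y) ∈ gs.flatten := hperm.mem_iff.2 ((hmv _ _).2 ⟨hy.1, hy.2, rfl⟩)
      obtain ⟨g', hg', hyg⟩ := List.mem_flatten.1 hyg
      have hiff := h₃.blk_eq (g.map Prod.fst) (List.mem_map_of_mem hg) x
        (List.mem_map_of_mem (f := Prod.fst) hxg) y ((hfl y).2 hy)
      rw [eq_comm, hiff, List.mem_map]
      constructor
      · rintro ⟨⟨y', w⟩, hyw, rfl⟩
        have hw := ((hmv _ _).1 (hperm.mem_iff.1 (List.mem_flatten.2 ⟨g, hg, hyw⟩))).2.2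
        have := hgs.key_eq g hg _ hxg _ hyw
        exact this.trans hw
      · intro hxy
        by_cases hgg : g = g'
        · subst hgg
          exact ⟨_, hyg, rfl⟩
        · exfalso
          have hsym : Std.Symm (fun g g' : List (X × H.obj Three.{u}) =>
              ∀ a ∈ g, ∀ b ∈ g', a.2 ≠ b.2) := ⟨fun a b hab p hp r hr => (hab r hr p hp).symm⟩
          exact hgs.pairwise.forall hg hg' hgg _ hxg _ hyg hxy
    · rw [hblk_old y hy]
      have h1 := hblk_new x hx
      have h2 := hlt y
      refine iff_of_false (by omega) ?_
      rintro ⟨h3, h4⟩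
      have hxB := hms x hx.1
      exact hx.2 ((h4 hxB).trans (hval y (h3 ▸ hxB) hy))
    · rw [hblk_old x hx]
      have h1 := hblk_new y hy
      have h2 := hlt x
      refine iff_of_false (by omega) ?_
      rintro ⟨h3, h4⟩
      have hyB := hms y hy.1
      exact hy.2 ((h4 (h3.trans hyB)).symm.trans (hval x (h3.trans hyB) hx))
    · rw [hblk_old x hx, hblk_old y hy, iff_self_and]
      intro hxy hxB
      rw [hval x hxB hx, hval y (hxy ▸ hxB) hy]
  · rw [g9, g10]
    by_cases hx : x ∈ (s.mark B).map Prod.fst ∧ val x ≠ v₀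
    · rw [(hblk_new x hx).2, hms x hx.1]
    · rw [hblk_old x hx, h₃.comp_old _ (by simpa only [f4] using hlt x)]
      exact congrFun f5 _

/-- Here `vC` is a key such that only the states in `Mid` deviate from it. Grouping sorts at most
twice as many elements as deviate from any given key, so the logarithm is charged to marked states
in `Mid` only. -/
theorem ev_splitBlock {cT cc : ℕ} (hT : ∀ l x, T.updateTime l x ≤ cT * (l.length + 1))
    (hcc : ∀ a b, T.compareTime a b ≤ cc) (hw : R.IsWeight wt) (hinp : inp.Encodes ξ)
    (hS : ∀ y ∈ S, q y = k) (hD : ∀ y, q y ≠ D) {s : Mem R inp} (hs : s.Hole ∅ ∅)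
    (hcell : Cells inp ξ wt Set.univ c s.lastW s.deref s.nextCell) {B : ℕ}
    (hne : s.mark B ≠ []) (hmk : ((s.mark B).map Prod.fst).Nodup)
    (hmk' : ∀ xp ∈ s.mark B, s.blk xp.1 = B ∧ c xp.1 = q ∧ (s.toSub xp.1).Nodup ∧
      (∀ e, e ∈ s.toSub xp.1 ↔ (inp.graph e).1 = xp.1 ∧ (inp.graph e).2.2 ∈ S) ∧
      ∃ e ∈ s.toSub xp.1, s.lastW e = xp.2) {v₀ vC : H.obj Three.{u}}
    (hv₀ : ∀ x, s.blk x = B → x ∉ (s.mark B).map Prod.fst →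
      fmap H (chi S {y | q y = k}) (ξ x) = v₀)
    {Mid : X → Prop} [DecidablePred Mid]
    (hmid : ∀ x ∈ (s.mark B).map Prod.fst, fmap H (chi S {y | q y = k}) (ξ x) ≠ vC → Mid x)
    {n : ℕ} (hn : (s.mark B).length ≤ n) :
    (splitBlock R T inp B v₀).Ev s (fun _ s' t => BlockSplit ξ wt q S D c
        (fun x => fmap H (chi S {y | q y = k}) (ξ x)) B s s' ∧
      t ≤ (cT + 5 * cc + 45) * ((((s.mark B).map Prod.fst).map fun x =>
        (s.toSub x).length + 1 + (Nat.clog 2 n + 1) * if Mid x then 1 else 0).sum + 1)) := by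
  have hB : s.mem B ≠ [] := by
    obtain ⟨xp, hxp⟩ := List.exists_mem_of_ne_nil _ hne
    exact List.ne_nil_of_mem ((hs.mem_iff _ _).2 ⟨(hmk' xp hxp).1, by simp⟩)
  have hms : ∀ x ∈ (s.mark B).map Prod.fst, s.blk x = B := by
    rintro _ hx
    obtain ⟨xp, hxp, rfl⟩ := List.mem_map.1 hx
    exact (hmk' xp hxp).1
  have hs0 : ({ s with moved := [] } : Mem R inp).Hole ∅ ∅ :=
    ⟨hs.1, hs.2, hs.3, hs.4, hs.5, hs.6, hs.7, hs.8, hs.9⟩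
  unfold splitBlock
  rw [Comp.ev_bind, clearMoved, Comp.ev_write, Comp.ev_bind, Comp.ev_read, Comp.ev_bind]
  refine (ev_splitBlock_moving (s := { s with moved := [] }) hT hcc hw hinp hS hD hs0 hcell
    hmk hmk' v₀ rfl).mono ?_
  rintro _ s₂ t₂ ⟨h₂', ht₂⟩
  have h₂ : Moving ξ wt q S D c (fun x => fmap H (chi S {y | q y = k}) (ξ x)) v₀ B s
      ((s.mark B).map Prod.fst) s₂ :=
    ⟨h₂'.frame, h₂'.moved_eq, h₂'.mem_ne, h₂'.nodup, h₂'.mem_iff, h₂'.toSub_eq, h₂'.lastW_eq,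
      h₂'.cells⟩
  obtain ⟨f1, f2, f3, f4, f5, f6, f7, f8⟩ := h₂.frame
  simp only [Comp.ev_bind, clearMark, Comp.ev_write, Comp.ev_read]
  refine (ev_group hcc Prod.snd _ s₂.moved).mono ?_
  rintro gs _ t₃ ⟨rfl, ⟨N, ht₃, hN1, hN2⟩, hperm, hgs⟩
  have hmvfst : s₂.moved.map Prod.fst = (((s.mark B).map Prod.fst).filter
      (fun x => fmap H (chi S {y | q y = k}) (ξ x) ≠ v₀)).reverse := by
    rw [h₂.moved_eq, List.map_reverse, List.map_map]
    congr 1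
    exact List.map_id _
  have hmvnd : (s₂.moved.map Prod.fst).Nodup := by
    rw [hmvfst, List.nodup_reverse]
    exact hmk.filter _
  have hmvlen : s₂.moved.length ≤ (s.mark B).length := by
    rw [← List.length_map (f := Prod.fst), hmvfst, List.length_reverse]
    exact (List.length_filter_le _ _).trans (by rw [List.length_map])
  have hcompB : s.comp B < s.nextQ := by
    obtain ⟨x, hx⟩ := List.exists_mem_of_ne_nil _ hB
    rw [← ((hs.mem_iff _ _).1 hx).1]
    exact hs.comp_lt (by simp)
  have hhole : ({ s₂ with mark := Function.update s₂.mark B [] } : Mem R inp).Hole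
      {x | x ∈ s₂.moved.map Prod.fst} {B} := by
    refine hs.takeOut hB (fun x hx => ?_) h₂.nodup (fun x => ?_) h₂.mem_ne f3 f4 f5 f6 f7 f8
    · rw [Set.mem_ofPred_eq, hmvfst, List.mem_reverse] at hx
      exact hms x (List.mem_filter.1 hx).1
    · rw [Set.mem_ofPred_eq, hmvfst]
      simpa using h₂.mem_iff x
  rw [congrFun f5 B]
  refine (ev_insertBlocks Prod.fst gs hhole (by simpa only [f7] using hcompB) hgs.ne_nil
    ((hperm.map _).nodup_iff.2 hmvnd) (fun x hx => (hperm.map _).mem_iff.1 hx)).mono ?_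
  rintro _ s₃ t₄ ⟨h₃, ht₄⟩
  rw [hperm.length_eq] at ht₄
  have hBlt : B < s.nextP := by
    obtain ⟨x, hx⟩ := List.exists_mem_of_ne_nil _ hB
    rw [← ((hs.mem_iff _ _).1 hx).1]
    exact hs.blk_lt x (by simp)
  have hcB : s₃.comp B = s.comp B := by
    rw [h₃.comp_old B (by simpa only [f4] using hBlt)]
    exact congrFun f5 B
  have htime : ∀ t₅ ≤ 1, 1 + (1 + (t₂ + (1 + (1 + (t₃ + (1 + (t₄ + (1 + t₅)))))))) ≤
      (cT + 5 * cc + 45) * ((((s.mark B).map Prod.fst).map fun x =>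
        (s.toSub x).length + 1 + (Nat.clog 2 n + 1) * if Mid x then 1 else 0).sum + 1) := by
    intro t₅ ht₅
    rw [sum_map_add_mul_ite]
    have e1 : (s.mark B).length ≤
        (((s.mark B).map Prod.fst).map fun x => (s.toSub x).length + 1).sum := by
      rw [← List.length_map (f := Prod.fst)]
      generalize (s.mark B).map Prod.fst = l
      induction l with
      | nil => simp
      | cons x l ih => simp only [List.map_cons, List.sum_cons, List.length_cons]; omega
    -- The bound for grouping is applied to the key `vC`, which need not be the candidate that
    -- grouping has found.
    have e2 : N ≤ 2 * ((s.mark B).map Prod.fst).countP (fun x => Mid x) := by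
      refine (hN2 vC).trans (Nat.mul_le_mul_left 2 ?_)
      rw [h₂.moved_eq, List.countP_reverse, List.countP_map]
      refine (List.countP_mono_left fun x hx hx' => ?_).trans
        (List.Sublist.countP_le (List.filter_sublist ..))
      simp only [Function.comp, decide_eq_true_eq] at hx' ⊢
      exact hmid x (List.mem_filter.1 hx).1 hx'
    have e3 : N * (Nat.clog 2 N + 1) ≤ 2 * ((Nat.clog 2 n + 1) *
        ((s.mark B).map Prod.fst).countP (fun x => Mid x)) := by
      refine (Nat.mul_le_mul e2 (Nat.add_le_add_right
        (Nat.clog_mono_right 2 ((hN1.trans hmvlen).trans hn)) 1)).trans_eq (by ring)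
    simp only at ht₂
    generalize (((s.mark B).map Prod.fst).map fun x => (s.toSub x).length + 1).sum = A at *
    generalize (Nat.clog 2 n + 1) * ((s.mark B).map Prod.fst).countP (fun x => Mid x) = G at *
    generalize N * (Nat.clog 2 N + 1) = G' at *
    have e4 : (4 * cc + 13) * (s₂.moved.length + 1) ≤ (4 * cc + 13) * (A + 1) :=
      Nat.mul_le_mul_left _ (by omega)
    have e5 := Nat.mul_le_mul_left (cc + 5) e3
    have e6 : 0 ≤ cT * G := Nat.zero_le _
    have e7 : 0 ≤ cc * G := Nat.zero_le _
    nlinarith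
  by_cases hm : s₃.mem B = []
  · simp only [hm, List.isEmpty_nil, if_true, detach, Comp.ev_write]
    refine ⟨?_, htime 1 le_rfl⟩
    refine .of_inserted hs hB hms hv₀ h₂ hperm hgs h₃ ?_
    rw [if_pos hm, hcB]
  · have e0 : (s₃.mem B).isEmpty = false := by simpa using hm
    simp only [e0, Bool.false_eq_true, if_false, Comp.ev_ret]
    refine ⟨?_, htime 0 (by omega)⟩
    refine .of_inserted hs hB hms hv₀ h₂ hperm hgs h₃ ?_
    rw [if_neg hm]

end SplitBlock

/-! ### Correctness and cost of the procedure `Split` -/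

section Split

variable {H : Type u ⥤ Type u} {enc : FunctorEncoding.{u, v} H}
  {R : RefinementInterface.{u, v, w} enc} {T : R.Timing}
  {X : Type u} [DecidableEq X] {inp : Input H enc.Label X}

/-- The number of edges into a state. -/
def Input.indeg (inp : Input H enc.Label X) (y : X) : ℕ :=
  (Finset.univ.filter (fun e => (inp.graph e).2.2 = y)).card

/-- The state `x` has an edge into `S` and an edge into the rest of the class `k` of `q`. -/
def Input.Middle (inp : Input H enc.Label X) (q : X → ℕ) (S : Set X) (k : ℕ) (x : X) : Prop :=
  (∃ e, (inp.graph e).1 = x ∧ (inp.graph e).2.2 ∈ S) ∧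
  ∃ e, (inp.graph e).1 = x ∧ q (inp.graph e).2.2 = k ∧ (inp.graph e).2.2 ∉ S

/-- The state after the blocks in `Bs` have been split, starting from `s`. -/
structure Splitting (ξ : X → H.obj X) (wt : Set X → H.obj X → R.W) (q : X → ℕ) (S : Set X)
    (D : ℕ) (val : X → H.obj Three.{u}) (s : Mem R inp) (Bs : List ℕ) (s' : Mem R inp) : Prop where
  hole : s'.Hole ∅ ∅
  pred_eq : s'.pred = s.pred
  toSub_eq : ∀ x, s'.toSub x = if s.blk x ∈ Bs then [] else s.toSub x
  mark_eq : ∀ B, s'.mark B = if B ∈ Bs then [] else s.mark B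
  lastW_eq : ∀ e, s.blk (inp.graph e).1 ∉ Bs → s'.lastW e = s.lastW e
  cells : Cells inp ξ wt Set.univ
    (fun x => if s.blk x ∈ Bs ∧ s.toSub x ≠ [] then splitOff q S D else q)
    s'.lastW s'.deref s'.nextCell
  blk_old : ∀ x, s.blk x ∉ Bs → s'.blk x = s.blk x
  blk_iff : ∀ x y, s'.blk x = s'.blk y ↔ s.blk x = s.blk y ∧ (s.blk x ∈ Bs → val x = val y)
  comp_eq : ∀ x, s'.comp (s'.blk x) = s.comp (s.blk x)

variable {ξ : X → H.obj X} {wt : Set X → H.obj X → R.W} {q : X → ℕ} {S : Set X} {k D : ℕ}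

/-- A block not yet treated still has its old elements and markings: earlier splits changed only
their own blocks and gave the moved states new names. So the split of `B` refines the original block
`B`. -/
theorem Splitting.snoc {val : X → H.obj Three.{u}} {s s₁ s₂ : Mem R inp} {Bs : List ℕ}
    (h : Splitting ξ wt q S D val s Bs s₁) {B : ℕ} (hB : B ∉ Bs) {x₀ : X} (hx₀ : s.blk x₀ = B)
    (hmk : ∀ x, x ∈ (s.mark B).map Prod.fst ↔ s.blk x = B ∧ s.toSub x ≠ [])
    {c : X → X → ℕ}
    (hc : c = fun x => if s.blk x ∈ Bs ∧ s.toSub x ≠ [] then splitOff q S D else q)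
    (h' : BlockSplit ξ wt q S D c val B s₁ s₂) :
    Splitting ξ wt q S D val s (Bs ++ [B]) s₂ := by
  have hblk : ∀ x, s₁.blk x = B ↔ s.blk x = B := by
    intro x
    constructor
    · intro hx
      have := h.blk_old x₀ (by rwa [hx₀])
      rw [hx₀] at this
      exact ((h.blk_iff x x₀).1 (hx.trans this.symm)).1.trans hx₀
    · intro hx
      rw [h.blk_old x (by rwa [hx]), hx]
  have hmB : s₁.mark B = s.mark B := by rw [h.mark_eq, if_neg hB]
  refine ⟨h'.hole, h'.pred_eq.trans h.pred_eq, fun x => ?_, fun B' => ?_, fun e he => ?_, ?_,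
    fun x hx => ?_, fun x y => ?_, fun x => (h'.comp_eq x).trans (h.comp_eq x)⟩
  · rw [h'.toSub_eq, h.toSub_eq, hmB]
    simp only [hmk, List.mem_append, List.mem_singleton]
    by_cases h1 : s.blk x ∈ Bs
    · simp [h1]
    · by_cases h2 : s.blk x = B
      · by_cases h3 : s.toSub x = [] <;> simp [h2, h3]
      · simp [h1, h2]
  · rw [h'.mark_eq]
    by_cases h1 : B' = B
    · subst h1; simp
    · rw [Function.update_of_ne h1, h.mark_eq]
      simp [h1]
  · simp only [List.mem_append, List.mem_singleton, not_or] at he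
    rw [h'.lastW_eq e (by rw [hmB, hmk]; exact fun hh => he.2 hh.1), h.lastW_eq e he.1]
  · have := h'.cells
    rw [hmB] at this
    convert this using 2 with x
    subst hc
    simp only [hmk, List.mem_append, List.mem_singleton]
    by_cases h1 : s.blk x ∈ Bs
    · by_cases h3 : s.toSub x = [] <;> simp [h1, h3]
    · by_cases h2 : s.blk x = B
      · by_cases h3 : s.toSub x = [] <;> simp [h2, h3]
      · simp [h1, h2]
  · simp only [List.mem_append, List.mem_singleton, not_or] at hx
    rw [h'.blk_old x (fun hh => hx.2 ((hblk x).1 hh)), h.blk_old x hx.1]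
  · rw [h'.blk_iff, h.blk_iff, hblk]
    simp only [List.mem_append, List.mem_singleton]
    tauto

/-- A touched block has a marked state and a marked state has a collected edge. All constant
overheads per block and per state are thus absorbed by the number of edges, which doubles the
constants. -/
theorem sum_touched_le {A : Type*} (ts : X → List A) [Fintype X] (mk : ℕ → List (X × ℕ))
    (blk : X → ℕ) {bs : List ℕ} (hbs : bs.Nodup) (hne : ∀ B ∈ bs, mk B ≠ [])
    (hmk : ∀ B, ((mk B).map Prod.fst).Nodup)
    (hblk : ∀ B, ∀ x ∈ (mk B).map Prod.fst, blk x = B ∧ ts x ≠ [])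
    (L K : ℕ) (p : X → Prop) [DecidablePred p] :
    (bs.map fun B => K * ((((mk B).map Prod.fst).map fun x =>
      (ts x).length + 1 + L * if p x then 1 else 0).sum + 1) + 1).sum ≤
    (2 * K + 1) * (2 * (∑ x, (ts x).length) + L * (Finset.univ.filter p).card) := by
  have h1 : (bs.map fun B => K * ((((mk B).map Prod.fst).map fun x =>
      (ts x).length + 1 + L * if p x then 1 else 0).sum + 1) + 1).sum ≤
      (bs.map fun B => (2 * K + 1) * (((mk B).map Prod.fst).map fun x =>
        2 * (ts x).length + L * if p x then 1 else 0).sum).sum := by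
    refine List.sum_le_sum fun B hB => ?_
    have h2 : (((mk B).map Prod.fst).map fun x =>
        (ts x).length + 1 + L * if p x then 1 else 0).sum ≤ (((mk B).map Prod.fst).map fun x =>
        2 * (ts x).length + L * if p x then 1 else 0).sum := by
      refine List.sum_le_sum fun x hx => ?_
      have := List.length_pos_of_ne_nil (hblk B x hx).2
      omega
    have h3 : 1 ≤ (((mk B).map Prod.fst).map fun x =>
        (ts x).length + 1 + L * if p x then 1 else 0).sum := by
      rcases hm : mk B with _ | ⟨a, l⟩
      · exact absurd hm (hne B hB)
      · simp only [List.map_cons, List.sum_cons]; omega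
    nlinarith
  refine h1.trans ?_
  rw [List.sum_map_mul_left]
  refine Nat.mul_le_mul_left _ ?_
  have hnd : (bs.flatMap fun B => (mk B).map Prod.fst).Nodup := by
    refine List.nodup_flatMap.2 ⟨fun B _ => hmk B, hbs.imp fun {a b} hab x hxa hxb => hab ?_⟩
    rw [← (hblk a x hxa).1, ← (hblk b x hxb).1]
  have h4 : (bs.map fun B => (((mk B).map Prod.fst).map fun x =>
      2 * (ts x).length + L * if p x then 1 else 0).sum).sum =
      ((bs.flatMap fun B => (mk B).map Prod.fst).map fun x =>
        2 * (ts x).length + L * if p x then 1 else 0).sum := by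
    rw [List.map_flatMap, List.flatMap, List.sum_flatten, List.map_map]
    rfl
  rw [h4, ← List.sum_toFinset _ hnd, Finset.card_filter, Finset.mul_sum, Finset.mul_sum,
    ← Finset.sum_add_distrib]
  exact Finset.sum_le_sum_of_subset (Finset.subset_univ _)

open Classical in
-- The hypothesis `hstab` makes `H χ_∅^C` and `H χ_C^C` constant on each block, because both
-- characteristic maps factor through `q`. The first value is `v∅`, valid for all states of the
-- block without an edge into `S`. The second is the key of those whose edges into `C` all end in
-- `S`, so that only the states in `Middle` can deviate from it among the marked ones.
theorem ev_split [LinearOrder (H.obj Three.{u})] [Fintype X] {cT cc : ℕ} (hT : ∀ l x, T.updateTime l x ≤ cT * (l.length + 1))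
    (hcc : ∀ a b, T.compareTime a b ≤ cc) (hw : R.IsWeight wt) (hinp : inp.Encodes ξ)
    {s : Mem R inp} (hs : s.Hole ∅ ∅) {S : ℕ}
    (hS : ∀ y ∈ s.mem S, q y = k) (hD : ∀ y, q y ≠ D)
    (hts : ∀ x, s.toSub x = []) (hmark : ∀ B, s.mark B = [])
    (hp : ∀ y, (s.pred y).Nodup) (hpred : ∀ y e, e ∈ s.pred y ↔ (inp.graph e).2.2 = y)
    (hcell : Cells inp ξ wt Set.univ (fun _ => q) s.lastW s.deref s.nextCell)
    (hstab : ∀ x y, s.blk x = s.blk y →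
      fmap H (lifted q) (ξ x) = fmap H (lifted q) (ξ y)) :
    (split R T inp S).Ev s (fun _ s' t =>
      (s'.Hole ∅ ∅ ∧ s'.pred = s.pred ∧ (∀ x, s'.toSub x = []) ∧ (∀ B, s'.mark B = []) ∧
        Cells inp ξ wt Set.univ (fun _ => splitOff q {y | y ∈ s.mem S} D)
          s'.lastW s'.deref s'.nextCell ∧
        (∀ x y, s'.blk x = s'.blk y ↔ s.blk x = s.blk y ∧
          fmap H (chi {y | y ∈ s.mem S} {y | q y = k}) (ξ x) =
            fmap H (chi {y | y ∈ s.mem S} {y | q y = k}) (ξ y)) ∧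
        ∀ x, s'.comp (s'.blk x) = s.comp (s.blk x)) ∧
      t ≤ (5 * cT + 20 * cc + 210) * ((∑ y ∈ (s.mem S).toFinset, (inp.indeg y + 1)) + 1 +
        (Nat.clog 2 (Fintype.card X) + 1) *
          (Finset.univ.filter (inp.Middle q {y | y ∈ s.mem S} k)).card)) := by
  set Sset : Set X := {y | y ∈ s.mem S} with hSset
  set val : X → H.obj Three.{u} := fun x => fmap H (chi Sset {y | q y = k}) (ξ x) with hval
  have hindeg : ∀ y, (s.pred y).length = inp.indeg y := by
    intro y
    rw [Input.indeg, ← List.toFinset_card_of_nodup (hp y)]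
    congr 1
    ext e
    simp [hpred]
  unfold split
  rw [Comp.ev_bind]
  refine (ev_collect (S := S) hT s hts hmark (hs.mem_nodup S) hp hpred
    (wv := fun e => wt {y | q y = k} (ξ (inp.graph e).1)) ?_).mono ?_
  · intro e he
    rw [hcell.deref_eq e (Set.mem_univ _), hS _ he]
  rintro _ _ t₁ ⟨⟨ts, mk, tl, rfl, hcol⟩, ht₁⟩
  rw [Comp.ev_bind, Comp.ev_read]
  simp only
  set s₁ : Mem R inp := { s with toSub := ts, mark := mk, touched := tl } with hs₁
  have hs₁h : s₁.Hole ∅ ∅ := ⟨hs.1, hs.2, hs.3, hs.4, hs.5, hs.6, hs.7, hs.8, hs.9⟩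
  have hmkts : ∀ B x, x ∈ (mk B).map Prod.fst ↔ s.blk x = B ∧ ts x ≠ [] := by
    intro B x
    constructor
    · intro hx
      obtain ⟨xp, hxp, rfl⟩ := List.mem_map.1 hx
      obtain ⟨h1, e, he, -⟩ := hcol.mk_mem B xp hxp
      exact ⟨h1, List.ne_nil_of_mem he⟩
    · rintro ⟨rfl, h2⟩
      exact hcol.mk_of_ts x h2
  have hnoedge : ∀ x, ts x = [] → fil Sset (enc.flat X (ξ x)) = 0 := by
    intro x hx
    rw [hinp.fil_eq (es := ts x) (hcol.ts_nodup x)]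
    · simp [hx]
    · intro e
      rw [hcol.ts_iff, and_comm]
      rfl
  have hSC : Sset ⊆ {y | q y = k} := hS
  have hlast : ∀ (e e' : Fin inp.m), e ∈ ts (inp.graph e').1 → e' ∈ ts (inp.graph e').1 →
      s.lastW e = s.lastW e' := by
    intro e e' he he'
    rw [hcol.ts_iff] at he he'
    rw [hcell.inj e e' (Set.mem_univ _) (Set.mem_univ _)]
    exact ⟨he.2, (hS _ he.1).trans (hS _ he'.1).symm⟩
  refine (ev_forEach (fun pre s' => Splitting ξ wt q Sset D val s₁ (pre.map Prod.fst) s')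
    (fun Bv => (cT + 5 * cc + 45) * ((((mk Bv.1).map Prod.fst).map fun x =>
        (ts x).length + 1 + (Nat.clog 2 (Fintype.card X) + 1) *
          if inp.Middle q Sset k x then 1 else 0).sum + 1)) ?_ ?_).mono ?_
  · refine ⟨hs₁h, rfl, by simp, by simp, by simp, by simpa using hcell, by simp, by simp,
      by simp⟩
  · rintro pre ⟨B, v₀⟩ suf hl s₂ h₂
    have hBv : (B, v₀) ∈ tl := by rw [hl]; simp
    have hBpre : B ∉ pre.map Prod.fst := by
      have := hcol.tl_nodup
      rw [hl, List.map_append, List.map_cons] at this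
      exact fun hm => (List.nodup_append.1 this).2.2 B hm B (by simp) rfl
    have hmB : s₂.mark B = mk B := by rw [h₂.mark_eq, if_neg hBpre]
    have hneB : mk B ≠ [] := (hcol.tl_iff B).1 (List.mem_map_of_mem hBv)
    obtain ⟨e₀, he₀, hB₀, hv₀⟩ := hcol.tl_val _ hBv
    simp only at hB₀ hv₀
    have hblk : ∀ x, s₂.blk x = B ↔ s.blk x = B := by
      intro x
      constructor
      · intro hx
        have := h₂.blk_old (inp.graph e₀).1 (by rwa [show s₁.blk _ = B from hB₀])
        rw [show s₁.blk _ = B from hB₀] at this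
        exact ((h₂.blk_iff x _).1 (hx.trans this.symm)).1.trans hB₀
      · intro hx
        rw [h₂.blk_old x (by rwa [show s₁.blk _ = B from hx])]
        exact hx
    have hts₂ : ∀ x, s.blk x = B → s₂.toSub x = ts x := by
      intro x hx
      rw [h₂.toSub_eq, if_neg (by rwa [show s₁.blk _ = B from hx])]
    have hstep := ev_splitBlock (T := T) hT hcc hw hinp hSC hD h₂.hole h₂.cells (B := B)
      (by rwa [hmB]) (by rw [hmB]; exact hcol.mk_nodup B) (v₀ := v₀)
      (vC := fmap H (chi {y | q y = k} {y | q y = k}) (ξ (inp.graph e₀).1))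
      (Mid := inp.Middle q Sset k) (n := Fintype.card X) ?_ ?_ ?_ ?_
    · refine hstep.mono ?_
      rintro _ s₃ t ⟨h₃, ht⟩
      refine ⟨?_, ht.trans_eq ?_⟩
      · rw [List.map_append]
        exact h₂.snoc hBpre hB₀ (hmkts B) rfl h₃
      · simp only [hmB]
        congr 3
        refine List.map_congr_left fun x hx => ?_
        rw [hts₂ x ((hmkts B x).1 hx).1]
    · rw [hmB]
      intro xp hxp
      obtain ⟨h1, e, he, h2⟩ := hcol.mk_mem B xp hxp
      rw [hts₂ _ h1]
      refine ⟨(hblk _).2 h1, if_neg fun hh => hBpre (h1 ▸ hh.1), hcol.ts_nodup _, fun e => ?_,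
        e, he, ?_⟩
      · rw [hcol.ts_iff, and_comm]
        rfl
      · rw [h₂.lastW_eq e (by
          rw [((hcol.ts_iff _ _).1 he).2]
          rwa [show s₁.blk _ = B from h1])]
        exact h2
    · intro x hx hxm
      rw [hblk] at hx
      rw [hmB, hmkts, not_and, not_not] at hxm
      -- The value `v₀` was computed at the source of `e₀`, a state of the same block, with the
      -- empty bag; stability transports it to `x`.
      rw [(hw.of_fil_eq_zero hSC (hnoedge x (hxm hx))).1, hv₀, hw.update_zero]
      exact fmap_chi_eq (by simp) (fun a b hab => by simp [hab]) x
        (hstab _ _ (hx.trans hB₀.symm))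
    · rw [hmB]
      intro x hx hne
      obtain ⟨hxB, hxts⟩ := (hmkts B x).1 hx
      obtain ⟨e, he⟩ := List.exists_mem_of_ne_nil _ hxts
      obtain ⟨he1, he2⟩ := (hcol.ts_iff _ _).1 he
      refine ⟨⟨e, he2, he1⟩, ?_⟩
      by_contra hno
      -- If `x` had no edge into the rest of the class, its key would be that of `χ_C^C`, and
      -- stability would make this equal to the value at the source of `e₀`.
      refine hne ((hw.of_fil_diff_eq_zero hSC ?_).trans
        (fmap_chi_eq (fun a b hab => by simp [hab]) (fun a b hab => by simp [hab]) x
          (hstab _ _ (hxB.trans hB₀.symm))))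
      rw [hinp.fil_eq (es := []) (by simp)]
      · simp
      · intro e'
        simp only [List.not_mem_nil, false_iff]
        exact fun hh => hno ⟨e', hh.1, hh.2.1, hh.2.2⟩
    · rw [hmB, ← List.length_map (f := Prod.fst)]
      exact (hcol.mk_nodup B).length_le_card
  · rintro _ s₃ t₂ ⟨h₃, ht₂⟩
    have htouched : ∀ x, ts x ≠ [] → s.blk x ∈ tl.map Prod.fst := by
      intro x hx
      rw [hcol.tl_iff]
      exact List.ne_nil_of_mem (List.mem_map.1 (hcol.mk_of_ts x hx)).choose_spec.1
    refine ⟨⟨h₃.hole, h₃.pred_eq, fun x => ?_, fun B => ?_, ?_, fun x y => ?_, h₃.comp_eq⟩, ?_⟩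
    · rw [h₃.toSub_eq]
      split_ifs with h
      · rfl
      · by_contra hne
        exact h (htouched x hne)
    · rw [h₃.mark_eq]
      split_ifs with h
      · rfl
      · by_contra hne
        exact h ((hcol.tl_iff B).2 hne)
    · refine h₃.cells.finish hw hinp hSC hD fun x => ?_
      by_cases hx : ts x = []
      · right
        refine ⟨if_neg fun hh => hh.2 hx, fun e he heS => ?_⟩
        have : e ∈ ts x := (hcol.ts_iff _ _).2 ⟨heS, he⟩
        simp [hx] at this
      · exact Or.inl (if_pos ⟨htouched x hx, hx⟩)
    · rw [h₃.blk_iff]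
      refine and_congr_right fun hxy => ⟨fun h => ?_, fun h _ => h⟩
      -- In an untouched block no state has an edge into `S`; all keys are then equal, so leaving
      -- the block alone is the same as splitting it by the key.
      by_cases hB : s.blk x ∈ tl.map Prod.fst
      · exact h hB
      · have hx : ts x = [] := by
          by_contra hne
          exact hB (htouched x hne)
        have hy : ts y = [] := by
          by_contra hne
          exact hB ((show s.blk x = s.blk y from hxy) ▸ htouched y hne)
        rw [(hw.of_fil_eq_zero hSC (hnoedge x hx)).1, (hw.of_fil_eq_zero hSC (hnoedge y hy)).1]
        exact fmap_chi_eq (by simp) (fun a b hab => by simp [hab]) x (hstab _ _ hxy)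
    · have hsum := sum_touched_le ts mk s.blk hcol.tl_nodup (fun B hB => (hcol.tl_iff B).1 hB)
        hcol.mk_nodup (fun B x hx => (hmkts B x).1 hx) (Nat.clog 2 (Fintype.card X) + 1)
        (cT + 5 * cc + 45) (inp.Middle q Sset k)
      rw [List.map_map] at hsum
      have e1 : ((s.mem S).map fun y => (s.pred y).length + 1).sum =
          ∑ y ∈ (s.mem S).toFinset, (inp.indeg y + 1) := by
        rw [← List.sum_toFinset _ (hs.mem_nodup S)]
        simp only [hindeg]
      have e2 : ∑ x, (ts x).length ≤ ∑ y ∈ (s.mem S).toFinset, (inp.indeg y + 1) := by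
        have e3 : ∑ x, (ts x).length =
            (Finset.univ.filter fun e => (inp.graph e).2.2 ∈ s.mem S).card := by
          rw [Finset.card_eq_sum_card_fiberwise (f := fun e => (inp.graph e).1) (t := Finset.univ)
            (fun _ _ => Finset.mem_coe.2 (Finset.mem_univ _))]
          refine Finset.sum_congr rfl fun x _ => ?_
          rw [← List.toFinset_card_of_nodup (hcol.ts_nodup x)]
          congr 1
          ext e
          simp [hcol.ts_iff]
        have e4 : (Finset.univ.filter fun e => (inp.graph e).2.2 ∈ s.mem S).card =
            ∑ y ∈ (s.mem S).toFinset, inp.indeg y := by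
          rw [Finset.card_eq_sum_card_fiberwise (f := fun e => (inp.graph e).2.2)
            (t := (s.mem S).toFinset) (fun e he => by simpa using he)]
          refine Finset.sum_congr rfl fun y hy => ?_
          rw [Input.indeg]
          congr 1
          ext e
          simp only [Finset.mem_filter, Finset.mem_univ, true_and, and_iff_right_iff_imp]
          rintro rfl
          simpa using hy
        rw [e3, e4]
        exact Finset.sum_le_sum fun y _ => Nat.le_succ _
      rw [e1] at ht₁
      have e5 : (tl.map ((fun B => (cT + 5 * cc + 45) * ((((mk B).map Prod.fst).map fun x =>
        (ts x).length + 1 + (Nat.clog 2 (Fintype.card X) + 1) *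
          if inp.Middle q Sset k x then 1 else 0).sum + 1) + 1) ∘ Prod.fst)) =
        tl.map (fun Bv => (cT + 5 * cc + 45) * ((((mk Bv.1).map Prod.fst).map fun x =>
        (ts x).length + 1 + (Nat.clog 2 (Fintype.card X) + 1) *
          if inp.Middle q Sset k x then 1 else 0).sum + 1) + 1) := rfl
      rw [e5] at hsum
      have ht₃ := ht₂.trans (Nat.add_le_add_right hsum 1)
      clear hsum e5 e1 ht₂
      generalize (Nat.clog 2 (Fintype.card X) + 1) *
        (Finset.univ.filter (inp.Middle q Sset k)).card = G at *
      generalize ∑ y ∈ (s.mem S).toFinset, (inp.indeg y + 1) = A at *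
      generalize ∑ x, (ts x).length = A' at *
      -- The coefficient of `A` is `2 (2 (cT + 5 cc + 45) + 1) = 4 cT + 20 cc + 182` from splitting
      -- plus `cT + 20` from collecting; the rest of `5 cT + 20 cc + 210` covers single steps.
      have e6 : (2 * (cT + 5 * cc + 45) + 1) * (2 * A' + G) ≤
          (2 * (cT + 5 * cc + 45) + 1) * (2 * A + G) := Nat.mul_le_mul_left _ (by omega)
      have e7 : 0 ≤ cT * G := Nat.zero_le _
      have e8 : 0 ≤ cc * G := Nat.zero_le _
      have e9 : 0 ≤ cc * A := Nat.zero_le _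
      nlinarith

end Split

/-! ### Potentials: sizes of classes, and pairs of a source and a reached class -/

section Potential

variable {H : Type u ⥤ Type u} {enc : FunctorEncoding.{u, v} H} {X : Type u} [DecidableEq X]
  (inp : Input H enc.Label X) (q : X → ℕ)

/-- The sum of the logarithms of the sizes of the classes around the states, weighted with the
numbers of edges into the states. -/
def Input.logPotential [Fintype X] : ℕ :=
  ∑ y, (inp.indeg y + 1) * Nat.log 2 (Finset.univ.filter (fun z => q z = q y)).card

/-- The number of pairs of a state and a class into which it has an edge. -/
def Input.linkCount : ℕ :=
  (Finset.univ.image (fun e => ((inp.graph e).1, q (inp.graph e).2.2))).card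

variable {inp q}

/-- The class around a state of `S` shrinks to at most half its size, so its logarithm drops by at
least one. The drop, weighted by `indeg y + 1`, pays for visiting `y` and the edges into it; no
other class grows. -/
theorem Input.logPotential_splitOff [Fintype X] {S : Finset X} {k D : ℕ} (hS : ∀ y ∈ S, q y = k)
    (hD : ∀ y, q y ≠ D) (h2 : 2 * S.card ≤ (Finset.univ.filter (fun z => q z = k)).card) :
    inp.logPotential (splitOff q S D) + ∑ y ∈ S, (inp.indeg y + 1) ≤ inp.logPotential q := by
  unfold Input.logPotential
  have hsum : ∑ y ∈ S, (inp.indeg y + 1) = ∑ y, if y ∈ S then inp.indeg y + 1 else 0 := by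
    rw [Finset.sum_ite_mem, Finset.univ_inter]
  rw [hsum, ← Finset.sum_add_distrib]
  refine Finset.sum_le_sum fun y _ => ?_
  by_cases hy : y ∈ S
  · have e : (Finset.univ.filter (fun z => splitOff q S D z = splitOff q S D y)) = S := by
      ext z
      rw [splitOff_of_mem (Finset.mem_coe.2 hy)]
      by_cases hz : z ∈ S
      · simp [splitOff_of_mem (Finset.mem_coe.2 hz), hz]
      · simp [splitOff_of_not_mem (fun h => hz (Finset.mem_coe.1 h)), hz, hD z]
    have hpos : S.card ≠ 0 := Finset.card_ne_zero_of_mem hy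
    have hlog : Nat.log 2 S.card + 1 ≤
        Nat.log 2 (Finset.univ.filter (fun z => q z = q y)).card := by
      rw [hS y hy, ← Nat.log_mul_base (by norm_num) hpos, mul_comm]
      exact Nat.log_mono_right h2
    rw [e, if_pos hy, ← Nat.mul_succ]
    exact Nat.mul_le_mul_left _ hlog
  · rw [if_neg hy, add_zero]
    refine Nat.mul_le_mul_left _ (Nat.log_mono_right (Finset.card_le_card fun z hz => ?_))
    simp only [Finset.mem_filter, Finset.mem_univ, true_and] at hz ⊢
    rw [splitOff_of_not_mem (fun h => hy (Finset.mem_coe.1 h))] at hz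
    by_cases hz' : z ∈ S
    · rw [splitOff_of_mem (Finset.mem_coe.2 hz')] at hz
      exact absurd hz.symm (hD y)
    · rwa [splitOff_of_not_mem (fun h => hz' (Finset.mem_coe.1 h))] at hz

open Classical in
-- A state in `Middle` reached the class `k` before and reaches both halves afterwards, so it gains
-- a pair. No pair is lost, since renaming `D` to `k` maps the new pairs onto the old ones.
theorem Input.linkCount_splitOff [Fintype X] {S : Set X} {k D : ℕ} (hS : ∀ y ∈ S, q y = k)
    (hD : ∀ y, q y ≠ D) :
    inp.linkCount q + (Finset.univ.filter (inp.Middle q S k)).card ≤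
      inp.linkCount (splitOff q S D) := by
  unfold Input.linkCount
  set M := Finset.univ.filter (inp.Middle q S k) with hM
  set A := Finset.univ.image (fun e => ((inp.graph e).1, splitOff q S D (inp.graph e).2.2)) with hA
  have hsub : M.image (fun x => (x, D)) ⊆ A := by
    intro p hp
    obtain ⟨x, hx, rfl⟩ := Finset.mem_image.1 hp
    obtain ⟨⟨e, rfl, he⟩, -⟩ := (Finset.mem_filter.1 hx).2
    exact Finset.mem_image.2 ⟨e, Finset.mem_univ _, by rw [splitOff_of_mem he]⟩
  have hcard : (M.image (fun x => (x, D))).card = M.card :=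
    Finset.card_image_of_injective _ fun a b hab => (Prod.mk.inj hab).1
  -- The old pairs are still covered after the pairs `(x, D)` with `x` in `Middle` have been
  -- discarded: for such `x` the pair with `k` comes from its edge into the rest of the class.
  have hle : (Finset.univ.image (fun e => ((inp.graph e).1, q (inp.graph e).2.2))).card ≤
      (A \ M.image (fun x => (x, D))).card := by
    refine (Finset.card_le_card ?_).trans (Finset.card_image_le
      (f := fun p : X × ℕ => (p.1, if p.2 = D then k else p.2)))
    intro p hp
    obtain ⟨e, -, rfl⟩ := Finset.mem_image.1 hp
    rw [Finset.mem_image]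
    have key : ∀ e', (inp.graph e').1 = (inp.graph e).1 → (inp.graph e').2.2 ∉ S →
        q (inp.graph e').2.2 = q (inp.graph e).2.2 →
        ∃ a ∈ A \ M.image (fun x => (x, D)), (a.1, if a.2 = D then k else a.2) =
          ((inp.graph e).1, q (inp.graph e).2.2) := by
      intro e' h1 h2 h3
      refine ⟨((inp.graph e).1, q (inp.graph e).2.2), Finset.mem_sdiff.2 ⟨?_, ?_⟩, ?_⟩
      · exact Finset.mem_image.2 ⟨e', Finset.mem_univ _, by rw [splitOff_of_not_mem h2, h1, h3]⟩
      · intro h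
        obtain ⟨x, -, hx⟩ := Finset.mem_image.1 h
        exact hD _ (Prod.mk.inj hx).2.symm
      · simp [hD]
    by_cases he : (inp.graph e).2.2 ∈ S
    · by_cases hm : inp.Middle q S k (inp.graph e).1
      · obtain ⟨-, e', h1, h2, h3⟩ := hm
        exact key e' h1 h3 (h2.trans (hS _ he).symm)
      · refine ⟨((inp.graph e).1, D), Finset.mem_sdiff.2 ⟨?_, fun h => ?_⟩, ?_⟩
        · exact Finset.mem_image.2 ⟨e, Finset.mem_univ _, by rw [splitOff_of_mem he]⟩
        · obtain ⟨x, hx, hxe⟩ := Finset.mem_image.1 h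
          rw [(Prod.mk.inj hxe).1] at hx
          exact hm (Finset.mem_filter.1 hx).2
        · simp [hS _ he]
    · exact key e rfl he rfl
  rw [Finset.card_sdiff_of_subset hsub, hcard] at hle
  have := Finset.card_le_card hsub
  rw [hcard] at this
  omega

theorem Input.linkCount_le : inp.linkCount q ≤ inp.m := by
  refine Finset.card_image_le.trans ?_
  simp

theorem Input.sum_indeg [Fintype X] : ∑ y, inp.indeg y = inp.m := by
  have := Finset.card_eq_sum_card_fiberwise (f := fun e => (inp.graph e).2.2)
    (s := Finset.univ) (t := Finset.univ) (fun _ _ => Finset.mem_coe.2 (Finset.mem_univ _))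
  rw [Finset.card_univ, Fintype.card_fin] at this
  exact this.symm

theorem Input.logPotential_le [Fintype X] :
    inp.logPotential q ≤ (inp.m + Fintype.card X) * Nat.log 2 (Fintype.card X) := by
  have : inp.m + Fintype.card X = ∑ y, (inp.indeg y + 1) := by
    rw [Finset.sum_add_distrib, Input.sum_indeg]
    simp
  rw [this, Finset.sum_mul]
  exact Finset.sum_le_sum fun y _ => Nat.mul_le_mul_left _
    (Nat.log_mono_right (Finset.card_le_univ _))

end Potential

/-! ### The main loop -/

section Loop

variable {H : Type u ⥤ Type u} {enc : FunctorEncoding.{u, v} H}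
  {R : RefinementInterface.{u, v, w} enc} {X : Type u} {inp : Input H enc.Label X}

/-- The partition `X/Q` as a map. -/
def Memory.coarse {m : ℕ} {W : Type w} {K : Type u} (s : Memory X m W K) (x : X) : ℕ :=
  s.comp (s.blk x)

/-- The invariant of the main loop. -/
structure Inv (ξ : X → H.obj X) (wt : Set X → H.obj X → R.W) (s : Mem R inp) : Prop where
  hole : s.Hole ∅ ∅
  toSub : ∀ x, s.toSub x = []
  mark : ∀ B, s.mark B = []
  pred_nodup : ∀ y, (s.pred y).Nodup
  mem_pred : ∀ y e, e ∈ s.pred y ↔ (inp.graph e).2.2 = y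
  cells : Cells inp ξ wt Set.univ (fun _ => s.coarse) s.lastW s.deref s.nextCell
  stable : ∀ x y, s.blk x = s.blk y →
    fmap H (lifted s.coarse) (ξ x) = fmap H (lifted s.coarse) (ξ y)
  blk_eq : ∀ x y, BehaviourallyEquivalent H ξ x y → s.blk x = s.blk y

variable {ξ : X → H.obj X} {wt : Set X → H.obj X → R.W}

/-- When the main loop stops, the memory holds the simple quotient. -/
theorem Inv.computesQuotient {s : Mem R inp} (hs : Inv ξ wt s) (hwork : s.work = []) :
    ComputesQuotient ξ s := by
  have hwf := hs.hole.wellFormed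
  have hiff : ∀ x y, s.coarse x = s.coarse y ↔ s.blk x = s.blk y := fun x y =>
    ⟨fun h => hwf.comp_inj hwork h, fun h => congrArg s.comp h⟩
  obtain ⟨h1, Y, f, h2, h3, h4⟩ := simple_quotient (q := s.coarse)
    (fun a b hab => hs.stable a b ((hiff a b).1 hab))
    (fun a b hab => (hiff a b).2 (hs.blk_eq a b hab))
  exact ⟨hwf, fun x y => (hiff x y).symm.trans (h1 x y), Y, f, h2,
    fun x y => (h3 x y).trans (hiff x y), h4⟩

variable {T : R.Timing} [LinearOrder (H.obj Three.{u})] [DecidableEq X]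

/-- The potential that pays for the main loop. -/
def Memory.potential [Fintype X] (s : Mem R inp) (c : ℕ) : ℕ :=
  c * (inp.logPotential s.coarse +
    (Nat.clog 2 (Fintype.card X) + 1) * (inp.m - inp.linkCount s.coarse))

/-- The drop of the potential covers the body and, by the summand `1`, the loop test before it, so
the potential bounds the time of the loop and decreases strictly. -/
theorem ev_loopBody [Fintype X] {cT cc k : ℕ}
    (hT : ∀ l x, T.updateTime l x ≤ cT * (l.length + 1))
    (hcc : ∀ a b, T.compareTime a b ≤ cc) (hH : Zippable H) (hw : R.IsWeight wt)
    (hinp : inp.Encodes ξ) {pick : Comp (Mem R inp) ℕ} (hpick : Admissible k pick)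
    {s : Mem R inp} (hs : Inv ξ wt s) (hwork : s.work ≠ []) :
    (loopBody R T inp pick).Ev s (fun _ s' t => Inv ξ wt s' ∧
      1 + t + s'.potential (10 * cT + 40 * cc + 430 + k) ≤
        s.potential (10 * cT + 40 * cc + 430 + k)) := by
  classical
  obtain ⟨S, t₀, hp, ht₀, hne, hhalf⟩ := hpick s hs.hole.wellFormed hwork
  have hmemS : ∀ y, y ∈ s.mem S ↔ s.blk y = S := fun y => by simp [hs.hole.mem_iff]
  have hS : ∀ y ∈ s.mem S, s.coarse y = s.comp S := fun y hy => by
    rw [Memory.coarse, (hmemS y).1 hy]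
  have hD : ∀ y, s.coarse y ≠ s.nextQ := fun y => (hs.hole.comp_lt (by simp)).ne
  have hsplit := ev_split (T := T) (S := S) (k := s.comp S) (D := s.nextQ) hT hcc hw hinp
    (hs.hole.isolated hne) hS hD hs.toSub hs.mark hs.pred_nodup hs.mem_pred hs.cells hs.stable
  unfold loopBody
  rw [Comp.ev_bind]
  refine ⟨S, s, t₀, hp, ?_⟩
  beta_reduce
  rw [Comp.ev_bind, Comp.ev_read]
  refine ev_isolate hs.hole hne ?_
  refine hsplit.mono ?_
  rintro _ s' t ⟨⟨h1, h2, h3, h4, h5, h6, h7⟩, ht⟩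
  have hq : s'.coarse = splitOff s.coarse {y | y ∈ s.mem S} s.nextQ := by
    funext x
    rw [Memory.coarse, h7]
    change Function.update s.comp S s.nextQ (s.blk x) = _
    by_cases hx : s.blk x = S
    · rw [hx, Function.update_self, splitOff_of_mem]
      exact (hmemS x).2 hx
    · rw [Function.update_of_ne hx, splitOff_of_not_mem]
      · rfl
      · exact fun h => hx ((hmemS x).1 h)
  refine ⟨⟨h1, h3, h4, ?_, ?_, ?_, fun x y hxy => ?_, fun x y hxy => ?_⟩, ?_⟩
  · rw [h2]; exact hs.pred_nodup
  · rw [h2]; exact hs.mem_pred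
  · rw [hq]; exact h5
  · rw [hq]
    obtain ⟨e1, e2⟩ := (h6 x y).1 hxy
    -- Stability for the refined `X/Q` needs stability for the old one and equality of the keys; the
    -- latter holds because the blocks were split by the key.
    exact hH.fmap_splitOff s.nextQ hS (hs.stable x y e1) e2
  -- Both `S` and its compound block are unions of blocks of `X/P`, so `χ_S^C` does not separate
  -- behaviourally equivalent states, and their keys agree.
  · refine (h6 x y).2 ⟨hs.blk_eq x y hxy, hxy.fmap_eq fun a b hab => ?_⟩
    have hb := hs.blk_eq a b hab
    have e1 : a ∈ (s.isolated S).mem S ↔ b ∈ (s.isolated S).mem S :=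
      (hmemS a).trans (by rw [hb]; exact (hmemS b).symm)
    have e2 : s.coarse a = s.coarse b := congrArg s.comp hb
    by_cases hbm : b ∈ (s.isolated S).mem S <;> simp [chi, e1, e2, hbm]
  · have hcoe : {y | y ∈ s.mem S} = ((s.mem S).toFinset : Set X) := by
      ext y; simp
    have hcard : 2 * (s.mem S).toFinset.card ≤
        (Finset.univ.filter (fun z => s.coarse z = s.comp S)).card := by
      rw [List.toFinset_card_of_nodup (hs.hole.mem_nodup S)]
      exact hhalf.trans_eq (hs.hole.compSize_eq _)
    have p1 := Input.logPotential_splitOff (inp := inp) (q := s.coarse) (k := s.comp S)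
      (fun y hy => hS y (List.mem_toFinset.1 hy)) hD hcard
    have p2 := Input.linkCount_splitOff (inp := inp) (S := {y | y ∈ s.mem S}) hS hD
    rw [← hcoe, ← hq] at p1
    rw [← hq] at p2
    have p3 := Input.linkCount_le (inp := inp) (q := s'.coarse)
    have hpos : 1 ≤ ∑ y ∈ (s.mem S).toFinset, (inp.indeg y + 1) := by
      obtain ⟨y, hy⟩ := List.exists_mem_of_ne_nil _ hne
      have := Finset.single_le_sum (f := fun y => inp.indeg y + 1) (fun _ _ => Nat.zero_le _)
        (List.mem_toFinset.2 hy)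
      omega
    unfold Memory.potential
    have ht' : t ≤ (5 * cT + 20 * cc + 210) * ((∑ y ∈ (s.mem S).toFinset, (inp.indeg y + 1)) + 1 +
        (Nat.clog 2 (Fintype.card X) + 1) *
          (Finset.univ.filter (inp.Middle s.coarse {y | y ∈ s.mem S} (s.comp S))).card) := ht
    generalize ∑ y ∈ (s.mem S).toFinset, (inp.indeg y + 1) = A at *
    generalize (Finset.univ.filter (inp.Middle s.coarse {y | y ∈ s.mem S} (s.comp S))).card = M at *
    generalize Nat.clog 2 (Fintype.card X) + 1 = L at *
    have e1 : inp.m - inp.linkCount s'.coarse + M ≤ inp.m - inp.linkCount s.coarse := by omega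
    have e2 := Nat.mul_le_mul_left L e1
    have e3 : inp.logPotential s'.coarse + L * (inp.m - inp.linkCount s'.coarse) + (A + L * M) ≤
        inp.logPotential s.coarse + L * (inp.m - inp.linkCount s.coarse) := by
      rw [mul_add] at e2; omega
    have e4 := Nat.mul_le_mul_left (10 * cT + 40 * cc + 430 + k) e3
    rw [mul_add] at e4
    -- As `A ≥ 1`, the term `A + 1` is at most `2 A`, which doubles the constant of `Split`. The
    -- summand `10 + k` pays for the loop test, the pick and the isolation of `S`.
    have e5 : 1 + (t₀ + (1 + (t + 4))) ≤ (10 * cT + 40 * cc + 430 + k) * (A + L * M) := by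
      have g1 : (5 * cT + 20 * cc + 210) * (A + 1 + L * M) ≤
          (5 * cT + 20 * cc + 210) * (2 * (A + L * M)) := Nat.mul_le_mul_left _ (by omega)
      have g2 : (10 + k) * 1 ≤ (10 + k) * (A + L * M) := Nat.mul_le_mul_left _ (by omega)
      have g3 : (10 * cT + 40 * cc + 430 + k) * (A + L * M) =
        (5 * cT + 20 * cc + 210) * (2 * (A + L * M)) + (10 + k) * (A + L * M) := by ring
      omega
    omega

theorem WhileLoop.inv [Fintype X] {cT cc k : ℕ}
    (hT : ∀ l x, T.updateTime l x ≤ cT * (l.length + 1))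
    (hcc : ∀ a b, T.compareTime a b ≤ cc) (hH : Zippable H) (hw : R.IsWeight wt)
    (hinp : inp.Encodes ξ) {pick : Comp (Mem R inp) ℕ} (hpick : Admissible k pick)
    {s s' : Mem R inp} {t : ℕ}
    (h : WhileLoop (fun s : Mem R inp => !s.work.isEmpty) (loopBody R T inp pick) s s' t)
    (hs : Inv ξ wt s) :
    Inv ξ wt s' ∧ s'.work = [] ∧ t ≤ s.potential (10 * cT + 40 * cc + 430 + k) + 1 := by
  induction h with
  | done s hc => exact ⟨hs, by simpa using hc, by omega⟩
  | step s s₁ s₂ t t' hc hp _ ih =>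
    have hwork : s.work ≠ [] := by simpa using hc
    obtain ⟨_, s₁', t₁, hp', hinv, hle⟩ :=
      ev_loopBody (T := T) hT hcc hH hw hinp hpick hs hwork
    rw [hp'] at hp
    simp only [Option.some.injEq, Prod.mk.injEq, true_and] at hp
    obtain ⟨rfl, rfl⟩ := hp
    obtain ⟨i1, i2, i3⟩ := ih hinv
    exact ⟨i1, i2, by omega⟩

/-- Induction on a bound for the potential, which falls in every iteration. -/
theorem WhileLoop.exists_of_inv [Fintype X] {cT cc k : ℕ}
    (hT : ∀ l x, T.updateTime l x ≤ cT * (l.length + 1))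
    (hcc : ∀ a b, T.compareTime a b ≤ cc) (hH : Zippable H) (hw : R.IsWeight wt)
    (hinp : inp.Encodes ξ) {pick : Comp (Mem R inp) ℕ} (hpick : Admissible k pick)
    (n : ℕ) : ∀ s : Mem R inp, Inv ξ wt s → s.potential (10 * cT + 40 * cc + 430 + k) ≤ n →
    ∃ s' t, WhileLoop (fun s : Mem R inp => !s.work.isEmpty) (loopBody R T inp pick) s s' t := by
  induction n with
  | zero =>
    intro s hs hn
    by_cases hwork : s.work = []
    · exact ⟨s, 1, .done s (by simp [hwork])⟩
    · obtain ⟨_, s₁, t₁, hp, hinv, hle⟩ :=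
        ev_loopBody (T := T) hT hcc hH hw hinp hpick hs hwork
      -- A potential of zero cannot pay for the loop test, so the list `work` is empty in this case.
      omega
  | succ n ih =>
    intro s hs hn
    by_cases hwork : s.work = []
    · exact ⟨s, 1, .done s (by simp [hwork])⟩
    · obtain ⟨_, s₁, t₁, hp, hinv, hle⟩ :=
        ev_loopBody (T := T) hT hcc hH hw hinp hpick hs hwork
      obtain ⟨s', t, h⟩ := ih s₁ hinv (by omega)
      exact ⟨s', _, .step s s₁ s' t₁ t (by simpa using hwork) hp h⟩

end Loop

/-! ### The initialization -/

/-- The map `1 → 3` is a split monomorphism, and every functor preserves these. -/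
theorem oneToThree_injective {H : Type u ⥤ Type u} :
    Function.Injective (oneToThree : H.obj One.{u} → H.obj Three.{u}) := by
  have h : ∀ b : H.obj One.{u},
      fmap H (fun _ : Three.{u} => (PUnit.unit : One.{u})) (oneToThree b) = b := by
    intro b
    unfold oneToThree
    rw [fmap_fmap]
    exact fmap_id _ b
  intro a b hab
  rw [← h a, ← h b, hab]

section SetUp

variable {H : Type u ⥤ Type u} {enc : FunctorEncoding.{u, v} H}
  {R : RefinementInterface.{u, v, w} enc} {T : R.Timing} {X : Type u} [DecidableEq X]
  {inp : Input H enc.Label X}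

theorem Input.sum_card_source [Fintype X] (inp : Input H enc.Label X) :
    ∑ x, (Finset.univ.filter fun e => (inp.graph e).1 = x).card = inp.m := by
  have := Finset.card_eq_sum_card_fiberwise (f := fun e => (inp.graph e).1)
    (s := Finset.univ) (t := Finset.univ) (fun _ _ => Finset.mem_coe.2 (Finset.mem_univ _))
  rw [Finset.card_univ, Fintype.card_fin] at this
  exact this.symm

theorem Input.Encodes.sum_card [Fintype X] {ξ : X → H.obj X} (h : inp.Encodes ξ) :
    ∑ x, Multiset.card (enc.flat X (ξ x)) = inp.m := by
  refine Eq.trans (Finset.sum_congr rfl fun x _ => ?_) inp.sum_card_source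
  rw [← h.2.2.2 x, Multiset.coe_card, List.length_map,
    ← List.toFinset_card_of_nodup ((List.nodup_finRange _).filter _)]
  congr 1
  ext e
  simp

theorem ev_readGraph {W : Type w} {K : Type u} {s : Memory X inp.m W K}
    (hts : ∀ x, s.toSub x = []) (hpr : ∀ y, s.pred y = []) :
    (forEach (List.finRange inp.m) (fun e =>
      Comp.read (fun _ => inp.graph e) >>>= fun xay =>
      addToSub xay.1 e >>>= fun _ =>
      addPred xay.2.2 e)).Ev s (fun _ s' t =>
      (∃ ts pr, s' = { s with toSub := ts, pred := pr } ∧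
        (∀ x, (ts x).Nodup ∧ ∀ e, e ∈ ts x ↔ (inp.graph e).1 = x) ∧
        (∀ y, (pr y).Nodup ∧ ∀ e, e ∈ pr y ↔ (inp.graph e).2.2 = y)) ∧
      t ≤ 4 * inp.m + 1) := by
  refine (ev_forEach_const (fun pre s' => ∃ ts pr, s' = { s with toSub := ts, pred := pr } ∧
    (∀ x, (ts x).Nodup ∧ ∀ e, e ∈ ts x ↔ e ∈ pre ∧ (inp.graph e).1 = x) ∧
    (∀ y, (pr y).Nodup ∧ ∀ e, e ∈ pr y ↔ e ∈ pre ∧ (inp.graph e).2.2 = y)) 3 ?_ ?_).mono ?_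
  · exact ⟨s.toSub, s.pred, rfl, by simp [hts], by simp [hpr]⟩
  · rintro pre e suf hl _ ⟨ts, pr, rfl, h1, h2⟩
    have he : e ∉ pre := by
      have := List.nodup_finRange inp.m
      rw [hl] at this
      exact fun hm => (List.nodup_append.1 this).2.2 e hm e (by simp) rfl
    have key : ∀ (f : Fin inp.m → X) (l : X → List (Fin inp.m)),
        (∀ x, (l x).Nodup ∧ ∀ e, e ∈ l x ↔ e ∈ pre ∧ f e = x) → ∀ x,
        (Function.update l (f e) (e :: l (f e)) x).Nodup ∧
        ∀ e', e' ∈ Function.update l (f e) (e :: l (f e)) x ↔ e' ∈ pre ++ [e] ∧ f e' = x := by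
      intro f l hl x
      by_cases hx : x = f e
      · subst hx
        rw [Function.update_self]
        refine ⟨List.nodup_cons.2 ⟨fun hm => he (((hl _).2 e).1 hm).1, (hl _).1⟩, fun e' => ?_⟩
        rw [List.mem_cons, (hl _).2, List.mem_append, List.mem_singleton]
        constructor
        · rintro (rfl | hh)
          · exact ⟨Or.inr rfl, rfl⟩
          · exact ⟨Or.inl hh.1, hh.2⟩
        · rintro ⟨hh | rfl, h3⟩
          · exact Or.inr ⟨hh, h3⟩
          · exact Or.inl rfl
      · rw [Function.update_of_ne hx]
        refine ⟨(hl x).1, fun e' => ?_⟩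
        rw [(hl x).2, List.mem_append, List.mem_singleton]
        refine and_congr_left fun h3 => (or_iff_left ?_).symm
        rintro rfl
        exact hx h3.symm
    simp only [Comp.ev_bind, Comp.ev_read, addToSub, addPred, Comp.ev_write]
    exact ⟨⟨_, _, rfl, key (fun e => (inp.graph e).1) ts h1,
      key (fun e => (inp.graph e).2.2) pr h2⟩, le_rfl⟩
  · rintro _ s' t ⟨⟨ts, pr, h0, h1, h2⟩, ht⟩
    exact ⟨⟨ts, pr, h0, by simpa using h1, by simpa using h2⟩, by simpa using ht⟩

theorem ev_insertGroups {m : ℕ} {W : Type w} {K : Type u} (gs : List (List X))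
    {s : Memory X m W K} {Z : Set X} {Y : Set ℕ} (h : s.Hole Z Y)
    {D : ℕ} (hD : D < s.nextQ) (hne : ∀ g ∈ gs, g ≠ []) (hnd : gs.flatten.Nodup)
    (hZ : ∀ x ∈ gs.flatten, x ∈ Z) :
    (forEach gs (fun g => insertBlock D g)).Ev s (fun _ s' t =>
      s.Inserted Z Y D gs s' ∧ t ≤ 7 * gs.flatten.length + 1) := by
  refine (ev_forEach (fun pre s' => s.Inserted Z Y D pre s')
    (fun g => 2 * g.length + 4) (Memory.Inserted.nil D h) ?_).mono ?_
  · rintro pre g suf rfl s' hs'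
    refine (ev_insertBlock D _ _).mono ?_
    rintro _ _ t ⟨rfl, ht⟩
    refine ⟨hs'.snoc hD (hne g (by simp)) ?_ (fun x hx => hZ x ?_), ht⟩
    · refine List.Nodup.sublist ?_ hnd
      simp
    · exact List.mem_flatten.2 ⟨g, by simp, hx⟩
  · rintro _ s' t ⟨h1, ht⟩
    refine ⟨h1, ht.trans (Nat.add_le_add_right ?_ 1)⟩
    rw [List.length_flatten, ← List.sum_map_mul_left]
    refine List.sum_le_sum fun g hg => ?_
    have := List.length_pos_of_ne_nil (hne g hg)
    omega

/-- The memory while the weights are initialized; the states of `pre` are done. -/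
structure Weighing (ξ : X → H.obj X) (wt : Set X → H.obj X → R.W) (s : Mem R inp) (pre : List X)
    (s' : Mem R inp) : Prop where
  frame : s'.pred = s.pred ∧ s'.mark = s.mark ∧ s'.blk = s.blk ∧ s'.mem = s.mem ∧
    s'.nextP = s.nextP ∧ s'.comp = s.comp ∧ s'.sub = s.sub ∧ s'.nextQ = s.nextQ ∧ s'.work = s.work
  toSub_eq : ∀ x, s'.toSub x = if x ∈ pre then [] else s.toSub x
  cells : Cells inp ξ wt {x | x ∈ pre} (fun _ _ => 0) s'.lastW s'.deref s'.nextCell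

variable {ξ : X → H.obj X} {wt : Set X → H.obj X → R.W}

/-- The labels of all edges from `x` form the bag filtered by the whole set, so the law of `init`
applies. A state without edges also receives a cell, to which no edge refers. -/
theorem ev_initWeights {cI : ℕ} (hT : ∀ b l, T.initTime b l ≤ cI * (l.length + 1))
    (hw : R.IsWeight wt) (hinp : inp.Encodes ξ) {s : Mem R inp}
    (hts : ∀ x, (s.toSub x).Nodup ∧ ∀ e, e ∈ s.toSub x ↔ (inp.graph e).1 = x) :
    (forEach inp.states (fun x =>
      Comp.read (fun s => s.toSub x) >>>= fun es =>
      mapList (fun e => (inp.graph e).2.1) es >>>= fun l =>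
      Comp.read (fun _ => inp.type x) >>>= fun b =>
      callInit R T inp b l >>>= fun wx =>
      newCell wx >>>= fun p =>
      forEach es (fun e => setLastW e p) >>>= fun _ =>
      clearToSub x)).Ev s (fun _ s' t => Weighing ξ wt s inp.states s' ∧
        t ≤ (inp.states.map fun x => (cI + 3) * (s.toSub x).length + cI + 9 + 1).sum + 1) := by
  refine ev_forEach (fun pre s' => Weighing ξ wt s pre s')
    (fun x => (cI + 3) * (s.toSub x).length + cI + 9) ?_ ?_
  · exact ⟨⟨rfl, rfl, rfl, rfl, rfl, rfl, rfl, rfl, rfl⟩, by simp,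
      ⟨by simp, by simp, by simp⟩⟩
  · rintro pre x suf hl s₁ h₁
    have hx : x ∉ pre := by
      have := hinp.1
      rw [hl] at this
      exact fun hm => (List.nodup_append.1 this).2.2 x hm x (by simp) rfl
    have hes : s₁.toSub x = s.toSub x := by rw [h₁.toSub_eq, if_neg hx]
    have hinit : R.init (inp.type x, ((s.toSub x).map fun e => (inp.graph e).2.1 : List _)) =
        wt Set.univ (ξ x) := by
      rw [← hw.init_eq, hinp.2.2.1, hinp.fil_eq (hts x).1]
      intro e
      simpa using (hts x).2 e
    have htime := hT (inp.type x) ((s.toSub x).map fun e => (inp.graph e).2.1)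
    rw [List.length_map] at htime
    simp only [Comp.ev_bind, Comp.ev_read, hes]
    refine (ev_mapList _ _ s₁).mono ?_
    rintro _ _ t₁ ⟨rfl, rfl, ht₁⟩
    simp only [callInit, Comp.ev_bind, Comp.ev_tick, Comp.ev_ret, hinit, newCell, Comp.ev_read,
      storeW, Comp.ev_write]
    refine (ev_setLastW _ _ _).mono ?_
    rintro _ _ t₂ ⟨rfl, ht₂⟩
    simp only [clearToSub, Comp.ev_write]
    refine ⟨⟨h₁.frame, fun x' => ?_, ?_⟩, ?_⟩
    · by_cases hx' : x' = x
      · subst hx'; simp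
      · simp only [Function.update_of_ne hx', h₁.toSub_eq, List.mem_append, List.mem_singleton,
          hx', or_false]
    · have := h₁.cells.start (x := x) (hts x).2
      convert this using 1
      ext x'
      simp [or_comm]
    · ring_nf at htime ⊢
      omega

variable [LinearOrder (H.obj Three.{u})] [Fintype X]

/-- With `X/Q` trivial, stability says that `H!` identifies the states of a block, which is grouping
by type. Behaviourally equivalent states have equal types because every map to `1` is constant. -/
theorem ev_setUp {cI cc : ℕ} (hT : ∀ b l, T.initTime b l ≤ cI * (l.length + 1))
    (hcc : ∀ a b, T.compareTime a b ≤ cc) (hw : R.IsWeight wt) (hinp : inp.Encodes ξ) :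
    (setUp R T inp).Ev (Memory.empty X inp.m R.W (H.obj Three.{u})) (fun _ s' t => Inv ξ wt s' ∧
      t ≤ (cI + 5 * cc + 40) *
        (inp.m + Fintype.card X * (Nat.clog 2 (Fintype.card X) + 1) + 1)) := by
  have hlen : inp.states.length = Fintype.card X := by
    rw [← List.toFinset_card_of_nodup hinp.1, ← Finset.card_univ]
    congr 1
    ext x
    simp [hinp.2.1]
  unfold setUp
  rw [Comp.ev_bind, Comp.ev_tick, Comp.ev_bind]
  refine (ev_readGraph (fun _ => rfl) (fun _ => rfl)).mono ?_
  rintro _ _ t₁ ⟨⟨ts, pr, rfl, hts, hpr⟩, ht₁⟩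
  rw [Comp.ev_bind]
  refine (ev_initWeights hT hw hinp hts).mono ?_
  rintro _ s₂ t₂ ⟨h₂, ht₂⟩
  obtain ⟨f1, f2, f3, f4, f5, f6, f7, f8, f9⟩ := h₂.frame
  rw [Comp.ev_bind]
  refine (ev_group hcc _ s₂ inp.states).mono ?_
  rintro gs s₂ t₃ ⟨rfl, ⟨N, ht₃, hN, -⟩, hperm, hgs⟩
  simp only [newQ, Comp.ev_bind, Comp.ev_read, Comp.ev_write, Comp.ev_ret]
  have e8 : s₂.nextQ = 0 := f8
  have hhole : ({ s₂ with nextQ := s₂.nextQ + 1 } : Mem R inp).Hole Set.univ ∅ := by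
    have e4 : s₂.mem = fun _ => [] := f4
    have e7 : s₂.sub = fun _ => [] := f7
    have e9 : s₂.work = [] := f9
    exact ⟨by simp [e4], by simp [e4], by simp [e4, e7], by simp [e7], by simp [e7, e9],
      by simp [e9], by simp, by simp, by simp [e7]⟩
  refine (ev_insertGroups gs hhole (D := s₂.nextQ) (Nat.lt_succ_self _) hgs.ne_nil
    (hperm.nodup_iff.2 hinp.1) (fun x _ => Set.mem_univ x)).mono ?_
  rintro _ s₃ t₄ ⟨h₃, ht₄⟩
  have hall : ∀ x, x ∈ gs.flatten := fun x => hperm.mem_iff.2 (hinp.2.1 x)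
  have hq : s₃.coarse = fun _ => 0 := by
    funext x
    exact ((h₃.blk_new x (hall x)).2.2).trans e8
  have hblk : ∀ x y, s₃.blk x = s₃.blk y ↔ inp.type x = inp.type y := by
    intro x y
    obtain ⟨g, hg, hx⟩ := List.mem_flatten.1 (hall x)
    obtain ⟨g', hg', hy⟩ := List.mem_flatten.1 (hall y)
    rw [eq_comm, h₃.blk_eq g hg x hx y (hall y)]
    constructor
    · exact fun hyg => oneToThree_injective (hgs.key_eq g hg x hx y hyg)
    · intro hxy
      by_cases hgg : g = g'
      · rwa [hgg]
      · exfalso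
        have hsym : Std.Symm (fun g g' : List X =>
            ∀ a ∈ g, ∀ b ∈ g', oneToThree (inp.type a) ≠ oneToThree (inp.type b)) :=
          ⟨fun a b hab p hp r hr => (hab r hr p hp).symm⟩
        exact hgs.pairwise.forall hg hg' hgg x hx y hy (congrArg _ hxy)
  refine ⟨⟨?_, fun x => ?_, fun B => ?_, ?_, ?_, ?_, fun x y hxy => ?_, fun x y hxy => ?_⟩, ?_⟩
  · have := h₃.hole
    convert this using 1
    symm
    rw [Set.sdiff_eq_empty]
    exact fun x _ => hall x
  · rw [h₃.edges.toSub]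
    exact (h₂.toSub_eq x).trans (if_pos (hinp.2.1 x))
  · rw [h₃.edges.mark]
    exact congrFun f2 B
  · rw [h₃.edges.pred]
    intro y
    exact (congrFun f1 y).symm ▸ (hpr y).1
  · rw [h₃.edges.pred]
    intro y e
    rw [show s₂.pred y = pr y from congrFun f1 y]
    exact (hpr y).2 e
  · rw [hq, h₃.edges.lastW, h₃.edges.deref, h₃.edges.nextCell]
    have := h₂.cells
    convert this using 1
    ext x
    simp [hinp.2.1]
  · rw [hq]
    have := (hblk x y).1 hxy
    rw [hinp.2.2.1, hinp.2.2.1] at this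
    -- The projection to the single class `0` factors through `1`, so equality of types is enough.
    have := congrArg (fmap H (fun _ : One.{u} => (⟨0⟩ : ULift.{u} ℕ))) this
    rwa [fmap_fmap, fmap_fmap] at this
  · rw [hblk, hinp.2.2.1, hinp.2.2.1]
    exact hxy.fmap_eq fun _ _ _ => rfl
  · have e1 : (inp.states.map fun x => (cI + 3) * (ts x).length + cI + 9 + 1).sum =
        (cI + 3) * inp.m + (cI + 10) * Fintype.card X := by
      rw [← List.sum_toFinset _ hinp.1]
      have e2 : inp.states.toFinset = Finset.univ := by
        ext x; simp [hinp.2.1]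
      have e3 : ∑ x, (ts x).length = inp.m := by
        refine Eq.trans ?_ inp.sum_card_source
        refine Finset.sum_congr rfl fun x _ => ?_
        rw [← List.toFinset_card_of_nodup (hts x).1]
        congr 1
        ext e
        simp [(hts x).2]
      rw [e2]
      simp only [add_assoc]
      rw [Finset.sum_add_distrib, ← Finset.mul_sum, e3, Finset.sum_const, Finset.card_univ,
        smul_eq_mul]
      ring
    simp only at ht₂
    rw [e1] at ht₂
    rw [hperm.length_eq, hlen] at ht₄
    rw [hlen] at ht₃ hN ⊢
    -- No majority is needed here: the initial grouping happens once, and sorting all `n` states is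
    -- affordable.
    have e5 : N * (Nat.clog 2 N + 1) ≤ Fintype.card X * (Nat.clog 2 (Fintype.card X) + 1) :=
      Nat.mul_le_mul hN (Nat.add_le_add_right (Nat.clog_mono_right 2 hN) 1)
    have e6 : Fintype.card X ≤ Fintype.card X * (Nat.clog 2 (Fintype.card X) + 1) :=
      Nat.le_mul_of_pos_right _ (Nat.succ_pos _)
    generalize Fintype.card X * (Nat.clog 2 (Fintype.card X) + 1) = G at *
    generalize N * (Nat.clog 2 N + 1) = G' at *
    generalize Fintype.card X = n at *
    have e7 := Nat.mul_le_mul_left (cc + 5) e5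
    have e8 := Nat.mul_le_mul_left (4 * cc + 13) e6
    have e9 := Nat.mul_le_mul_left (cI + 10) e6
    have e10 : 0 ≤ cc * inp.m := Nat.zero_le _
    nlinarith

end SetUp

/-! ### The total running time -/

section Total

variable {H : Type u ⥤ Type u} {enc : FunctorEncoding.{u, v} H}
  {R : RefinementInterface.{u, v, w} enc} {T : R.Timing} {X : Type u} [DecidableEq X]
  {inp : Input H enc.Label X} {ξ : X → H.obj X} [LinearOrder (H.obj Three.{u})] [Fintype X]

theorem Runs.exists {c k : ℕ} (hI : ∀ b l, T.initTime b l ≤ c * (l.length + 1))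
    (hT : ∀ l x, T.updateTime l x ≤ c * (l.length + 1)) (hcc : ∀ a b, T.compareTime a b ≤ c)
    (hH : Zippable H) (hinp : inp.Encodes ξ) {pick : Comp (Mem R inp) ℕ}
    (hpick : Admissible k pick) : ∃ s t, Runs R T inp pick s t := by
  obtain ⟨wt, hw⟩ := R.exists_isWeight X
  obtain ⟨_, s₀, t₀, h₀, hinv, -⟩ := ev_setUp hI hcc hw hinp
  obtain ⟨s, t, h⟩ := WhileLoop.exists_of_inv hT hcc hH hw hinp hpick _ s₀ hinv le_rfl
  exact ⟨s, _, s₀, t₀, t, h₀, h, rfl⟩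

theorem Runs.computesQuotient_and_le {c k : ℕ}
    (hI : ∀ b l, T.initTime b l ≤ c * (l.length + 1))
    (hT : ∀ l x, T.updateTime l x ≤ c * (l.length + 1)) (hcc : ∀ a b, T.compareTime a b ≤ c)
    (hH : Zippable H) (hinp : inp.Encodes ξ) {pick : Comp (Mem R inp) ℕ}
    (hpick : Admissible k pick) {s : Mem R inp} {t : ℕ} (h : Runs R T inp pick s t) :
    ComputesQuotient ξ s ∧
      t ≤ (6 * c + 40) *
          (inp.m + Fintype.card X * (Nat.clog 2 (Fintype.card X) + 1) + 1) +
        (50 * c + 430 + k) * ((inp.m + Fintype.card X) * Nat.log 2 (Fintype.card X) +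
          (Nat.clog 2 (Fintype.card X) + 1) * inp.m) + 1 := by
  obtain ⟨wt, hw⟩ := R.exists_isWeight X
  obtain ⟨s₀, t₀, t₁, h₀, h₁, rfl⟩ := h
  obtain ⟨_, s₀', t₀', h₀', hinv, ht₀⟩ := ev_setUp hI hcc hw hinp
  -- Computations are deterministic, so the memory reached in the given run is the one for which the
  -- invariant was shown.
  rw [h₀] at h₀'
  simp only [Option.some.injEq, Prod.mk.injEq] at h₀'
  obtain ⟨-, rfl, rfl⟩ := h₀'
  obtain ⟨hs, hwork, ht₁⟩ := WhileLoop.inv hT hcc hH hw hinp hpick h₁ hinv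
  refine ⟨hs.computesQuotient hwork, ?_⟩
  rw [← add_mul] at ht₁
  rw [show c + 5 * c + 40 = 6 * c + 40 by ring] at ht₀
  have hpot : s₀.potential ((10 + 40) * c + 430 + k) ≤
      (50 * c + 430 + k) * ((inp.m + Fintype.card X) * Nat.log 2 (Fintype.card X) +
        (Nat.clog 2 (Fintype.card X) + 1) * inp.m) :=
    Nat.mul_le_mul_left _ (Nat.add_le_add inp.logPotential_le
      (Nat.mul_le_mul_left _ (Nat.sub_le _ _)))
  omega

end Total

/-- The two summands are the bounds for the initialization and for the main loop. -/
theorem total_le_of_two_le {a b m n : ℕ} (hn : 2 ≤ n) :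
    a * (m + n * (Nat.clog 2 n + 1) + 1) +
        b * ((m + n) * Nat.log 2 n + (Nat.clog 2 n + 1) * m) + 1 ≤
      (4 * a + 4 * b + 1) * ((m + n) * Nat.log 2 n) := by
  have h1 : 1 ≤ Nat.log 2 n := Nat.log_pos one_lt_two hn
  -- The ceiling logarithm exceeds the floor logarithm by at most one, and the latter is at least
  -- one for `n ≥ 2`.
  have h2 : Nat.clog 2 n + 1 ≤ 3 * Nat.log 2 n := by
    have : Nat.clog 2 n ≤ Nat.log 2 n + 1 :=
      Nat.clog_le_of_le_pow (Nat.lt_pow_succ_log_self one_lt_two n).le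
    omega
  have h3 := Nat.mul_le_mul_left n h2
  have h4 := Nat.mul_le_mul_right m h2
  have h5 := Nat.mul_le_mul_left m h1
  have h6 := Nat.mul_le_mul_left n h1
  have h7 : m + n * (Nat.clog 2 n + 1) + 1 ≤ 4 * ((m + n) * Nat.log 2 n) := by
    rw [add_mul]; linarith
  have h8 : (m + n) * Nat.log 2 n + (Nat.clog 2 n + 1) * m ≤ 4 * ((m + n) * Nat.log 2 n) := by
    rw [add_mul]; nlinarith
  have h9 : 1 ≤ (m + n) * Nat.log 2 n := Nat.mul_pos (by omega) h1
  have h10 := Nat.mul_le_mul_left a h7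
  have h11 := Nat.mul_le_mul_left b h8
  nlinarith

/-- Both logarithms vanish, and what remains is linear in `m` with an additive constant. -/
theorem total_le_of_le_one {a b m n : ℕ} (hn : n ≤ 1) :
    a * (m + n * (Nat.clog 2 n + 1) + 1) +
        b * ((m + n) * Nat.log 2 n + (Nat.clog 2 n + 1) * m) + 1 ≤
      (4 * a + 4 * b + 1) * (m + 1) := by
  have h1 : Nat.log 2 n = 0 := Nat.log_of_lt (by omega)
  have h2 : Nat.clog 2 n = 0 := Nat.clog_of_right_le_one hn 2
  rw [h1, h2]
  have := Nat.mul_le_mul_left a hn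
  nlinarith [Nat.zero_le (a * m), Nat.zero_le (b * m)]

end CoalgRefine

theorem mainTheorem1 {H : Type u ⥤ Type u} (hH : CoalgRefine.Zippable H)
    (enc : CoalgRefine.FunctorEncoding.{u, v} H)
    (R : CoalgRefine.RefinementInterface.{u, v, w} enc)
    [LinearOrder (H.obj CoalgRefine.Three.{u})]
    (T : R.Timing) (hT : T.Linear) :
    (∃ k : ℕ, ∀ (X : Type u) (m : ℕ),
      CoalgRefine.Admissible k
        (CoalgRefine.pickSmaller (X := X) (m := m) (W := R.W)
          (K := H.obj CoalgRefine.Three.{u}))) ∧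
    ∀ k : ℕ, ∃ c : ℝ, ∀ (X : Type u) [Fintype X] [DecidableEq X] (ξ : X → H.obj X)
      (inp : CoalgRefine.Input H enc.Label X), inp.Encodes ξ →
      ∀ (n m : ℕ), n = Fintype.card X → m = ∑ x : X, Multiset.card (enc.flat X (ξ x)) →
      ∀ pick : CoalgRefine.Comp (CoalgRefine.Mem R inp) ℕ, CoalgRefine.Admissible k pick →
        (∃ s t, CoalgRefine.Runs R T inp pick s t) ∧
        ∀ s t, CoalgRefine.Runs R T inp pick s t →
          CoalgRefine.ComputesQuotient ξ s ∧
          (2 ≤ n → (t : ℝ) ≤ c * ((m + n) * Real.log n)) ∧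
          (n ≤ 1 → (t : ℝ) ≤ c * (m + 1)) := by
  refine ⟨⟨6, fun X m => CoalgRefine.admissible_pickSmaller X m _ _⟩, fun k => ?_⟩
  obtain ⟨c, hI, hU, hcc⟩ := hT
  set d : ℕ := 4 * (6 * c + 40) + 4 * (50 * c + 430 + k) + 1 with hd
  have hlog : 0 < Real.log 2 := Real.log_pos one_lt_two
  -- Dividing by `log 2` changes the base of the logarithm. As `log 2 ≤ 1`, the same constant also
  -- serves the case `n ≤ 1`.
  refine ⟨d / Real.log 2, ?_⟩
  rintro X _ _ ξ inp hinp n m rfl hm pick hpick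
  rw [hinp.sum_card] at hm
  refine ⟨CoalgRefine.Runs.exists hI hU hcc hH hinp hpick, fun s t h => ?_⟩
  obtain ⟨hq, ht⟩ := h.computesQuotient_and_le hI hU hcc hH hinp hpick
  rw [← hm] at ht
  refine ⟨hq, fun hn => ?_, fun hn => ?_⟩
  · calc (t : ℝ) ≤ ((d * ((m + Fintype.card X) * Nat.log 2 (Fintype.card X)) : ℕ) : ℝ) :=
        Nat.cast_le.2 (ht.trans (CoalgRefine.total_le_of_two_le hn))
      _ = d * ((m + Fintype.card X) * (Nat.log 2 (Fintype.card X) : ℝ)) := by push_cast; rfl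
      _ ≤ d * ((m + Fintype.card X) * Real.logb 2 (Fintype.card X)) := by
        gcongr
        exact_mod_cast Real.natLog_le_logb (Fintype.card X) 2
      _ = d / Real.log 2 * ((m + Fintype.card X) * Real.log (Fintype.card X)) := by
        rw [Real.logb]; ring
  · calc (t : ℝ) ≤ ((d * (m + 1) : ℕ) : ℝ) :=
        Nat.cast_le.2 (ht.trans (CoalgRefine.total_le_of_le_one hn))
      _ = d * (m + 1) := by push_cast; rfl
      _ ≤ d / Real.log 2 * (m + 1) := by
        gcongr
        refine le_div_self (Nat.cast_nonneg d) hlog ?_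
        exact (Real.log_le_sub_one_of_pos two_pos).trans (by norm_num)
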